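/- Consider the search version of LS Max $c$-Cut. The input consists of a finite simple undirected graph $G=(V,E)$ with $n$ vertices and maximum degree $\Delta$, a number of colors $c\in\mathbb N$, edge weights $\omega:E\to\mathbb Q$, a $c$-coloring $\chi:V\to\{1,\dots,c\}$, and $k\in\mathbb N$. For a $c$-coloring $\chi'$ (not necessarily proper) let $\omega(E(\chi'))$ be the total weight of the edges whose endpoints have different colors under $\chi'$. The task is to output a $c$-coloring $\chi'$ that differs from $\chi$ on at most $k$ vertices and satisfies $\omega(E(\chi'))>\omega(E(\chi))$, or to report correctly that no such coloring exists. Theorem. There is an algorithm that solves this problem on every input and whose running time, on the inputs with $\Delta\ge 2$ and $k\ge 1$, is $$O\bigl((3e)^k\cdot(\Delta-1)^{k+1}\cdot c\cdot k^3\cdot n\bigr),$$ where $e$ is Euler's number and the constant hidden in the $O$ is absolute. Here the graph is given by adjacency lists (in arbitrary order), time is counted on a random access machine with words of $O(k+\log n+\log c)$ bits and the usual word operations at unit cost, and each addition, subtraction or comparison of two weights takes one unit of time. -/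

import Mathlib

namespace LSCut

/-! ### The problem -/

/-- An instance of LS Max `c`-Cut: a finite simple graph with vertices `0, …, n - 1`, the number `c`
of colors, rational edge weights (of either sign), a `c`-coloring and the search radius `k`. The
`c` colors are the elements of `Fin c`. -/
structure Instance where
  n : ℕ
  G : SimpleGraph (Fin n)
  c : ℕ
  ω : G.edgeSet → ℚ
  χ : Fin n → Fin c
  k : ℕ

namespace Instance

variable (I : Instance)

/-- `D_flip(χ₁, χ₂)`: the vertices on which the two colorings differ. -/
def flip (χ₁ χ₂ : Fin I.n → Fin I.c) : Finset (Fin I.n) :=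
  Finset.univ.filter fun v => χ₁ v ≠ χ₂ v

/-- The edge `e` is properly colored by `χ`: its two endpoints have different colors. -/
def ProperlyColored (χ : Fin I.n → Fin I.c) (e : I.G.edgeSet) : Prop :=
  ∃ u v : Fin I.n, (e : Sym2 (Fin I.n)) = s(u, v) ∧ χ u ≠ χ v

open Classical in
/-- `ω(E(χ))`: the total weight of the properly colored edges. -/
noncomputable def cutWeight (χ : Fin I.n → Fin I.c) : ℚ :=
  ∑ e ∈ Finset.univ.filter (fun e : I.G.edgeSet => I.ProperlyColored χ e), I.ω e

/-- `χ'` is an improving `k`-neighbor of the coloring of the instance. -/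
def Improving (χ' : Fin I.n → Fin I.c) : Prop :=
  (I.flip I.χ χ').card ≤ I.k ∧ I.cutWeight I.χ < I.cutWeight χ'

open Classical in
/-- The degree of a vertex. -/
noncomputable def degree (v : Fin I.n) : ℕ := I.G.degree v

open Classical in
/-- The maximum degree `Δ(G)`. -/
noncomputable def maxDegree : ℕ := I.G.maxDegree

end Instance

/-! ### The machine model

A random access machine with words of `w` bits, programmed in a structured way. It has word
registers and finitely many (per program) word arrays, and, separately, registers and arrays for
weights. Weights are exact rational numbers that can only be moved, added, subtracted and compared.
Each operation on words or weights, each memory access and each test takes one unit of time. -/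

/-- Memory contents: word registers, word arrays (name, then index), weight registers, weight
arrays (name, then index). -/
structure State where
  reg : ℕ → ℕ
  arr : ℕ → ℕ → ℕ
  wreg : ℕ → ℚ
  warr : ℕ → ℕ → ℚ

/-- The operations on words; `sub` is truncated at `0`, `div` and `mod` are the quotient and the
remainder (with quotient `0` and remainder `a` for `a` divided by `0`). -/
inductive WordOp
  | add | sub | mul | div | mod | and | or | xor

def WordOp.eval : WordOp → ℕ → ℕ → ℕ
  | .add, a, b => a + b
  | .sub, a, b => a - b
  | .mul, a, b => a * b
  | .div, a, b => a / b
  | .mod, a, b => a % b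
  | .and, a, b => a &&& b
  | .or, a, b => a ||| b
  | .xor, a, b => a ^^^ b

/-- Word expressions: constants, registers, array entries, operations. -/
inductive Expr
  | const (m : ℕ)
  | reg (x : ℕ)
  | get (a : ℕ) (i : Expr)
  | op (o : WordOp) (e f : Expr)

namespace Expr

def eval (s : State) : Expr → ℕ
  | const m => m
  | reg x => s.reg x
  | get a i => s.arr a (i.eval s)
  | op o e f => o.eval (e.eval s) (f.eval s)

/-- Time to evaluate: one unit for each node. -/
def cost : Expr → ℕ
  | const _ => 1
  | reg _ => 1
  | get _ i => 1 + i.cost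
  | op _ e f => 1 + e.cost + f.cost

/-- No overflow: every value that occurs in the evaluation fits into a word of `w` bits. -/
def Fits (w : ℕ) (s : State) : Expr → Prop
  | const m => m < 2 ^ w
  | reg x => s.reg x < 2 ^ w
  | get a i => i.Fits w s ∧ s.arr a (i.eval s) < 2 ^ w
  | op o e f => e.Fits w s ∧ f.Fits w s ∧ o.eval (e.eval s) (f.eval s) < 2 ^ w

end Expr

/-- Weight expressions. -/
inductive WExpr
  | zero
  | reg (x : ℕ)
  | get (a : ℕ) (i : Expr)
  | add (u v : WExpr)
  | sub (u v : WExpr)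

namespace WExpr

def eval (s : State) : WExpr → ℚ
  | zero => 0
  | reg x => s.wreg x
  | get a i => s.warr a (i.eval s)
  | add u v => u.eval s + v.eval s
  | sub u v => u.eval s - v.eval s

def cost : WExpr → ℕ
  | zero => 1
  | reg _ => 1
  | get _ i => 1 + i.cost
  | add u v => 1 + u.cost + v.cost
  | sub u v => 1 + u.cost + v.cost

/-- No overflow in the index computations. -/
def Fits (w : ℕ) (s : State) : WExpr → Prop
  | zero => True
  | reg _ => True
  | get _ i => i.Fits w s
  | add u v => u.Fits w s ∧ v.Fits w s
  | sub u v => u.Fits w s ∧ v.Fits w s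

end WExpr

/-- Tests: comparisons of words, comparison of weights, Boolean combinations. -/
inductive Test
  | lt (e f : Expr)
  | eq (e f : Expr)
  | wlt (u v : WExpr)
  | not (b : Test)
  | and (b d : Test)

namespace Test

def Holds (s : State) : Test → Prop
  | lt e f => e.eval s < f.eval s
  | eq e f => e.eval s = f.eval s
  | wlt u v => u.eval s < v.eval s
  | not b => ¬ b.Holds s
  | and b d => b.Holds s ∧ d.Holds s

def cost : Test → ℕ
  | lt e f => 1 + e.cost + f.cost
  | eq e f => 1 + e.cost + f.cost
  | wlt u v => 1 + u.cost + v.cost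
  | not b => 1 + b.cost
  | and b d => 1 + b.cost + d.cost

def Fits (w : ℕ) (s : State) : Test → Prop
  | lt e f => e.Fits w s ∧ f.Fits w s
  | eq e f => e.Fits w s ∧ f.Fits w s
  | wlt u v => u.Fits w s ∧ v.Fits w s
  | not b => b.Fits w s
  | and b d => b.Fits w s ∧ d.Fits w s

end Test

/-- Programs. -/
inductive Program
  | skip
  | set (x : ℕ) (e : Expr)
  | store (a : ℕ) (i e : Expr)
  | wset (x : ℕ) (u : WExpr)
  | wstore (a : ℕ) (i : Expr) (u : WExpr)
  | seq (p q : Program)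
  | ite (b : Test) (p q : Program)
  | loop (b : Test) (p : Program)

namespace State

def setReg (s : State) (x v : ℕ) : State :=
  { s with reg := Function.update s.reg x v }

def setArr (s : State) (a i v : ℕ) : State :=
  { s with arr := Function.update s.arr a (Function.update (s.arr a) i v) }

def setWReg (s : State) (x : ℕ) (v : ℚ) : State :=
  { s with wreg := Function.update s.wreg x v }

def setWArr (s : State) (a i : ℕ) (v : ℚ) : State :=
  { s with warr := Function.update s.warr a (Function.update (s.warr a) i v) }

end State

/-- `Runs w p s t s'`: on a machine with words of `w` bits, the program `p` started in the state `s`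
halts after `t` units of time in the state `s'`, and no overflow occurs in the run. -/
inductive Runs (w : ℕ) : Program → State → ℕ → State → Prop
  | skip (s : State) : Runs w .skip s 1 s
  | set (s : State) (x : ℕ) (e : Expr) (he : e.Fits w s) :
      Runs w (.set x e) s (1 + e.cost) (s.setReg x (e.eval s))
  | store (s : State) (a : ℕ) (i e : Expr) (hi : i.Fits w s) (he : e.Fits w s) :
      Runs w (.store a i e) s (1 + i.cost + e.cost) (s.setArr a (i.eval s) (e.eval s))
  | wset (s : State) (x : ℕ) (u : WExpr) (hu : u.Fits w s) :
      Runs w (.wset x u) s (1 + u.cost) (s.setWReg x (u.eval s))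
  | wstore (s : State) (a : ℕ) (i : Expr) (u : WExpr) (hi : i.Fits w s) (hu : u.Fits w s) :
      Runs w (.wstore a i u) s (1 + i.cost + u.cost) (s.setWArr a (i.eval s) (u.eval s))
  | seq (p q : Program) (s s₁ s₂ : State) (t₁ t₂ : ℕ) (hp : Runs w p s t₁ s₁)
      (hq : Runs w q s₁ t₂ s₂) : Runs w (.seq p q) s (t₁ + t₂) s₂
  | iteTrue (b : Test) (p q : Program) (s s₁ : State) (t : ℕ) (hf : b.Fits w s)
      (hb : b.Holds s) (hp : Runs w p s t s₁) : Runs w (.ite b p q) s (1 + b.cost + t) s₁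
  | iteFalse (b : Test) (p q : Program) (s s₁ : State) (t : ℕ) (hf : b.Fits w s)
      (hb : ¬ b.Holds s) (hq : Runs w q s t s₁) : Runs w (.ite b p q) s (1 + b.cost + t) s₁
  | loopDone (b : Test) (p : Program) (s : State) (hf : b.Fits w s) (hb : ¬ b.Holds s) :
      Runs w (.loop b p) s (1 + b.cost) s
  | loopStep (b : Test) (p : Program) (s s₁ s₂ : State) (t₁ t₂ : ℕ) (hf : b.Fits w s)
      (hb : b.Holds s) (hp : Runs w p s t₁ s₁) (hl : Runs w (.loop b p) s₁ t₂ s₂) :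
      Runs w (.loop b p) s (1 + b.cost + t₁ + t₂) s₂

/-- The machine is deterministic: running time and final state are determined by the start. -/
theorem Runs.deterministic {w : ℕ} {p : Program} {s : State} {t t' : ℕ} {s₁ s₂ : State}
    (h₁ : Runs w p s t s₁) (h₂ : Runs w p s t' s₂) : t = t' ∧ s₁ = s₂ := by
  induction h₁ generalizing t' s₂ with
  | skip | set | store | wset | wstore => cases h₂; exact ⟨rfl, rfl⟩
  | seq p q s a b t₁ t₂ hp hq ih₁ ih₂ =>
    cases h₂ with
    | seq _ _ _ _ _ _ _ hp' hq' =>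
      obtain ⟨rfl, rfl⟩ := ih₁ hp'
      obtain ⟨rfl, rfl⟩ := ih₂ hq'
      exact ⟨rfl, rfl⟩
  | iteTrue b p q s a t hf hb hp ih =>
    cases h₂ with
    | iteTrue _ _ _ _ _ _ _ _ hp' => obtain ⟨rfl, rfl⟩ := ih hp'; exact ⟨rfl, rfl⟩
    | iteFalse _ _ _ _ _ _ _ hb' => exact absurd hb hb'
  | iteFalse b p q s a t hf hb hp ih =>
    cases h₂ with
    | iteTrue _ _ _ _ _ _ _ hb' => exact absurd hb' hb
    | iteFalse _ _ _ _ _ _ _ _ hp' => obtain ⟨rfl, rfl⟩ := ih hp'; exact ⟨rfl, rfl⟩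
  | loopDone b p s hf hb =>
    cases h₂ with
    | loopDone => exact ⟨rfl, rfl⟩
    | loopStep _ _ _ _ _ _ _ _ hb' => exact absurd hb' hb
  | loopStep b p s a d t₁ t₂ hf hb hp hl ih₁ ih₂ =>
    cases h₂ with
    | loopDone _ _ _ _ hb' => exact absurd hb hb'
    | loopStep _ _ _ _ _ _ _ _ _ hp' hl' =>
      obtain ⟨rfl, rfl⟩ := ih₁ hp'
      obtain ⟨rfl, rfl⟩ := ih₂ hl'
      exact ⟨rfl, rfl⟩

/-! ### Input and output -/

/-- The memory holds the instance and is zero elsewhere. Registers `0`, `1`, `2` hold `n`, `c`, `k`.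
The graph is given by adjacency lists, in an arbitrary order, one after the other: array `0` holds
at `v` the position where the list of the vertex `v` starts; array `1` holds the neighbors and
weight array `0` the weights of the corresponding edges. Array `2` holds the coloring. -/
structure Encodes (I : Instance) (s : State) : Prop where
  reg_n : s.reg 0 = I.n
  reg_c : s.reg 1 = I.c
  reg_k : s.reg 2 = I.k
  start_zero : s.arr 0 0 = 0
  start_succ : ∀ v : Fin I.n, s.arr 0 (v + 1) = s.arr 0 v + I.degree v
  /-- Each neighbor of `v` stands, with the weight of the edge, in the list of `v`. As the length of
  the list is the degree of `v`, it stands there exactly once, and the list has no other entries. -/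
  neighbor : ∀ (v u : Fin I.n) (h : I.G.Adj v u), ∃ j, s.arr 0 v ≤ j ∧ j < s.arr 0 (v + 1) ∧
    s.arr 1 j = u ∧ s.warr 0 j = I.ω ⟨s(v, u), I.G.mem_edgeSet.2 h⟩
  color : ∀ v : Fin I.n, s.arr 2 v = I.χ v
  reg_rest : ∀ x, 3 ≤ x → s.reg x = 0
  start_rest : ∀ i, I.n < i → s.arr 0 i = 0
  neighbor_rest : ∀ i, s.arr 0 I.n ≤ i → s.arr 1 i = 0
  color_rest : ∀ i, I.n ≤ i → s.arr 2 i = 0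
  arr_rest : ∀ a i, 3 ≤ a → s.arr a i = 0
  wreg_rest : ∀ x, s.wreg x = 0
  weight_rest : ∀ i, s.arr 0 I.n ≤ i → s.warr 0 i = 0
  warr_rest : ∀ a i, 1 ≤ a → s.warr a i = 0

/-- The memory holds a correct answer: either register `0` holds `1` and array `0` holds an improving
`k`-neighbor, or register `0` holds `0` and there is no improving `k`-neighbor. -/
def Answers (I : Instance) (s : State) : Prop :=
  (s.reg 0 = 1 ∧ ∃ χ' : Fin I.n → Fin I.c, I.Improving χ' ∧ ∀ v : Fin I.n, s.arr 0 v = χ' v) ∨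
  (s.reg 0 = 0 ∧ ¬ ∃ χ' : Fin I.n → Fin I.c, I.Improving χ')

end LSCut

/-!
An improving coloring may be assumed to recolor a part that a local search can find, and this local
search has few possible courses.

*Locality.* Let `f` be an improving coloring and `D` the set of the recolored vertices. Starting
from some `v ∈ D`, breadth-first search inside `D` finds a set `A` such that no edge joins `A` to
`D \ A`. Then the changes on `A` and on `D \ A` contribute independently to the weight
(`Data.mono_split`), so one of the two partial recolorings improves, and by induction on `|D|` there
is an improvement on a set found by such a search (`Data.Improves.exists_local`).

*Few candidates.* The program does not know `D`. Put `d = max 1 (Δ - 1)`. In a breadth-first search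
with a list of at most `k` vertices, number the moments at which a vertex outside the list is seen;
these are the slots. The root passes at most `d + 1` slots and every other list vertex at most `d`,
since its parent is in the list already (`Data.slot_run_le`). Hence the search inside `D` is
determined by the slots at which vertices are taken, and these can be completed to `k - 1` numbers
below `k * d + 1` (`Data.exists_comb`; the superfluous slots are put behind all those that are
passed). For each root the program goes through all `(k * d + 1).choose (k - 1)` combinations, in
colexicographic order; the rank of a combination in this order proves that none is missed and that
there are no more steps than this (`rank_next`, `rank_injective`).

*The best recoloring of one candidate.* For a list of `m ≤ k` vertices, a dynamic program computes,
for each number `i` of colors and each set `X` of list positions, the least change of the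
monochromatic weight when `X` is colored with the first `i` colors: a class of color `i` is split
off, which gives `3 ^ m` pairs of a set and a part of it for each color. The change is a sum of
contributions of the color classes (`Data.sum_gain`), so this is correct (`table_le`,
`wp_recolor`). The pairs are coded by ternary numbers; sets are coded by those with digits `0`
and `1`.

*Time.* A pair costs `O(k² d)` steps, a combination `O(3^k c k² d)`, and
`(k * d + 1).choose (k - 1) ≤ (d (k + 1))^(k - 1) / (k - 1)! ≤ d^(k - 1) e^(k + 1)`
(`choose_mul_unit_le`), which gives even a little less than the bound claimed.

The programs are verified by a calculus for total correctness with running time (`WP`); each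
`wp_…` lemma describes the effect of one program and bounds its time, with generous constants.
Besides the stated effect, `WP.conseq` supplies that the contents of memory stay below `2 ^ w` and
that whatever a program does not write is unchanged.
-/

namespace LSCut

open LSCut.Expr (reg const get)

/-! ### Reasoning about programs -/

infixr:30 " ;; " => Program.seq

instance : Add Expr := ⟨Expr.op .add⟩
instance : Sub Expr := ⟨Expr.op .sub⟩
instance : Mul Expr := ⟨Expr.op .mul⟩
instance : Div Expr := ⟨Expr.op .div⟩
instance : Mod Expr := ⟨Expr.op .mod⟩
instance : Add WExpr := ⟨WExpr.add⟩
instance : Sub WExpr := ⟨WExpr.sub⟩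

/-- The number of words of `w` bits. -/
def cap (w : ℕ) : ℕ := 2 ^ w

section Simp

variable (w : ℕ) (s : State) (e f : Expr) (u v : WExpr)

@[simp] theorem Expr.eval_const (m : ℕ) : (const m).eval s = m := rfl
@[simp] theorem Expr.eval_reg (x : ℕ) : (reg x).eval s = s.reg x := rfl
@[simp] theorem Expr.eval_get (a : ℕ) : (get a e).eval s = s.arr a (e.eval s) := rfl
@[simp] theorem Expr.eval_add : (e + f).eval s = e.eval s + f.eval s := rfl
@[simp] theorem Expr.eval_sub : (e - f).eval s = e.eval s - f.eval s := rfl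
@[simp] theorem Expr.eval_mul : (e * f).eval s = e.eval s * f.eval s := rfl
@[simp] theorem Expr.eval_div : (e / f).eval s = e.eval s / f.eval s := rfl
@[simp] theorem Expr.eval_mod : (e % f).eval s = e.eval s % f.eval s := rfl

@[simp] theorem Expr.cost_const (m : ℕ) : (const m).cost = 1 := rfl
@[simp] theorem Expr.cost_reg (x : ℕ) : (reg x).cost = 1 := rfl
@[simp] theorem Expr.cost_get (a : ℕ) : (get a e).cost = 1 + e.cost := rfl
@[simp] theorem Expr.cost_add : (e + f).cost = 1 + e.cost + f.cost := rfl
@[simp] theorem Expr.cost_sub : (e - f).cost = 1 + e.cost + f.cost := rfl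
@[simp] theorem Expr.cost_mul : (e * f).cost = 1 + e.cost + f.cost := rfl
@[simp] theorem Expr.cost_div : (e / f).cost = 1 + e.cost + f.cost := rfl
@[simp] theorem Expr.cost_mod : (e % f).cost = 1 + e.cost + f.cost := rfl

@[simp] theorem Expr.fits_const (m : ℕ) : (const m).Fits w s ↔ m < cap w := Iff.rfl
@[simp] theorem Expr.fits_reg (x : ℕ) : (reg x).Fits w s ↔ s.reg x < cap w := Iff.rfl
@[simp] theorem Expr.fits_get (a : ℕ) :
    (get a e).Fits w s ↔ e.Fits w s ∧ s.arr a (e.eval s) < cap w := Iff.rfl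
@[simp] theorem Expr.fits_add :
    (e + f).Fits w s ↔ e.Fits w s ∧ f.Fits w s ∧ e.eval s + f.eval s < cap w := Iff.rfl
@[simp] theorem Expr.fits_sub :
    (e - f).Fits w s ↔ e.Fits w s ∧ f.Fits w s ∧ e.eval s - f.eval s < cap w := Iff.rfl
@[simp] theorem Expr.fits_mul :
    (e * f).Fits w s ↔ e.Fits w s ∧ f.Fits w s ∧ e.eval s * f.eval s < cap w := Iff.rfl
@[simp] theorem Expr.fits_div :
    (e / f).Fits w s ↔ e.Fits w s ∧ f.Fits w s ∧ e.eval s / f.eval s < cap w := Iff.rfl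
@[simp] theorem Expr.fits_mod :
    (e % f).Fits w s ↔ e.Fits w s ∧ f.Fits w s ∧ e.eval s % f.eval s < cap w := Iff.rfl

@[simp] theorem WExpr.eval_zero : WExpr.zero.eval s = 0 := rfl
@[simp] theorem WExpr.eval_reg (x : ℕ) : (WExpr.reg x).eval s = s.wreg x := rfl
@[simp] theorem WExpr.eval_get (a : ℕ) : (WExpr.get a e).eval s = s.warr a (e.eval s) := rfl
@[simp] theorem WExpr.eval_add : (u + v).eval s = u.eval s + v.eval s := rfl
@[simp] theorem WExpr.eval_sub : (u - v).eval s = u.eval s - v.eval s := rfl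
@[simp] theorem WExpr.cost_zero : WExpr.zero.cost = 1 := rfl
@[simp] theorem WExpr.cost_reg (x : ℕ) : (WExpr.reg x).cost = 1 := rfl
@[simp] theorem WExpr.cost_get (a : ℕ) : (WExpr.get a e).cost = 1 + e.cost := rfl
@[simp] theorem WExpr.cost_add : (u + v).cost = 1 + u.cost + v.cost := rfl
@[simp] theorem WExpr.cost_sub : (u - v).cost = 1 + u.cost + v.cost := rfl
@[simp] theorem WExpr.fits_zero : WExpr.zero.Fits w s := trivial
@[simp] theorem WExpr.fits_reg (x : ℕ) : (WExpr.reg x).Fits w s := trivial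
@[simp] theorem WExpr.fits_get (a : ℕ) : (WExpr.get a e).Fits w s ↔ e.Fits w s := Iff.rfl
@[simp] theorem WExpr.fits_add : (u + v).Fits w s ↔ u.Fits w s ∧ v.Fits w s := Iff.rfl
@[simp] theorem WExpr.fits_sub : (u - v).Fits w s ↔ u.Fits w s ∧ v.Fits w s := Iff.rfl

variable (x y a b i z : ℕ) (q : ℚ)

@[simp] theorem State.setReg_reg :
    (s.setReg x z).reg y = if y = x then z else s.reg y := by
  simp [State.setReg, Function.update_apply]
@[simp] theorem State.setReg_arr : (s.setReg x z).arr = s.arr := rfl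
@[simp] theorem State.setReg_wreg : (s.setReg x z).wreg = s.wreg := rfl
@[simp] theorem State.setReg_warr : (s.setReg x z).warr = s.warr := rfl
@[simp] theorem State.setArr_reg : (s.setArr a i z).reg = s.reg := rfl
@[simp] theorem State.setArr_arr :
    (s.setArr a i z).arr b = if b = a then Function.update (s.arr a) i z else s.arr b := by
  simp [State.setArr, Function.update_apply]
@[simp] theorem State.setArr_wreg : (s.setArr a i z).wreg = s.wreg := rfl
@[simp] theorem State.setArr_warr : (s.setArr a i z).warr = s.warr := rfl
@[simp] theorem State.setWReg_reg : (s.setWReg x q).reg = s.reg := rfl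
@[simp] theorem State.setWReg_arr : (s.setWReg x q).arr = s.arr := rfl
@[simp] theorem State.setWReg_wreg :
    (s.setWReg x q).wreg y = if y = x then q else s.wreg y := by
  simp [State.setWReg, Function.update_apply]
@[simp] theorem State.setWReg_warr : (s.setWReg x q).warr = s.warr := rfl
@[simp] theorem State.setWArr_reg : (s.setWArr a i q).reg = s.reg := rfl
@[simp] theorem State.setWArr_arr : (s.setWArr a i q).arr = s.arr := rfl
@[simp] theorem State.setWArr_wreg : (s.setWArr a i q).wreg = s.wreg := rfl
@[simp] theorem State.setWArr_warr :
    (s.setWArr a i q).warr b = if b = a then Function.update (s.warr a) i q else s.warr b := by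
  simp [State.setWArr, Function.update_apply]

end Simp

/-- All words in the memory fit into `w` bits. -/
structure Bounded (w : ℕ) (s : State) : Prop where
  reg : ∀ x, s.reg x < cap w
  arr : ∀ a i, s.arr a i < cap w

theorem Expr.Fits.eval_lt {w : ℕ} {s : State} {e : Expr} (h : e.Fits w s) : e.eval s < cap w := by
  cases e with
  | const m => exact h
  | reg x => exact h
  | get a i => exact h.2
  | op o e f => exact h.2.2

theorem Bounded.setReg {w : ℕ} {s : State} (h : Bounded w s) {x v : ℕ} (hv : v < cap w) :
    Bounded w (s.setReg x v) := by
  refine ⟨fun y => ?_, h.arr⟩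
  rw [State.setReg_reg]
  split
  · exact hv
  · exact h.reg y

theorem Bounded.setArr {w : ℕ} {s : State} (h : Bounded w s) {a i v : ℕ} (hv : v < cap w) :
    Bounded w (s.setArr a i v) := by
  refine ⟨h.reg, fun b j => ?_⟩
  rw [State.setArr_arr]
  split
  · rw [Function.update_apply]
    split
    · exact hv
    · exact h.arr a j
  · exact h.arr b j

theorem Bounded.setWReg {w : ℕ} {s : State} (h : Bounded w s) {x : ℕ} {v : ℚ} :
    Bounded w (s.setWReg x v) := ⟨h.reg, h.arr⟩

theorem Bounded.setWArr {w : ℕ} {s : State} (h : Bounded w s) {a i : ℕ} {v : ℚ} :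
    Bounded w (s.setWArr a i v) := ⟨h.reg, h.arr⟩

theorem Runs.bounded {w : ℕ} {p : Program} {s : State} {t : ℕ} {s' : State} (h : Runs w p s t s')
    (hb : Bounded w s) : Bounded w s' := by
  induction h with
  | skip => exact hb
  | set s x e he => exact hb.setReg he.eval_lt
  | store s a i e hi he => exact hb.setArr he.eval_lt
  | wset => exact ⟨hb.reg, hb.arr⟩
  | wstore => exact ⟨hb.reg, hb.arr⟩
  | seq p q s s₁ s₂ t₁ t₂ hp hq ih₁ ih₂ => exact ih₂ (ih₁ hb)
  | iteTrue b p q s s₁ t hf h hp ih => exact ih hb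
  | iteFalse b p q s s₁ t hf h hp ih => exact ih hb
  | loopDone => exact hb
  | loopStep b p s s₁ s₂ t₁ t₂ hf h hp hl ih₁ ih₂ => exact ih₂ (ih₁ hb)

namespace Program

/-- Whether the program can write word register `x`. -/
def writesReg (x : ℕ) : Program → Bool
  | set y _ => x == y
  | seq p q => p.writesReg x || q.writesReg x
  | ite _ p q => p.writesReg x || q.writesReg x
  | loop _ p => p.writesReg x
  | _ => false

/-- Whether the program can write into word array `a`. -/
def writesArr (a : ℕ) : Program → Bool
  | store b _ _ => a == b
  | seq p q => p.writesArr a || q.writesArr a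
  | ite _ p q => p.writesArr a || q.writesArr a
  | loop _ p => p.writesArr a
  | _ => false

/-- Whether the program can write weight register `x`. -/
def writesWReg (x : ℕ) : Program → Bool
  | wset y _ => x == y
  | seq p q => p.writesWReg x || q.writesWReg x
  | ite _ p q => p.writesWReg x || q.writesWReg x
  | loop _ p => p.writesWReg x
  | _ => false

/-- Whether the program can write into weight array `a`. -/
def writesWArr (a : ℕ) : Program → Bool
  | wstore b _ _ => a == b
  | seq p q => p.writesWArr a || q.writesWArr a
  | ite _ p q => p.writesWArr a || q.writesWArr a
  | loop _ p => p.writesWArr a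
  | _ => false

end Program

/-- The states `s` and `s'` agree on every register and array that `p` does not write. -/
structure Frame (p : Program) (s s' : State) : Prop where
  reg : ∀ x, p.writesReg x = false → s'.reg x = s.reg x
  arr : ∀ a, p.writesArr a = false → s'.arr a = s.arr a
  wreg : ∀ x, p.writesWReg x = false → s'.wreg x = s.wreg x
  warr : ∀ a, p.writesWArr a = false → s'.warr a = s.warr a

theorem Frame.refl (p : Program) (s : State) : Frame p s s :=
  ⟨fun _ _ => rfl, fun _ _ => rfl, fun _ _ => rfl, fun _ _ => rfl⟩

theorem Frame.trans {p : Program} {s₁ s₂ s₃ : State} (h₁ : Frame p s₁ s₂) (h₂ : Frame p s₂ s₃) :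
    Frame p s₁ s₃ :=
  ⟨fun x h => (h₂.reg x h).trans (h₁.reg x h), fun x h => (h₂.arr x h).trans (h₁.arr x h),
    fun x h => (h₂.wreg x h).trans (h₁.wreg x h), fun x h => (h₂.warr x h).trans (h₁.warr x h)⟩

/-- A program that writes less keeps more. -/
theorem Frame.mono {p q : Program} {s s' : State} (h : Frame p s s')
    (hr : ∀ x, q.writesReg x = false → p.writesReg x = false)
    (ha : ∀ x, q.writesArr x = false → p.writesArr x = false)
    (hw : ∀ x, q.writesWReg x = false → p.writesWReg x = false)
    (hv : ∀ x, q.writesWArr x = false → p.writesWArr x = false) : Frame q s s' :=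
  ⟨fun x hx => h.reg x (hr x hx), fun x hx => h.arr x (ha x hx),
    fun x hx => h.wreg x (hw x hx), fun x hx => h.warr x (hv x hx)⟩

theorem Runs.frame {w : ℕ} {p : Program} {s : State} {t : ℕ} {s' : State} (h : Runs w p s t s') :
    Frame p s s' := by
  induction h with
  | skip => exact Frame.refl _ _
  | set s x e he =>
    refine ⟨fun y hy => ?_, fun _ _ => rfl, fun _ _ => rfl, fun _ _ => rfl⟩
    simp only [Program.writesReg, beq_eq_false_iff_ne] at hy
    simp [hy]
  | store s a i e hi he =>
    refine ⟨fun _ _ => rfl, fun y hy => ?_, fun _ _ => rfl, fun _ _ => rfl⟩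
    simp only [Program.writesArr, beq_eq_false_iff_ne] at hy
    simp [hy]
  | wset s x e he =>
    refine ⟨fun _ _ => rfl, fun _ _ => rfl, fun y hy => ?_, fun _ _ => rfl⟩
    simp only [Program.writesWReg, beq_eq_false_iff_ne] at hy
    simp [hy]
  | wstore s a i e hi he =>
    refine ⟨fun _ _ => rfl, fun _ _ => rfl, fun _ _ => rfl, fun y hy => ?_⟩
    simp only [Program.writesWArr, beq_eq_false_iff_ne] at hy
    simp [hy]
  | seq p q s s₁ s₂ t₁ t₂ hp hq ih₁ ih₂ =>
    exact (ih₁.mono (by simp_all [Program.writesReg]) (by simp_all [Program.writesArr])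
      (by simp_all [Program.writesWReg]) (by simp_all [Program.writesWArr])).trans
      (ih₂.mono (by simp_all [Program.writesReg]) (by simp_all [Program.writesArr])
      (by simp_all [Program.writesWReg]) (by simp_all [Program.writesWArr]))
  | iteTrue b p q s s₁ t hf h hp ih =>
    exact ih.mono (by simp_all [Program.writesReg]) (by simp_all [Program.writesArr])
      (by simp_all [Program.writesWReg]) (by simp_all [Program.writesWArr])
  | iteFalse b p q s s₁ t hf h hp ih =>
    exact ih.mono (by simp_all [Program.writesReg]) (by simp_all [Program.writesArr])
      (by simp_all [Program.writesWReg]) (by simp_all [Program.writesWArr])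
  | loopDone => exact Frame.refl _ _
  | loopStep b p s s₁ s₂ t₁ t₂ hf h hp hl ih₁ ih₂ =>
    exact Frame.trans (ih₁.mono (q := .loop b p) (fun _ h => h) (fun _ h => h) (fun _ h => h)
      (fun _ h => h)) ih₂

/-- Total correctness with time: the program `p` started in `s` halts without overflow, and its
running time and its final state satisfy `Q`. -/
def WP (w : ℕ) (p : Program) (s : State) (Q : ℕ → State → Prop) : Prop :=
  ∃ t s', Runs w p s t s' ∧ Q t s'

section WP

variable {w : ℕ} {s : State} {Q : ℕ → State → Prop}

theorem WP.mono {p : Program} {Q' : ℕ → State → Prop} (h : WP w p s Q)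
    (hQ : ∀ t s', Q t s' → Q' t s') : WP w p s Q' := by
  obtain ⟨t, s', hr, hq⟩ := h
  exact ⟨t, s', hr, hQ t s' hq⟩

/-- The rule of consequence, which also supplies that words stay in bounds and that registers and
arrays which are not written keep their values. -/
theorem WP.conseq {p : Program} {Q' : ℕ → State → Prop} (h : WP w p s Q) (hb : Bounded w s)
    (hQ : ∀ t s', Bounded w s' → Frame p s s' → Q t s' → Q' t s') : WP w p s Q' := by
  obtain ⟨t, s', hr, hq⟩ := h
  exact ⟨t, s', hr, hQ t s' (hr.bounded hb) hr.frame hq⟩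

theorem wp_skip : WP w .skip s Q ↔ Q 1 s := by
  constructor
  · rintro ⟨t, s', hr, hq⟩
    cases hr
    exact hq
  · exact fun h => ⟨_, _, .skip s, h⟩

theorem wp_set {x : ℕ} {e : Expr} :
    WP w (.set x e) s Q ↔ e.Fits w s ∧ Q (1 + e.cost) (s.setReg x (e.eval s)) := by
  constructor
  · rintro ⟨t, s', hr, hq⟩
    cases hr with | set _ _ _ he => exact ⟨he, hq⟩
  · exact fun h => ⟨_, _, .set s x e h.1, h.2⟩

theorem wp_store {a : ℕ} {i e : Expr} :
    WP w (.store a i e) s Q ↔ i.Fits w s ∧ e.Fits w s ∧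
      Q (1 + i.cost + e.cost) (s.setArr a (i.eval s) (e.eval s)) := by
  constructor
  · rintro ⟨t, s', hr, hq⟩
    cases hr with | store _ _ _ _ hi he => exact ⟨hi, he, hq⟩
  · exact fun h => ⟨_, _, .store s a i e h.1 h.2.1, h.2.2⟩

theorem wp_wset {x : ℕ} {u : WExpr} :
    WP w (.wset x u) s Q ↔ u.Fits w s ∧ Q (1 + u.cost) (s.setWReg x (u.eval s)) := by
  constructor
  · rintro ⟨t, s', hr, hq⟩
    cases hr with | wset _ _ _ he => exact ⟨he, hq⟩
  · exact fun h => ⟨_, _, .wset s x u h.1, h.2⟩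

theorem wp_wstore {a : ℕ} {i : Expr} {u : WExpr} :
    WP w (.wstore a i u) s Q ↔ i.Fits w s ∧ u.Fits w s ∧
      Q (1 + i.cost + u.cost) (s.setWArr a (i.eval s) (u.eval s)) := by
  constructor
  · rintro ⟨t, s', hr, hq⟩
    cases hr with | wstore _ _ _ _ hi he => exact ⟨hi, he, hq⟩
  · exact fun h => ⟨_, _, .wstore s a i u h.1 h.2.1, h.2.2⟩

theorem wp_seq {p q : Program} :
    WP w (p ;; q) s Q ↔ WP w p s fun t₁ s₁ => WP w q s₁ fun t₂ s₂ => Q (t₁ + t₂) s₂ := by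
  constructor
  · rintro ⟨t, s', hr, hq⟩
    cases hr with | seq _ _ _ s₁ _ t₁ t₂ hp hq' => exact ⟨t₁, s₁, hp, t₂, s', hq', hq⟩
  · rintro ⟨t₁, s₁, h₁, t₂, s₂, h₂, hq⟩
    exact ⟨_, _, .seq p q s s₁ s₂ t₁ t₂ h₁ h₂, hq⟩

theorem wp_ite {b : Test} {p q : Program} :
    WP w (.ite b p q) s Q ↔ b.Fits w s ∧ (b.Holds s → WP w p s fun t => Q (1 + b.cost + t)) ∧
      (¬ b.Holds s → WP w q s fun t => Q (1 + b.cost + t)) := by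
  constructor
  · rintro ⟨t, s', hr, hq⟩
    cases hr with
    | iteTrue _ _ _ _ _ t hf hb hp => exact ⟨hf, fun _ => ⟨_, _, hp, hq⟩, fun h => absurd hb h⟩
    | iteFalse _ _ _ _ _ t hf hb hp => exact ⟨hf, fun h => absurd h hb, fun _ => ⟨_, _, hp, hq⟩⟩
  · rintro ⟨hf, h₁, h₂⟩
    by_cases hb : b.Holds s
    · obtain ⟨t, s', hr, hq⟩ := h₁ hb
      exact ⟨_, _, .iteTrue b p q s s' t hf hb hr, hq⟩
    · obtain ⟨t, s', hr, hq⟩ := h₂ hb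
      exact ⟨_, _, .iteFalse b p q s s' t hf hb hr, hq⟩

/-- The rule for loops: `Inv i s` holds before each pass, where `i` bounds the number of passes to
come, and each pass takes time at most `τ`. -/
theorem wp_loop {b : Test} {p : Program} (N τ : ℕ) (Inv : ℕ → State → Prop) (hb : Bounded w s)
    (h0 : Inv N s)
    (hstep : ∀ i s', Inv i s' → Bounded w s' → Frame (.loop b p) s s' →
      b.Fits w s' ∧ (b.Holds s' → WP w p s' fun t s'' => t ≤ τ ∧ ∃ j < i, Inv j s'')) :
    WP w (.loop b p) s fun t s' =>
      t ≤ N * (1 + b.cost + τ) + (1 + b.cost) ∧ ¬ b.Holds s' ∧ ∃ i, Inv i s' := by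
  suffices H : ∀ N s', Inv N s' → Bounded w s' → Frame (.loop b p) s s' →
      WP w (.loop b p) s' fun t s' =>
        t ≤ N * (1 + b.cost + τ) + (1 + b.cost) ∧ ¬ b.Holds s' ∧ ∃ i, Inv i s' from
    H N s h0 hb (Frame.refl _ _)
  intro N
  induction N using Nat.strong_induction_on with
  | _ N ih =>
    intro s₁ hI hb₁ hF
    obtain ⟨hf, hbody⟩ := hstep N s₁ hI hb₁ hF
    by_cases hc : b.Holds s₁
    · obtain ⟨t, s₂, hr, ht, j, hj, hI₂⟩ := hbody hc
      have hF₂ : Frame (.loop b p) s₁ s₂ :=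
        ⟨hr.frame.reg, hr.frame.arr, hr.frame.wreg, hr.frame.warr⟩
      obtain ⟨t', s₃, hr', ht', hn, hI₃⟩ := ih j hj s₂ hI₂ (hr.bounded hb₁) (hF.trans hF₂)
      refine ⟨_, s₃, .loopStep b p s₁ s₂ s₃ t t' hf hc hr hr', ?_, hn, hI₃⟩
      have : (j + 1) * (1 + b.cost + τ) ≤ N * (1 + b.cost + τ) := Nat.mul_le_mul_right _ hj
      rw [Nat.add_mul] at this
      omega
    · exact ⟨_, s₁, .loopDone b p s₁ hf hc, by omega, hc, N, hI⟩

end WP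

@[simp] theorem Test.holds_lt (s : State) (e f : Expr) :
    (Test.lt e f).Holds s ↔ e.eval s < f.eval s := Iff.rfl
@[simp] theorem Test.holds_eq (s : State) (e f : Expr) :
    (Test.eq e f).Holds s ↔ e.eval s = f.eval s := Iff.rfl
@[simp] theorem Test.holds_wlt (s : State) (e f : WExpr) :
    (Test.wlt e f).Holds s ↔ e.eval s < f.eval s := Iff.rfl
@[simp] theorem Test.holds_not (s : State) (b : Test) : b.not.Holds s ↔ ¬ b.Holds s := Iff.rfl
@[simp] theorem Test.holds_and (s : State) (b d : Test) :
    (b.and d).Holds s ↔ b.Holds s ∧ d.Holds s := Iff.rfl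
@[simp] theorem Test.fits_lt (w : ℕ) (s : State) (e f : Expr) :
    (Test.lt e f).Fits w s ↔ e.Fits w s ∧ f.Fits w s := Iff.rfl
@[simp] theorem Test.fits_eq (w : ℕ) (s : State) (e f : Expr) :
    (Test.eq e f).Fits w s ↔ e.Fits w s ∧ f.Fits w s := Iff.rfl
@[simp] theorem Test.fits_wlt (w : ℕ) (s : State) (e f : WExpr) :
    (Test.wlt e f).Fits w s ↔ e.Fits w s ∧ f.Fits w s := Iff.rfl
@[simp] theorem Test.fits_not (w : ℕ) (s : State) (b : Test) :
    b.not.Fits w s ↔ b.Fits w s := Iff.rfl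
@[simp] theorem Test.fits_and (w : ℕ) (s : State) (b d : Test) :
    (b.and d).Fits w s ↔ b.Fits w s ∧ d.Fits w s := Iff.rfl
@[simp] theorem Test.cost_lt (e f : Expr) : (Test.lt e f).cost = 1 + e.cost + f.cost := rfl
@[simp] theorem Test.cost_eq (e f : Expr) : (Test.eq e f).cost = 1 + e.cost + f.cost := rfl
@[simp] theorem Test.cost_wlt (e f : WExpr) : (Test.wlt e f).cost = 1 + e.cost + f.cost := rfl
@[simp] theorem Test.cost_not (b : Test) : b.not.cost = 1 + b.cost := rfl
@[simp] theorem Test.cost_and (b d : Test) : (b.and d).cost = 1 + b.cost + d.cost := rfl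

/-! ### The program -/

/-! Names of the registers and arrays. `rN`, `rC`, `rK` and `aStart`, `aNbr`, `aCol`, `wWt` are
those of the input. The list of the vertices found from the root `rV` is `aSet`, of length `rSize`;
the combination tried is in `aComb`, its slots being below `rM`; the table `wTab` of the dynamic
program and the recorded choices `aChoice` have the entry for `i` colors and the code `X` at the
index `i * 3 ^ rSize + X`. -/

notation "rN" => (0 : ℕ)
notation "rC" => (1 : ℕ)
notation "rK" => (2 : ℕ)
notation "rFound" => (3 : ℕ)
notation "rV" => (4 : ℕ)
notation "rD" => (5 : ℕ)
notation "rM" => (6 : ℕ)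
notation "rI" => (7 : ℕ)
notation "rSize" => (8 : ℕ)
notation "rJ" => (9 : ℕ)
notation "rE" => (10 : ℕ)
notation "rU" => (11 : ℕ)
notation "rPos" => (12 : ℕ)
notation "rSlot" => (13 : ℕ)
notation "rT" => (14 : ℕ)
notation "rX" => (15 : ℕ)
notation "rMask" => (16 : ℕ)
notation "rRest" => (17 : ℕ)
notation "rPow" => (18 : ℕ)
notation "rCol" => (19 : ℕ)
notation "rB" => (20 : ℕ)
notation "rFull" => (21 : ℕ)
notation "aStart" => (0 : ℕ)
notation "aNbr" => (1 : ℕ)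
notation "aCol" => (2 : ℕ)
notation "aComb" => (3 : ℕ)
notation "aSet" => (4 : ℕ)
notation "aDig" => (5 : ℕ)
notation "aChoice" => (6 : ℕ)
notation "wWt" => (0 : ℕ)
notation "wTab" => (1 : ℕ)
notation "wAcc" => (0 : ℕ)

/-- Searches the vertex in `rU` in the list `aSet`; the position found, or the length of the list,
is left in `rPos`. -/
def findPos : Program :=
  .set rPos (const 0) ;;
  .loop (.and (.lt (reg rPos) (reg rSize)) (.not (.eq (get aSet (reg rPos)) (reg rU))))
    (.set rPos (reg rPos + const 1))

/-- Adds to `wAcc` the contribution of the edge at position `rE` to the change of the doubled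
weight of the monochromatic edges, seen from the list vertex number `rJ`, if that vertex and the
list vertices with digit `1` receive the color `rCol`. -/
def edgeGain : Program :=
  -- an edge inside the list is met from both ends, hence counted once each time, else twice
  .set rU (get aNbr (reg rE)) ;;
  findPos ;;
  .ite (.lt (reg rPos) (reg rSize))
    (.ite (.eq (get aDig (reg rPos)) (const 1))
      (.wset wAcc (.reg wAcc + .get wWt (reg rE))) .skip ;;
    .ite (.eq (get aCol (reg rU)) (get aCol (get aSet (reg rJ))))
      (.wset wAcc (.reg wAcc - .get wWt (reg rE))) .skip)
    (.ite (.eq (get aCol (reg rU)) (reg rCol))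
      (.wset wAcc (.reg wAcc + (.get wWt (reg rE) + .get wWt (reg rE)))) .skip ;;
    .ite (.eq (get aCol (reg rU)) (get aCol (get aSet (reg rJ))))
      (.wset wAcc (.reg wAcc - (.get wWt (reg rE) + .get wWt (reg rE)))) .skip) ;;
  .set rE (reg rE + const 1)

/-- Computes in `wAcc` the total contribution of the list vertices with digit `1`. -/
def classGain : Program :=
  .wset wAcc .zero ;;
  .set rJ (const 0) ;;
  .loop (.lt (reg rJ) (reg rSize))
    (.ite (.eq (get aDig (reg rJ)) (const 1))
      (.set rE (get aStart (get aSet (reg rJ))) ;;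
      .loop (.lt (reg rE) (get aStart (get aSet (reg rJ) + const 1))) edgeGain) .skip ;;
    .set rJ (reg rJ + const 1))

/-- Writes the ternary digits of `rT` to `aDig`. The code of the set of positions with nonzero digit
goes to `rMask`, that of the set of positions with digit `2` to `rRest`. -/
def splitCode : Program :=
  .set rX (reg rT) ;;
  .set rMask (const 0) ;;
  .set rRest (const 0) ;;
  .set rPow (const 1) ;;
  .set rJ (const 0) ;;
  .loop (.lt (reg rJ) (reg rSize))
    (.store aDig (reg rJ) (reg rX % const 3) ;;
    .ite (.eq (get aDig (reg rJ)) (const 0)) .skip (.set rMask (reg rMask + reg rPow)) ;;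
    .ite (.eq (get aDig (reg rJ)) (const 2)) (.set rRest (reg rRest + reg rPow)) .skip ;;
    .set rX (reg rX / const 3) ;;
    .set rPow (reg rPow * const 3) ;;
    .set rJ (reg rJ + const 1))

/-- Updates a table entry for the first `rCol + 1` colors with the split `rT`, and moves to the next
split. A split is a set of positions (digits `1` and `2`) with its part that receives the color
`rCol` (digit `1`); the rest (digit `2`) is left to the smaller colors. -/
def relax : Program :=
  splitCode ;;
  classGain ;;
  .wset wAcc (.get wTab (reg rCol * reg rB + reg rRest) + .reg wAcc) ;;
  -- A split without rest always overwrites the entry: of all splits of its set it comes first, so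
  -- this initializes the entry. Color `0` allows no other splits.
  .ite (.not (.and (.not (.eq (reg rRest) (const 0)))
      (.not (.and (.lt (const 0) (reg rCol))
        (.wlt (.reg wAcc) (.get wTab ((reg rCol + const 1) * reg rB + reg rMask)))))))
    (.wstore wTab ((reg rCol + const 1) * reg rB + reg rMask) (.reg wAcc) ;;
    .store aChoice ((reg rCol + const 1) * reg rB + reg rMask) (reg rT)) .skip ;;
  .set rT (reg rT + const 1)

/-- Sets `rB` to `3 ^ m` and `rFull` to the code of the whole list, for a list of length `m`. -/
def powers : Program :=
  .set rB (const 1) ;;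
  .set rFull (const 0) ;;
  .set rJ (const 0) ;;
  .loop (.lt (reg rJ) (reg rSize))
    (.set rFull (reg rFull + reg rB) ;;
    .set rB (reg rB * const 3) ;;
    .set rJ (reg rJ + const 1))

/-- The dynamic program over colors and subsets of the list. -/
def fillTable : Program :=
  powers ;;
  .wstore wTab (const 0) .zero ;;
  .set rCol (const 0) ;;
  .loop (.lt (reg rCol) (reg rC))
    (.set rT (const 0) ;;
    .loop (.lt (reg rT) (reg rB)) relax ;;
    .set rCol (reg rCol + const 1))

/-- Gives the color `rCol` to the list vertices with digit `1`. -/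
def paintClass : Program :=
  .set rJ (const 0) ;;
  .loop (.lt (reg rJ) (reg rSize))
    (.ite (.eq (get aDig (reg rJ)) (const 1))
      (.store aCol (get aSet (reg rJ)) (reg rCol)) .skip ;;
    .set rJ (reg rJ + const 1))

/-- Recolors the list according to the choices recorded by the dynamic program. -/
def recolor : Program :=
  .set rMask (reg rFull) ;;
  .set rCol (reg rC) ;;
  .loop (.lt (const 0) (reg rCol))
    (.set rT (get aChoice (reg rCol * reg rB + reg rMask)) ;;
    .set rCol (reg rCol - const 1) ;;
    splitCode ;;
    paintClass ;;
    .set rMask (reg rRest))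

/-- Examines the edge at position `rE` in the breadth-first search: if its other end is not in the
list, it takes the next slot number, and it is put into the list if the combination says so. -/
def visitEdge : Program :=
  .set rU (get aNbr (reg rE)) ;;
  findPos ;;
  .ite (.lt (reg rPos) (reg rSize)) .skip
    (.ite (.and (.lt (reg rSize) (reg rK)) (.eq (get aComb (reg rSize - const 1)) (reg rSlot)))
      (.store aSet (reg rSize) (reg rU) ;; .set rSize (reg rSize + const 1)) .skip ;;
    .set rSlot (reg rSlot + const 1)) ;;
  .set rE (reg rE + const 1)

/-- Builds the list of vertices that the combination in `aComb` selects from the root `rV`. -/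
def explore : Program :=
  .store aSet (const 0) (reg rV) ;;
  .set rSize (const 1) ;;
  .set rSlot (const 0) ;;
  .set rJ (const 0) ;;
  .loop (.lt (reg rJ) (reg rSize))
    (.set rE (get aStart (get aSet (reg rJ))) ;;
    .loop (.lt (reg rE) (get aStart (get aSet (reg rJ) + const 1))) visitEdge ;;
    .set rJ (reg rJ + const 1))

/-- The first combination `0, …, k - 2`, followed by the sentinels `M` and `0`; the latter ends the
loop of `nextComb` at the former. -/
def initComb : Program :=
  .set rI (const 0) ;;
  .loop (.lt (reg rI) (reg rK - const 1))
    (.store aComb (reg rI) (reg rI) ;;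
    .set rI (reg rI + const 1)) ;;
  .store aComb (reg rK - const 1) (reg rM) ;;
  .store aComb (reg rK) (const 0)

/-- The next combination in colexicographic order; after the last one the sentinel `M` changes. -/
def nextComb : Program :=
  .set rI (const 0) ;;
  .loop (.eq (get aComb (reg rI) + const 1) (get aComb (reg rI + const 1)))
    (.store aComb (reg rI) (reg rI) ;;
    .set rI (reg rI + const 1)) ;;
  .store aComb (reg rI) (get aComb (reg rI) + const 1)

/-- Examines one combination. -/
def tryComb : Program :=
  explore ;;
  fillTable ;;
  .ite (.wlt (.get wTab (reg rC * reg rB + reg rFull)) .zero)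
    (.set rFound (const 1) ;; recolor) nextComb

/-- Examines all roots and combinations until an improvement is found. -/
def search : Program :=
  .set rV (const 0) ;;
  .loop (.and (.lt (reg rV) (reg rN)) (.eq (reg rFound) (const 0)))
    (initComb ;;
    .loop (.and (.eq (get aComb (reg rK - const 1)) (reg rM)) (.eq (reg rFound) (const 0)))
      tryComb ;;
    .set rV (reg rV + const 1))

/-- Sets `rD` to the maximum of `1` and the maximum degree minus `1`. -/
def degBound : Program :=
  .set rD (const 1) ;;
  .set rV (const 0) ;;
  .loop (.lt (reg rV) (reg rN))
    (.ite (.lt (reg rD + const 1) (get aStart (reg rV + const 1) - get aStart (reg rV)))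
      (.set rD (get aStart (reg rV + const 1) - get aStart (reg rV) - const 1)) .skip ;;
    .set rV (reg rV + const 1))

/-- Copies the coloring and the flag to the place of the output. -/
def output : Program :=
  .set rV (const 0) ;;
  .loop (.lt (reg rV) (reg rN))
    (.store aStart (reg rV) (get aCol (reg rV)) ;;
    .set rV (reg rV + const 1)) ;;
  .set rN (reg rFound)

/-- The program that solves LS Max `c`-Cut. -/
def solver : Program :=
  .ite (.lt (const 0) (reg rK))
    (degBound ;; .set rM (reg rK * reg rD + const 1) ;; search) .skip ;;
  output

/-! ### Instances as arrays -/

/-- The content of the input memory, together with a number `d` such that all degrees are at most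
`d + 1`. -/
structure Data where
  n : ℕ
  c : ℕ
  k : ℕ
  d : ℕ
  st : ℕ → ℕ
  nb : ℕ → ℕ
  col : ℕ → ℕ
  wt : ℕ → ℚ

namespace Data

variable (G : Data)

/-- The positions of the adjacency list of `v`. -/
def adj (v : ℕ) : Finset ℕ := Finset.Ico (G.st v) (G.st (v + 1))

/-- The weight matrix of the graph. -/
def W (v u : ℕ) : ℚ := ∑ e ∈ G.adj v, if G.nb e = u then G.wt e else 0

/-- Twice the total weight of the monochromatic edges of the coloring `f`. -/
def mono (f : ℕ → ℕ) : ℚ :=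
  ∑ v ∈ Finset.range G.n, ∑ u ∈ Finset.range G.n, if f u = f v then G.W v u else 0

/-- The arrays describe a simple graph with degrees at most `d + 1` and a `c`-coloring. -/
structure Valid : Prop where
  st_mono : ∀ v < G.n, G.st v ≤ G.st (v + 1)
  deg_le : ∀ v < G.n, G.st (v + 1) ≤ G.st v + (G.d + 1)
  nb_lt : ∀ v < G.n, ∀ e ∈ G.adj v, G.nb e < G.n
  symm : ∀ v < G.n, ∀ e ∈ G.adj v, ∃ e' ∈ G.adj (G.nb e), G.nb e' = v
  W_symm : ∀ u < G.n, ∀ v < G.n, G.W u v = G.W v u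
  col_lt : ∀ v < G.n, G.col v < G.c
  d_pos : 1 ≤ G.d
  k_pos : 1 ≤ G.k

/-- The numbers that the program handles fit into words of `w` bits. -/
structure Small (w : ℕ) : Prop where
  n_lt : G.n + 4 < cap w
  slot_lt : G.k * (G.d + 1) + 4 < cap w
  code_lt : (G.c + 1) * 3 ^ G.k + 4 < cap w

end Data

/-- The input is in memory. -/
structure Mem (G : Data) (s : State) : Prop where
  n : s.reg rN = G.n
  c : s.reg rC = G.c
  k : s.reg rK = G.k
  st : s.arr aStart = G.st
  nb : s.arr aNbr = G.nb
  col : s.arr aCol = G.col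
  wt : s.warr wWt = G.wt

theorem Mem.setReg {G : Data} {s : State} (h : Mem G s) {x v : ℕ} (hx : 3 ≤ x) :
    Mem G (s.setReg x v) := by
  obtain ⟨h1, h2, h3, h4, h5, h6, h7⟩ := h
  refine ⟨?_, ?_, ?_, h4, h5, h6, h7⟩ <;> rw [State.setReg_reg, if_neg (by omega)] <;> assumption

theorem Mem.setArr {G : Data} {s : State} (h : Mem G s) {a i v : ℕ} (ha : 3 ≤ a) :
    Mem G (s.setArr a i v) := by
  obtain ⟨h1, h2, h3, h4, h5, h6, h7⟩ := h
  refine ⟨h1, h2, h3, ?_, ?_, ?_, h7⟩ <;> rw [State.setArr_arr, if_neg (by omega)] <;> assumption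

theorem Mem.setWReg {G : Data} {s : State} (h : Mem G s) {x : ℕ} {v : ℚ} :
    Mem G (s.setWReg x v) := ⟨h.n, h.c, h.k, h.st, h.nb, h.col, h.wt⟩

theorem Mem.setWArr {G : Data} {s : State} (h : Mem G s) {a i : ℕ} {v : ℚ} (ha : 1 ≤ a) :
    Mem G (s.setWArr a i v) := by
  obtain ⟨h1, h2, h3, h4, h5, h6, h7⟩ := h
  refine ⟨h1, h2, h3, h4, h5, h6, ?_⟩
  rw [State.setWArr_warr, if_neg (by omega)]
  exact h7

/-- Whether the program leaves the input alone. -/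
def Program.keepsInput (p : Program) : Bool :=
  !(p.writesReg rN || p.writesReg rC || p.writesReg rK || p.writesArr aStart ||
    p.writesArr aNbr || p.writesArr aCol || p.writesWArr wWt)

theorem Mem.frame {G : Data} {p : Program} {s s' : State} (h : Mem G s) (hF : Frame p s s')
    (hp : p.keepsInput = true) : Mem G s' := by
  simp only [Program.keepsInput, Bool.not_eq_true', Bool.or_eq_false_iff] at hp
  obtain ⟨⟨⟨⟨⟨⟨p1, p2⟩, p3⟩, p4⟩, p5⟩, p6⟩, p7⟩ := hp
  exact ⟨(hF.reg _ p1).trans h.n, (hF.reg _ p2).trans h.c, (hF.reg _ p3).trans h.k,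
    (hF.arr _ p4).trans h.st, (hF.arr _ p5).trans h.nb, (hF.arr _ p6).trans h.col,
    (hF.warr _ p7).trans h.wt⟩

/-! ### Searching the list -/

/-- The first position below `m` at which `S` has the value `u`, and `m` if there is none. -/
def firstPos (S : ℕ → ℕ) (m u : ℕ) : ℕ := Nat.find (p := fun p => p = m ∨ S p = u) ⟨m, Or.inl rfl⟩

theorem apply_firstPos {S : ℕ → ℕ} {m u : ℕ} (h : firstPos S m u < m) : S (firstPos S m u) = u :=
  (Nat.find_spec (p := fun p => p = m ∨ S p = u) ⟨m, Or.inl rfl⟩).resolve_left h.ne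

theorem firstPos_lt_iff {S : ℕ → ℕ} {m u : ℕ} : firstPos S m u < m ↔ ∃ j < m, S j = u := by
  constructor
  · exact fun h => ⟨_, h, apply_firstPos h⟩
  · rintro ⟨j, hj, h⟩
    exact (Nat.find_min' _ (Or.inr h)).trans_lt hj

theorem firstPos_eq {S : ℕ → ℕ} {m u p : ℕ} (hp : p = m ∨ S p = u)
    (hlt : ∀ j < p, j ≠ m ∧ S j ≠ u) : firstPos S m u = p := by
  refine le_antisymm (Nat.find_min' _ hp) ?_
  rw [firstPos, Nat.le_find_iff]
  exact fun j hj => not_or.2 (hlt j hj)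

theorem wp_findPos {w : ℕ} {s : State} (hb : Bounded w s) (hw : 4 < cap w) :
    WP w findPos s fun t s' => t ≤ 14 * s.reg rSize + 20 ∧
      s'.reg rPos = firstPos (s.arr aSet) (s.reg rSize) (s.reg rU) := by
  simp only [findPos, wp_seq, wp_set]
  refine ⟨by simp ; omega, ?_⟩
  refine (wp_loop (s.reg rSize) 4 (fun i s' => s'.reg rPos + i = s.reg rSize ∧
    ∀ j < s'.reg rPos, s.arr aSet j ≠ s.reg rU) (hb.setReg (by simp ; omega)) (by simp)
    ?_).conseq (hb.setReg (by simp ; omega)) ?_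
  · rintro i s' ⟨h1, h2⟩ hb' hF
    have e1 : s'.reg rSize = s.reg rSize := hF.reg _ rfl
    have e2 : s'.reg rU = s.reg rU := hF.reg _ rfl
    have e3 : s'.arr aSet = s.arr aSet := hF.arr _ rfl
    refine ⟨by simp [hb'.reg, hb'.arr], fun hc => ?_⟩
    simp only [Test.holds_and, Test.holds_lt, Expr.eval_reg, Test.holds_not, Test.holds_eq,
      Expr.eval_get, e1, e2, e3] at hc
    have := hb'.reg rSize
    rw [wp_set]
    refine ⟨by simp [hb'.reg]; omega, by simp, i - 1, by omega, by simp ; omega, ?_⟩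
    simp only [Expr.eval_add, Expr.eval_reg, Expr.eval_const, State.setReg_reg, if_true]
    intro j hj
    rcases Nat.lt_succ_iff_lt_or_eq.1 hj with h | rfl
    · exact h2 j h
    · exact hc.2
  · rintro t s' hb' hF ⟨ht, hn, i, h1, h2⟩
    have e1 : s'.reg rSize = s.reg rSize := hF.reg _ rfl
    have e2 : s'.reg rU = s.reg rU := hF.reg _ rfl
    have e3 : s'.arr aSet = s.arr aSet := hF.arr _ rfl
    simp only [Test.holds_and, Test.holds_lt, Expr.eval_reg, Test.holds_not, Test.holds_eq,
      Expr.eval_get, e1, e2, e3] at hn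
    refine ⟨by simp at ht ⊢; omega, (firstPos_eq ?_ fun j hj => ⟨by omega, h2 j hj⟩).symm⟩
    by_contra! hc
    exact hn ⟨by omega, hc.2⟩

/-! ### The gain of a color class -/

/-- The coefficient of the weight of the edge from the list vertex number `j` to `u` in the change
of the doubled monochromatic weight if the list vertices with digit `1` receive the color `i`. Edges
inside the list are met from both ends and count once each time, the others count twice. -/
def Data.coeff (G : Data) (S : ℕ → ℕ) (m : ℕ) (D : ℕ → ℕ) (i j u : ℕ) : ℚ :=
  if firstPos S m u < m then
    (if D (firstPos S m u) = 1 then 1 else 0) - (if G.col u = G.col (S j) then 1 else 0)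
  else 2 * ((if G.col u = i then 1 else 0) - (if G.col u = G.col (S j) then 1 else 0))

/-- The contribution of the list vertices with digit `1` to the change of the doubled monochromatic
weight if they receive the color `i`. -/
def Data.gain (G : Data) (S : ℕ → ℕ) (m : ℕ) (i : ℕ) (D : ℕ → ℕ) : ℚ :=
  ∑ j ∈ Finset.range m, if D j = 1 then
    ∑ e ∈ G.adj (S j), G.wt e * G.coeff S m D i j (G.nb e) else 0

theorem wp_edgeGain {w : ℕ} {G : Data} {s : State} (hb : Bounded w s) (hw : G.Small w)
    (hM : Mem G s) (he : s.reg rE + 1 < cap w) :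
    WP w edgeGain s fun t s' => t ≤ 14 * s.reg rSize + 80 ∧ s'.reg rE = s.reg rE + 1 ∧
      s'.wreg wAcc = s.wreg wAcc + G.wt (s.reg rE) *
        G.coeff (s.arr aSet) (s.reg rSize) (s.arr aDig) (s.reg rCol) (s.reg rJ)
          (G.nb (s.reg rE)) := by
  have hn := hw.n_lt
  have hu : G.nb (s.reg rE) < cap w := by rw [← hM.nb]; exact hb.arr _ _
  rw [edgeGain, wp_seq, wp_set]
  refine ⟨by simp [hb.reg, hb.arr], ?_⟩
  have hb₁ := hb.setReg (x := rU) hu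
  simp only [Expr.eval_get, Expr.eval_reg, hM.nb]
  rw [wp_seq]
  refine (wp_findPos hb₁ (by omega)).conseq hb₁ ?_
  rintro t₁ s₁ hb₁ hF ⟨ht, hp⟩
  have hM₁ : Mem G s₁ := (hM.setReg (by omega)).frame hF rfl
  have e1 := hF.reg rSize rfl
  have e2 := hF.reg rU rfl
  have e3 := hF.reg rE rfl
  have e4 := hF.reg rJ rfl
  have e5 := hF.reg rCol rfl
  have e6 := hF.arr aSet rfl
  have e7 := hF.arr aDig rfl
  have e8 := hF.wreg wAcc rfl
  simp at e1 e2 e3 e4 e5 e6 e7 e8 hp ht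
  have hE : s.reg rE < cap w := hb.reg _
  simp only [Data.coeff]
  rw [← hp]
  have e9 : G.col (s.arr aSet (s.reg rJ)) < cap w := hM.col ▸ hb.arr _ _
  have e10 : G.col (G.nb (s.reg rE)) < cap w := hM.col ▸ hb.arr _ _
  have e11 := hb.reg rSize
  have e12 := hb.arr aDig
  have e13 := hb₁.reg rPos
  have e14 := hb.arr aSet
  have e15 := hb.reg rJ
  have e16 := hb.reg rCol
  simp only [wp_seq, wp_ite, wp_set, wp_wset, wp_skip]
  have w1 : 1 < cap w := by omega
  simp [hM₁.col, hM₁.wt, e1, e2, e3, e4, e5, e6, e7, e8, e9, e10, e11, e12, e13, e14, e15, e16, hE,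
    hu, he, w1]
  refine ⟨fun h1 => ⟨fun h2 => ⟨fun h3 => ?_, fun h3 => ?_⟩,
    fun h2 => ⟨fun h3 => ?_, fun h3 => ?_⟩⟩,
    fun h1 => ⟨fun h2 => ⟨fun h3 => ?_, fun h3 => ?_⟩, fun h2 => ⟨fun h3 => ?_, fun h3 => ?_⟩⟩⟩ <;>
  refine ⟨by omega, ?_⟩ <;> split_ifs <;> first | (exfalso; omega) | ring

theorem wp_classGain {w : ℕ} {G : Data} {s : State} {S : ℕ → ℕ} {m : ℕ} (hG : G.Valid)
    (hb : Bounded w s) (hw : G.Small w) (hM : Mem G s) (hm : s.reg rSize = m)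
    (hS : s.arr aSet = S) (hSn : ∀ j < m, S j < G.n) :
    WP w classGain s fun t s' => t ≤ m * ((G.d + 1) * (14 * m + 100) + 60) + 20 ∧
      s'.wreg wAcc = G.gain S m (s.reg rCol) (s.arr aDig) := by
  have hn := hw.n_lt
  simp only [classGain, wp_seq, wp_set, wp_wset]
  refine ⟨trivial, by simp; omega, ?_⟩
  simp only [WExpr.eval_zero, Expr.eval_const]
  have hb₀ : Bounded w ((s.setWReg wAcc 0).setReg rJ 0) := hb.setWReg.setReg (by omega)
  refine (wp_loop m ((G.d + 1) * (14 * m + 100) + 40) (fun i s' => s'.reg rJ + i = m ∧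
    s'.wreg wAcc = ∑ j ∈ Finset.range (s'.reg rJ), if s.arr aDig j = 1 then
      ∑ e ∈ G.adj (S j), G.wt e * G.coeff S m (s.arr aDig) (s.reg rCol) j (G.nb e) else 0)
    hb₀ (by simp) ?_).conseq hb₀ ?_
  · rintro i s₁ ⟨h1, h2⟩ hb₁ hF
    have hM₁ : Mem G s₁ := (hM.setWReg.setReg (by omega)).frame hF rfl
    have e1 : s₁.reg rSize = m := (hF.reg rSize rfl).trans hm
    have e2 : s₁.arr aSet = S := (hF.arr aSet rfl).trans hS
    have e3 : s₁.arr aDig = s.arr aDig := hF.arr aDig rfl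
    have e4 : s₁.reg rCol = s.reg rCol := hF.reg rCol rfl
    refine ⟨by simp [hb₁.reg], fun hc => ?_⟩
    simp only [Test.holds_lt, Expr.eval_reg, e1] at hc
    set j := s₁.reg rJ with hj
    have hv := hSn j hc
    have hjb : j < cap w := hb₁.reg rJ
    have w1 : 1 < cap w := by omega
    have hSb : S j + 1 < cap w := by omega
    have hSb' : S j < cap w := by omega
    have hm₁ : j + 1 < cap w := by have := hb₁.reg rSize; omega
    rw [wp_seq, wp_ite]
    refine ⟨by simp [hb₁.reg, hb₁.arr, w1], fun hd => ?_, fun hd => ?_⟩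
    · simp only [Test.holds_eq, Expr.eval_get, Expr.eval_reg, Expr.eval_const, e3, ← hj] at hd
      have hst := hb₁.arr aStart (S j)
      have f1 : s₁.arr aStart = G.st := hM₁.st
      rw [wp_seq, wp_set]
      refine ⟨by simp [hb₁.reg, hb₁.arr], ?_⟩
      simp only [Expr.eval_get, Expr.eval_reg, ← hj, e2, hM₁.st]
      rw [f1] at hst
      have hb₂ : Bounded w (s₁.setReg rE (G.st (S j))) := hb₁.setReg hst
      refine (wp_loop (G.st (S j + 1) - G.st (S j)) (14 * m + 80)
        (fun i s' => s'.reg rE + i = G.st (S j + 1) ∧ G.st (S j) ≤ s'.reg rE ∧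
          s'.wreg wAcc = s₁.wreg wAcc + ∑ e ∈ Finset.Ico (G.st (S j)) (s'.reg rE),
            G.wt e * G.coeff S m (s.arr aDig) (s.reg rCol) j (G.nb e))
        hb₂ ?_ ?_).conseq hb₂ ?_
      · have := hG.st_mono _ hv
        simp
        omega
      · rintro i' s₂ ⟨g1, g2, g3⟩ hb₃ hF₂
        have hM₂ : Mem G s₂ := (hM₁.setReg (by omega)).frame hF₂ rfl
        have c1 : s₂.reg rSize = m := (hF₂.reg rSize rfl).trans e1
        have c2 : s₂.arr aSet = S := (hF₂.arr aSet rfl).trans e2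
        have c3 : s₂.arr aDig = s.arr aDig := (hF₂.arr aDig rfl).trans e3
        have c4 : s₂.reg rCol = s.reg rCol := (hF₂.reg rCol rfl).trans e4
        have c5 : s₂.reg rJ = j := hF₂.reg rJ rfl
        refine ⟨by simp [hb₃.reg, hb₃.arr, w1, c2, c5, hSb, hSb', hjb], fun hc' => ?_⟩
        simp only [Test.holds_lt, Expr.eval_reg, Expr.eval_get, Expr.eval_add, Expr.eval_const, c2,
          c5, hM₂.st] at hc'
        have hst' := hb₃.arr aStart (S j + 1)
        rw [hM₂.st] at hst'
        refine (wp_edgeGain hb₃ hw hM₂ (by omega)).mono ?_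
        rintro t s₃ ⟨ht, k1, k2⟩
        rw [c1] at ht
        refine ⟨ht, i' - 1, by omega, by omega, by omega, ?_⟩
        rw [k2, k1, Finset.sum_Ico_succ_top g2, g3, c1, c2, c3, c4, c5, add_assoc]
      · rintro t s₂ hb₃ hF₂ ⟨ht, hn₂, i', g1, g2, g3⟩
        have hM₂ : Mem G s₂ := (hM₁.setReg (by omega)).frame hF₂ rfl
        have c2 : s₂.arr aSet = S := (hF₂.arr aSet rfl).trans e2
        have c5 : s₂.reg rJ = j := hF₂.reg rJ rfl
        simp only [Test.holds_lt, Expr.eval_reg, Expr.eval_get, Expr.eval_add, Expr.eval_const, c2,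
          c5, hM₂.st] at hn₂
        rw [wp_set]
        refine ⟨by simp [w1, c5, hm₁, hjb], ?_, i - 1, by omega, by simp [c5]; omega, ?_⟩
        · have hdeg : G.st (S j + 1) - G.st (S j) ≤ G.d + 1 := by have := hG.deg_le _ hv; omega
          have := ht.trans (Nat.add_le_add_right (Nat.mul_le_mul_right _ hdeg) _)
          simp at this ⊢
          nlinarith
        · have : s₂.reg rE = G.st (S j + 1) := by omega
          simp [c5, g3, Finset.sum_range_succ, hd, h2, this, Data.adj]
    · simp only [Test.holds_eq, Expr.eval_get, Expr.eval_reg, Expr.eval_const, e3, ← hj] at hd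
      rw [wp_skip, wp_set]
      refine ⟨by simp [w1, ← hj, hm₁, hjb], by simp, i - 1, by omega,
        by simp; omega, ?_⟩
      simp [← hj, Finset.sum_range_succ, hd, h2]
  · rintro t s₁ hb₁ hF ⟨ht, hn₁, i, h1, h2⟩
    have e1 : s₁.reg rSize = m := (hF.reg rSize rfl).trans hm
    simp only [Test.holds_lt, Expr.eval_reg, e1] at hn₁
    have : s₁.reg rJ = m := by omega
    refine ⟨?_, by rw [h2, this, Data.gain]⟩
    simp at ht ⊢
    nlinarith

/-! ### Ternary codes -/

/-- The ternary digit number `j` of `t`. -/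
def dig (t j : ℕ) : ℕ := t / 3 ^ j % 3

/-- The number with the ternary digits `g 0, …, g (m - 1)`. -/
def encode (m : ℕ) (g : ℕ → ℕ) : ℕ := ∑ j ∈ Finset.range m, g j * 3 ^ j

/-- The code, with digits `0` and `1`, of the set of positions where `t` has a nonzero digit. -/
def maskOf (m t : ℕ) : ℕ := encode m fun j => if dig t j = 0 then 0 else 1

/-- The code, with digits `0` and `1`, of the set of positions where `t` has the digit `2`. -/
def restOf (m t : ℕ) : ℕ := encode m fun j => if dig t j = 2 then 1 else 0

theorem dig_lt (t j : ℕ) : dig t j < 3 := Nat.mod_lt _ (by norm_num)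

theorem encode_succ (m : ℕ) (g : ℕ → ℕ) : encode (m + 1) g = encode m g + g m * 3 ^ m :=
  Finset.sum_range_succ _ _

theorem encode_congr {m : ℕ} {g g' : ℕ → ℕ} (h : ∀ j < m, g j = g' j) :
    encode m g = encode m g' :=
  Finset.sum_congr rfl fun j hj => by rw [h j (Finset.mem_range.1 hj)]

theorem encode_lt {m : ℕ} {g : ℕ → ℕ} (h : ∀ j < m, g j < 3) : encode m g < 3 ^ m := by
  induction m with
  | zero => simp [encode]
  | succ m ih =>
    have h1 := ih fun j hj => h j (by omega)
    have h2 : g m * 3 ^ m ≤ 2 * 3 ^ m := Nat.mul_le_mul_right _ (by have := h m (by omega); omega)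
    rw [encode_succ, pow_succ]
    omega

theorem dig_encode {m : ℕ} {g : ℕ → ℕ} (h : ∀ j < m, g j < 3) {j : ℕ} (hj : j < m) :
    dig (encode m g) j = g j := by
  induction m with
  | zero => omega
  | succ m ih =>
    have h1 := encode_lt fun j (hj : j < m) => h j (by omega)
    rw [encode_succ, dig]
    rcases Nat.lt_succ_iff_lt_or_eq.1 hj with hj | rfl
    · obtain ⟨r, rfl⟩ : ∃ r, m = j + 1 + r := ⟨m - (j + 1), by omega⟩
      have : g (j + 1 + r) * 3 ^ (j + 1 + r) = 3 ^ j * (3 * (g (j + 1 + r) * 3 ^ r)) := by ring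
      rw [this, Nat.add_mul_div_left _ _ (by positivity), Nat.add_mul_mod_self_left]
      exact ih (fun j hj => h j (by omega)) hj
    · rw [Nat.add_mul_div_right _ _ (by positivity), Nat.div_eq_of_lt h1, zero_add]
      exact Nat.mod_eq_of_lt (h j hj)

theorem encode_dig_mod (m t : ℕ) : encode m (dig t) = t % 3 ^ m := by
  induction m with
  | zero => simp [encode, Nat.mod_one]
  | succ m ih => rw [encode_succ, ih, dig, pow_succ, Nat.mod_mul, mul_comm (3 ^ m)]

theorem encode_dig {m t : ℕ} (h : t < 3 ^ m) : encode m (dig t) = t := by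
  rw [encode_dig_mod, Nat.mod_eq_of_lt h]

theorem maskOf_lt (m t : ℕ) : maskOf m t < 3 ^ m := encode_lt fun j _ => by split <;> norm_num

theorem restOf_lt (m t : ℕ) : restOf m t < 3 ^ m := encode_lt fun j _ => by split <;> norm_num

theorem dig_maskOf {m t j : ℕ} (hj : j < m) : dig (maskOf m t) j = if dig t j = 0 then 0 else 1 :=
  dig_encode (fun j _ => by split <;> norm_num) hj

theorem dig_restOf {m t j : ℕ} (hj : j < m) : dig (restOf m t) j = if dig t j = 2 then 1 else 0 :=
  dig_encode (fun j _ => by split <;> norm_num) hj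

theorem maskOf_add_restOf {m t : ℕ} (h : t < 3 ^ m) : maskOf m t + restOf m t = t := by
  conv_rhs => rw [← encode_dig h]
  rw [maskOf, restOf, encode, encode, encode, ← Finset.sum_add_distrib]
  refine Finset.sum_congr rfl fun j _ => ?_
  rw [← add_mul]
  congr 1
  have := dig_lt t j
  split_ifs <;> omega

theorem maskOf_maskOf (m t : ℕ) : maskOf m (maskOf m t) = maskOf m t :=
  encode_congr fun j hj => by rw [dig_maskOf hj]; split_ifs <;> simp_all

theorem restOf_maskOf (m t : ℕ) : restOf m (maskOf m t) = 0 := by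
  refine (encode_congr (g' := fun _ => 0) fun j hj => ?_).trans (by simp [encode])
  rw [dig_maskOf hj]
  split_ifs <;> simp_all

theorem wp_splitCode {w : ℕ} {s : State} {m : ℕ} (hb : Bounded w s) (hm : s.reg rSize = m)
    (hw : 3 ^ m + 4 < cap w) (ht : s.reg rT < 3 ^ m) :
    WP w splitCode s fun t s' => t ≤ m * 60 + 20 ∧
      (∀ j < m, s'.arr aDig j = dig (s.reg rT) j) ∧
      s'.reg rMask = maskOf m (s.reg rT) ∧ s'.reg rRest = restOf m (s.reg rT) := by
  set c := s.reg rT with hc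
  have hmw : m < cap w := hm ▸ hb.reg _
  have hcw : c < cap w := hb.reg _
  simp only [splitCode, wp_seq, wp_set]
  simp only [Expr.eval_const, Expr.eval_reg]
  refine ⟨by simp [hb.reg], by simp; omega, by simp; omega, by simp; omega, by simp; omega, ?_⟩
  have hb₀ : Bounded w (((((s.setReg rX (s.reg rT)).setReg rMask 0).setReg rRest 0).setReg
      rPow 1).setReg rJ 0) := by
    refine ((((hb.setReg ?_).setReg ?_).setReg ?_).setReg ?_).setReg ?_ <;> omega
  refine (wp_loop m 50 (fun i s' => s'.reg rJ + i = m ∧ s'.reg rX = c / 3 ^ (s'.reg rJ) ∧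
    s'.reg rPow = 3 ^ (s'.reg rJ) ∧ (∀ j < s'.reg rJ, s'.arr aDig j = dig c j) ∧
    s'.reg rMask = maskOf (s'.reg rJ) c ∧ s'.reg rRest = restOf (s'.reg rJ) c)
    hb₀ (by simp [← hc, maskOf, restOf, encode]) ?_).conseq hb₀ ?_
  · rintro i s₁ ⟨h1, h2, h3, h4, h5, h6⟩ hb₁ hF
    have e1 : s₁.reg rSize = m := (hF.reg rSize rfl).trans hm
    refine ⟨by simp [hb₁.reg], fun hlt => ?_⟩
    simp only [Test.holds_lt, Expr.eval_reg, e1] at hlt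
    obtain ⟨j, hj⟩ : ∃ j, s₁.reg rJ = j := ⟨_, rfl⟩
    rw [hj] at h1 h2 h3 h4 h5 h6 hlt
    have p1 : 3 ^ (j + 1) ≤ 3 ^ m := Nat.pow_le_pow_right (by norm_num) hlt
    have p2 := maskOf_lt j c
    have p3 := restOf_lt j c
    have p4 : c / 3 ^ j ≤ c := Nat.div_le_self _ _
    have p5 : c / 3 ^ j / 3 = c / 3 ^ (j + 1) := by rw [Nat.div_div_eq_div_mul, pow_succ]
    have p6 : c / 3 ^ j % 3 = dig c j := rfl
    have p7 : c / 3 ^ (j + 1) ≤ c := Nat.div_le_self _ _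
    have p8 := dig_lt c j
    have q1 : maskOf (j + 1) c = maskOf j c + if dig c j = 0 then 0 else 3 ^ j := by
      rw [maskOf, encode_succ, maskOf]; split_ifs <;> simp
    have q2 : restOf (j + 1) c = restOf j c + if dig c j = 2 then 3 ^ j else 0 := by
      rw [restOf, encode_succ, restOf]; split_ifs <;> simp
    have q3 : 3 ^ (j + 1) = 3 ^ j * 3 := pow_succ _ _
    have p9 : j + 1 < cap w := by omega
    have p10 : j < cap w := by omega
    have p11 : dig c j < cap w := by omega
    have p12 : 3 ^ j < cap w := by omega
    have w0 : 0 < cap w := by omega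
    have w1 : 1 < cap w := by omega
    have w2 : 2 < cap w := by omega
    have w3 : 3 < cap w := by omega
    have h4' : ∀ j' ≤ j, Function.update (s₁.arr aDig) j (dig c j) j' = dig c j' := by
      intro j' hj'
      rw [Function.update_apply]
      split
      · simp_all
      · exact h4 j' (by omega)
    have r1 : maskOf j c + 3 ^ j < cap w := by omega
    have r2 : restOf j c + 3 ^ j < cap w := by omega
    have r3 : c / 3 ^ j < cap w := by omega
    have r4 : c / 3 ^ (j + 1) < cap w := by omega
    have r5 : maskOf j c < cap w := by omega
    have r6 : restOf j c < cap w := by omega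
    have r7 : 3 ^ j * 3 < cap w := by omega
    simp only [wp_seq, wp_store, wp_ite, wp_set, wp_skip]
    simp [hj, h2, h3, h5, h6, p5, p6, p9, p10, p11, p12, w0, w1, w2, w3, r1, r2, r3, r4, r5,
      r6, r7]
    refine ⟨fun a => ⟨fun b => ?_, fun b => ?_⟩, fun a => ⟨fun b => ?_, fun b => ?_⟩⟩ <;>
    exact ⟨i - 1, by omega, by omega, q3.symm, h4', by simp [q1, a], by simp [q2, b]⟩
  · rintro t s₁ hb₁ hF ⟨h0, hn, i, h1, h2, h3, h4, h5, h6⟩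
    have e1 : s₁.reg rSize = m := (hF.reg rSize rfl).trans hm
    simp only [Test.holds_lt, Expr.eval_reg, e1] at hn
    have : s₁.reg rJ = m := by omega
    rw [this] at h4 h5 h6
    exact ⟨by simp at h0 ⊢; omega, h4, h5, h6⟩

/-! ### The dynamic program over colors and subsets -/

/-- The first `t` splits have been taken into account in the table entries for the color `i + 1`.
The entry of a mask is attained at the recorded choice and is at most the value of every split of
that mask seen so far. For the first color only the splits that leave nothing over count. -/
def Relaxed (H : ℕ → ℕ → ℚ) (m i : ℕ) (T : ℕ → ℚ) (ch : ℕ → ℕ) (t : ℕ) : Prop :=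
  ∀ t' < t, (i = 0 → restOf m t' = 0) →
    T ((i + 1) * 3 ^ m + maskOf m t') ≤ T (i * 3 ^ m + restOf m t') + H i t' ∧
    ch ((i + 1) * 3 ^ m + maskOf m t') < t ∧
    maskOf m (ch ((i + 1) * 3 ^ m + maskOf m t')) = maskOf m t' ∧
    (i = 0 → restOf m (ch ((i + 1) * 3 ^ m + maskOf m t')) = 0) ∧
    T ((i + 1) * 3 ^ m + maskOf m t') =
      T (i * 3 ^ m + restOf m (ch ((i + 1) * 3 ^ m + maskOf m t'))) +
        H i (ch ((i + 1) * 3 ^ m + maskOf m t'))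

theorem Relaxed.congr {H : ℕ → ℕ → ℚ} {m i : ℕ} {T T' : ℕ → ℚ} {ch ch' : ℕ → ℕ} {t : ℕ}
    (h : Relaxed H m i T ch t) (hT : ∀ x < (i + 2) * 3 ^ m, T' x = T x)
    (hc : ∀ x < (i + 2) * 3 ^ m, ch' x = ch x) : Relaxed H m i T' ch' t := by
  intro t' ht' hv
  have b1 : ∀ r, r < 3 ^ m → (i + 1) * 3 ^ m + r < (i + 2) * 3 ^ m := fun r hr => by nlinarith
  have b2 : ∀ r, r < 3 ^ m → i * 3 ^ m + r < (i + 2) * 3 ^ m := fun r hr => by nlinarith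
  rw [hT _ (b1 _ (maskOf_lt _ _)), hT _ (b2 _ (restOf_lt _ _)), hc _ (b1 _ (maskOf_lt _ _)),
    hT _ (b2 _ (restOf_lt _ _))]
  exact h t' ht' hv

open Classical in
/-- One step of the relaxation. Among the splits of a mask, the one that leaves nothing over is the
first, so it may overwrite what was stored in the entry. -/
theorem Relaxed.step {H : ℕ → ℕ → ℚ} {m i : ℕ} {T : ℕ → ℚ} {ch : ℕ → ℕ} {t : ℕ}
    (h : Relaxed H m i T ch t) (ht : t < 3 ^ m) {P : Prop}
    (hP : P ↔ restOf m t = 0 ∨ 0 < i ∧ T (i * 3 ^ m + restOf m t) + H i t <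
      T ((i + 1) * 3 ^ m + maskOf m t)) :
    Relaxed H m i
      (if P then Function.update T ((i + 1) * 3 ^ m + maskOf m t)
        (T (i * 3 ^ m + restOf m t) + H i t) else T)
      (if P then Function.update ch ((i + 1) * 3 ^ m + maskOf m t) t else ch) (t + 1) := by
  have low : ∀ r, r < 3 ^ m → ∀ r', i * 3 ^ m + r ≠ (i + 1) * 3 ^ m + r' := by
    intro r hr r'
    rw [add_mul, one_mul]
    omega
  intro t' ht' hv
  have hadd := maskOf_add_restOf ht
  by_cases hc : P
  · simp only [if_pos hc]
    rw [Function.update_of_ne (low _ (restOf_lt _ _) _)]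
    by_cases he : maskOf m t' = maskOf m t
    · rw [he, Function.update_self, Function.update_self,
        Function.update_of_ne (low _ (restOf_lt _ _) _)]
      refine ⟨?_, by omega, rfl, ?_, rfl⟩
      · rcases Nat.lt_succ_iff_lt_or_eq.1 ht' with hlt | rfl
        · have h1 := (h t' hlt hv).1
          rcases hP.1 hc with h2 | h2
          · -- here `t` is its own mask, hence the first split of this mask
            have := maskOf_add_restOf (hlt.trans ht)
            omega
          · rw [he] at h1
            linarith
        · exact le_rfl
      · intro hi
        rcases hP.1 hc with h2 | h2
        · exact h2
        · omega
    · have hne : t' ≠ t := fun e => he (e ▸ rfl)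
      rw [Function.update_of_ne (by omega), Function.update_of_ne (by omega),
        Function.update_of_ne (low _ (restOf_lt _ _) _)]
      obtain ⟨h1, h2, h3⟩ := h t' (by omega) hv
      exact ⟨h1, by omega, h3⟩
  · simp only [if_neg hc]
    rcases Nat.lt_succ_iff_lt_or_eq.1 ht' with hlt | rfl
    · obtain ⟨h1, h2, h3⟩ := h t' hlt hv
      exact ⟨h1, by omega, h3⟩
    · have hn := not_or.1 (mt hP.2 hc)
      have hi : i ≠ 0 := fun hi => hn.1 (hv hi)
      obtain ⟨h1, h2, h3⟩ := h (maskOf m t') (by omega) fun hi' => absurd hi' hi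
      rw [maskOf_maskOf] at h1 h2 h3
      refine ⟨?_, by omega, h3⟩
      by_contra! hlt
      exact hn.2 ⟨by omega, hlt⟩

theorem Data.gain_congr {G : Data} {S : ℕ → ℕ} {m i : ℕ} {D D' : ℕ → ℕ} (h : ∀ j < m, D j = D' j) :
    G.gain S m i D = G.gain S m i D' := by
  refine Finset.sum_congr rfl fun j hj => ?_
  rw [h j (Finset.mem_range.1 hj)]
  refine if_congr Iff.rfl (Finset.sum_congr rfl fun e _ => ?_) rfl
  congr 1
  simp only [Data.coeff]
  refine ite_congr rfl (fun hp => ?_) fun _ => rfl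
  rw [h _ hp]

open Classical in
theorem wp_relax {w : ℕ} {G : Data} {s : State} {S : ℕ → ℕ} {m : ℕ} (hG : G.Valid)
    (hb : Bounded w s) (hw : G.Small w) (hM : Mem G s) (hm : s.reg rSize = m) (hmk : m ≤ G.k)
    (hS : s.arr aSet = S) (hSn : ∀ j < m, S j < G.n) (hB : s.reg rB = 3 ^ m)
    (hi : s.reg rCol < G.c) (ht : s.reg rT < 3 ^ m) {t i : ℕ} (hti : s.reg rT = t)
    (hii : s.reg rCol = i) :
    WP w relax s fun τ s' => τ ≤ m * ((G.d + 1) * (14 * m + 100) + 120) + 110 ∧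
      s'.reg rT = t + 1 ∧ ∃ P : Prop,
      (P ↔ restOf m t = 0 ∨ 0 < i ∧ s.warr wTab (i * 3 ^ m + restOf m t) + G.gain S m i (dig t) <
        s.warr wTab ((i + 1) * 3 ^ m + maskOf m t)) ∧
      s'.warr wTab = (if P then Function.update (s.warr wTab) ((i + 1) * 3 ^ m + maskOf m t)
        (s.warr wTab (i * 3 ^ m + restOf m t) + G.gain S m i (dig t)) else s.warr wTab) ∧
      s'.arr aChoice = (if P then Function.update (s.arr aChoice) ((i + 1) * 3 ^ m + maskOf m t) t
        else s.arr aChoice) := by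
  rw [hti] at ht
  rw [hii] at hi
  have hn := hw.n_lt
  have hcode := hw.code_lt
  have p3 : 3 ^ m ≤ 3 ^ G.k := Nat.pow_le_pow_right (by norm_num) hmk
  have p4 : (G.c + 1) * 3 ^ m ≤ (G.c + 1) * 3 ^ G.k := Nat.mul_le_mul_left _ p3
  have p5 : (i + 2) * 3 ^ m ≤ (G.c + 1) * 3 ^ m := Nat.mul_le_mul_right _ (by omega)
  have p6 : (i + 2) * 3 ^ m = (i + 1) * 3 ^ m + 3 ^ m := by ring
  have p7 : (i + 1) * 3 ^ m = i * 3 ^ m + 3 ^ m := by ring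
  rw [relax, wp_seq]
  refine (wp_splitCode hb hm (by omega) (by omega)).conseq hb ?_
  rintro t₁ s₁ hb₁ hF₁ ⟨ht₁, hd₁, hma₁, hre₁⟩
  have hM₁ := hM.frame hF₁ rfl
  rw [hti] at hd₁ hma₁ hre₁
  rw [wp_seq]
  refine (wp_classGain hG hb₁ hw hM₁ ((hF₁.reg rSize rfl).trans hm) ((hF₁.arr aSet rfl).trans hS)
    hSn).conseq hb₁ ?_
  rintro t₂ s₂ hb₂ hF₂ ⟨ht₂, hg₂⟩
  rw [Data.gain_congr hd₁] at hg₂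
  have e1 : s₂.reg rMask = maskOf m t := (hF₂.reg rMask rfl).trans hma₁
  have e2 : s₂.reg rRest = restOf m t := (hF₂.reg rRest rfl).trans hre₁
  have e3 : s₂.reg rCol = i := ((hF₂.reg rCol rfl).trans (hF₁.reg rCol rfl)).trans hii
  have e4 : s₂.reg rT = t := ((hF₂.reg rT rfl).trans (hF₁.reg rT rfl)).trans hti
  have e5 : s₂.reg rB = 3 ^ m := ((hF₂.reg rB rfl).trans (hF₁.reg rB rfl)).trans hB
  have e6 : s₂.warr wTab = s.warr wTab := (hF₂.warr wTab rfl).trans (hF₁.warr wTab rfl)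
  have e7 : s₂.arr aChoice = s.arr aChoice := (hF₂.arr aChoice rfl).trans (hF₁.arr aChoice rfl)
  have e8 : s₂.wreg wAcc = G.gain S m i (dig t) := by
    rw [hg₂, hF₁.reg rCol rfl, hii]
  have q1 := maskOf_lt m t
  have q2 := restOf_lt m t
  have w0 : 0 < cap w := by omega
  have w1 : 1 < cap w := by omega
  have hcw : G.c < cap w := hM.c ▸ hb.reg rC
  have w2 : i < cap w := by omega
  have w3 : i + 1 < cap w := by omega
  have w4 : 3 ^ m < cap w := by omega
  have w5 : maskOf m t < cap w := by omega
  have w6 : restOf m t < cap w := by omega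
  have w7 : i * 3 ^ m < cap w := by omega
  have w8 : (i + 1) * 3 ^ m < cap w := by omega
  have w9 : i * 3 ^ m + restOf m t < cap w := by omega
  have w10 : (i + 1) * 3 ^ m + maskOf m t < cap w := by omega
  have w11 : t < cap w := by omega
  have w12 : t + 1 < cap w := by omega
  have htime : t₁ + t₂ ≤ m * ((G.d + 1) * (14 * m + 100) + 120) + 40 := by nlinarith
  simp only [wp_seq, wp_wset, wp_ite, wp_wstore, wp_store, wp_skip, wp_set]
  refine ⟨by simp [e2, e3, e5, w2, w4, w6, w7, w9], by
    simp [e1, e2, e3, e5, w0, w1, w2, w3, w4, w5, w6, w8, w10], fun hc => ?_, fun hc => ?_⟩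
  · refine ⟨by simp [e1, e3, e5, w1, w2, w3, w4, w5, w8, w10], trivial,
      by simp [e1, e3, e5, w1, w2, w3, w4, w5, w8, w10], by simp [e4, w11],
      by simp [e4, w1, w11, w12], by simp; omega, by simp [e4], True, ?_, ?_, ?_⟩
    · simp [e1, e2, e3, e5, e6, e8] at hc
      rw [true_iff]
      tauto
    · simp [e1, e2, e3, e5, e6, e8]
    · simp [e1, e3, e4, e5, e7]
  · refine ⟨by simp [e4, w1, w11, w12], by simp; omega, by simp [e4], False, ?_, ?_, ?_⟩
    · simp [e1, e2, e3, e5, e6, e8] at hc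
      simp only [false_iff, not_or, not_and, not_lt]
      exact hc
    · simp [e6]
    · simp [e7]

theorem wp_powers {w : ℕ} {s : State} {m : ℕ} (hb : Bounded w s) (hm : s.reg rSize = m)
    (hw : 3 ^ m + 4 < cap w) :
    WP w powers s fun t s' => t ≤ m * 30 + 20 ∧ s'.reg rB = 3 ^ m ∧
      s'.reg rFull = encode m fun _ => 1 := by
  have hmw : m < cap w := hm ▸ hb.reg _
  have p0 : 0 < 3 ^ m := by positivity
  simp only [powers, wp_seq, wp_set]
  simp only [Expr.eval_const]
  refine ⟨by simp; omega, by simp; omega, by simp; omega, ?_⟩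
  have hb₀ : Bounded w (((s.setReg rB 1).setReg rFull 0).setReg rJ 0) := by
    refine ((hb.setReg ?_).setReg ?_).setReg ?_ <;> omega
  refine (wp_loop m 20 (fun i s' => s'.reg rJ + i = m ∧ s'.reg rB = 3 ^ (s'.reg rJ) ∧
    s'.reg rFull = encode (s'.reg rJ) fun _ => 1) hb₀ (by simp [encode]) ?_).conseq hb₀ ?_
  · rintro i s₁ ⟨h1, h2, h3⟩ hb₁ hF
    have e1 : s₁.reg rSize = m := (hF.reg rSize rfl).trans hm
    refine ⟨by simp [hb₁.reg], fun hlt => ?_⟩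
    simp only [Test.holds_lt, Expr.eval_reg, e1] at hlt
    obtain ⟨j, hj⟩ : ∃ j, s₁.reg rJ = j := ⟨_, rfl⟩
    rw [hj] at h1 h2 h3 hlt
    have p1 : 3 ^ (j + 1) ≤ 3 ^ m := Nat.pow_le_pow_right (by norm_num) hlt
    have p2 : encode j (fun _ => 1) < 3 ^ j := encode_lt fun _ _ => by norm_num
    have p3 : 3 ^ (j + 1) = 3 ^ j * 3 := pow_succ _ _
    have w1 : 1 < cap w := by omega
    have w3 : 3 < cap w := by omega
    have w4 : 3 ^ j < cap w := by omega
    have w5 : encode j (fun _ => 1) < cap w := by omega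
    have w6 : encode j (fun _ => 1) + 3 ^ j < cap w := by omega
    have w7 : 3 ^ j * 3 < cap w := by omega
    have w8 : j < cap w := by omega
    have w9 : j + 1 < cap w := by omega
    simp only [wp_seq, wp_set]
    simp [hj, h2, h3, w1, w3, w4, w5, w6, w7, w8, w9]
    exact ⟨i - 1, by omega, by omega, p3.symm, by rw [encode_succ, one_mul]⟩
  · rintro t s₁ hb₁ hF ⟨h0, hn, i, h1, h2, h3⟩
    have e1 : s₁.reg rSize = m := (hF.reg rSize rfl).trans hm
    simp only [Test.holds_lt, Expr.eval_reg, e1] at hn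
    have : s₁.reg rJ = m := by omega
    rw [this] at h2 h3
    exact ⟨by simp at h0 ⊢; omega, h2, h3⟩

theorem wp_fillTable {w : ℕ} {G : Data} {s : State} {S : ℕ → ℕ} {m : ℕ} (hG : G.Valid)
    (hb : Bounded w s) (hw : G.Small w) (hM : Mem G s) (hm : s.reg rSize = m) (hmk : m ≤ G.k)
    (hS : s.arr aSet = S) (hSn : ∀ j < m, S j < G.n) :
    WP w fillTable s fun t s' =>
      t ≤ m * 30 + 50 + G.c * (3 ^ m * (m * ((G.d + 1) * (14 * m + 100) + 120) + 120) + 40) ∧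
      s'.reg rB = 3 ^ m ∧ s'.reg rFull = (encode m fun _ => 1) ∧ s'.warr wTab 0 = 0 ∧
      ∀ i < G.c, Relaxed (fun i t => G.gain S m i (dig t)) m i (s'.warr wTab) (s'.arr aChoice)
        (3 ^ m) := by
  have hn := hw.n_lt
  have hcode := hw.code_lt
  have p3 : 3 ^ m ≤ 3 ^ G.k := Nat.pow_le_pow_right (by norm_num) hmk
  have p4 : 3 ^ G.k ≤ (G.c + 1) * 3 ^ G.k := Nat.le_mul_of_pos_left _ (by omega)
  have hcw : G.c < cap w := hM.c ▸ hb.reg rC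
  have w0 : 0 < cap w := by omega
  have w1 : 1 < cap w := by omega
  rw [fillTable, wp_seq]
  refine (wp_powers hb hm (by omega)).conseq hb ?_
  rintro t₁ s₁ hb₁ hF₁ ⟨ht₁, hB₁, hfull₁⟩
  simp only [wp_seq, wp_wstore, wp_set]
  simp only [Expr.eval_const, WExpr.eval_zero]
  refine ⟨by simp [w0], trivial, by simp [w0], ?_⟩
  have hb₂ : Bounded w ((s₁.setWArr wTab 0 0).setReg rCol 0) := hb₁.setWArr.setReg w0
  have hM₁ := hM.frame hF₁ rfl
  have hM₂ : Mem G ((s₁.setWArr wTab 0 0).setReg rCol 0) :=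
    (hM₁.setWArr (by omega)).setReg (by omega)
  refine (wp_loop G.c (3 ^ m * (m * ((G.d + 1) * (14 * m + 100) + 120) + 120) + 30)
    (fun i' s' => s'.reg rCol + i' = G.c ∧ s'.warr wTab 0 = 0 ∧ ∀ i < s'.reg rCol,
      Relaxed (fun i t => G.gain S m i (dig t)) m i (s'.warr wTab) (s'.arr aChoice) (3 ^ m))
    hb₂ (by simp) ?_).conseq hb₂ ?_
  · rintro i' s₂ ⟨h1, h2, h3⟩ hb₂ hF₂
    have hM₃ := hM₂.frame hF₂ rfl
    have e1 : s₂.reg rSize = m := ((hF₂.reg rSize rfl).trans (hF₁.reg rSize rfl)).trans hm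
    have e2 : s₂.arr aSet = S := ((hF₂.arr aSet rfl).trans (hF₁.arr aSet rfl)).trans hS
    have e3 : s₂.reg rB = 3 ^ m := (hF₂.reg rB rfl).trans hB₁
    refine ⟨by simp [hb₂.reg], fun hlt => ?_⟩
    simp only [Test.holds_lt, Expr.eval_reg, hM₃.c] at hlt
    obtain ⟨i, hi⟩ : ∃ i, s₂.reg rCol = i := ⟨_, rfl⟩
    rw [hi] at h1 h3 hlt
    rw [wp_seq, wp_set]
    refine ⟨by simp [w0], ?_⟩
    simp only [Expr.eval_const]
    have hb₃ : Bounded w (s₂.setReg rT 0) := hb₂.setReg w0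
    rw [wp_seq]
    have low : ∀ x < (i + 1) * 3 ^ m, ∀ r, x ≠ (i + 1) * 3 ^ m + r := fun x hx r => by omega
    refine (wp_loop (3 ^ m) (m * ((G.d + 1) * (14 * m + 100) + 120) + 110)
      (fun t' s' => s'.reg rT + t' = 3 ^ m ∧
        (∀ x < (i + 1) * 3 ^ m, s'.warr wTab x = s₂.warr wTab x) ∧
        (∀ x < (i + 1) * 3 ^ m, s'.arr aChoice x = s₂.arr aChoice x) ∧
        Relaxed (fun i t => G.gain S m i (dig t)) m i (s'.warr wTab) (s'.arr aChoice)
          (s'.reg rT)) hb₃ ?_ ?_).conseq hb₃ ?_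
    · simp [Relaxed]
    · rintro t' s₃ ⟨g1, g2, g3, g4⟩ hb₄ hF₃
      have hM₄ : Mem G s₃ := (hM₃.setReg (by omega)).frame hF₃ rfl
      have c1 : s₃.reg rSize = m := (hF₃.reg rSize rfl).trans e1
      have c2 : s₃.arr aSet = S := (hF₃.arr aSet rfl).trans e2
      have c3 : s₃.reg rB = 3 ^ m := (hF₃.reg rB rfl).trans e3
      have c4 : s₃.reg rCol = i := (hF₃.reg rCol rfl).trans hi
      refine ⟨by simp [hb₄.reg], fun hlt' => ?_⟩
      simp only [Test.holds_lt, Expr.eval_reg, c3] at hlt'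
      refine (wp_relax hG hb₄ hw hM₄ c1 hmk c2 hSn c3 (by omega) hlt' rfl c4).mono ?_
      rintro τ s₄ ⟨hτ, k1, P, k2, k3, k4⟩
      refine ⟨hτ, t' - 1, by omega, by omega, fun x hx => ?_, fun x hx => ?_, ?_⟩
      · rw [k3]
        split_ifs
        · rw [Function.update_of_ne (low x hx _), g2 x hx]
        · exact g2 x hx
      · rw [k4]
        split_ifs
        · rw [Function.update_of_ne (low x hx _), g3 x hx]
        · exact g3 x hx
      · rw [k1, k3, k4]
        exact g4.step hlt' k2
    · rintro t₃ s₃ hb₄ hF₃ ⟨ht₃, hn₃, t', g1, g2, g3, g4⟩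
      have c3 : s₃.reg rB = 3 ^ m := (hF₃.reg rB rfl).trans e3
      have c4 : s₃.reg rCol = i := (hF₃.reg rCol rfl).trans hi
      simp only [Test.holds_lt, Expr.eval_reg, c3] at hn₃
      have c5 : s₃.reg rT = 3 ^ m := by omega
      rw [c5] at g4
      have w2 : i < cap w := by omega
      have w3 : i + 1 < cap w := by omega
      rw [wp_set]
      refine ⟨by simp [c4, w1, w2, w3], ?_, i' - 1, by omega, by simp [c4]; omega, ?_, ?_⟩
      · simp at ht₃ ⊢
        nlinarith
      · have : 0 < (i + 1) * 3 ^ m := by positivity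
        simp [g2 0 this, h2]
      · simp only [State.setReg_warr, State.setReg_arr, State.setReg_reg, if_true, Expr.eval_add,
          Expr.eval_reg, c4, Expr.eval_const]
        intro i₀ hi₀
        rcases Nat.lt_succ_iff_lt_or_eq.1 hi₀ with hlt₀ | rfl
        · have : (i₀ + 2) * 3 ^ m ≤ (i + 1) * 3 ^ m := Nat.mul_le_mul_right _ (by omega)
          exact (h3 i₀ hlt₀).congr (fun x hx => g2 x (by omega)) fun x hx => g3 x (by omega)
        · exact g4
  · rintro t₂ s₂ hb₂ hF₂ ⟨ht₂, hn₂, i', h1, h2, h3⟩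
    have hM₃ := hM₂.frame hF₂ rfl
    simp only [Test.holds_lt, Expr.eval_reg, hM₃.c] at hn₂
    refine ⟨?_, (hF₂.reg rB rfl).trans hB₁, (hF₂.reg rFull rfl).trans hfull₁, h2,
      fun i hi => h3 i (by omega)⟩
    simp at ht₂ ⊢
    nlinarith

/-- The code of the set of the positions below `m` that lie in `X`. -/
def codeOf (m : ℕ) (X : Finset ℕ) : ℕ := encode m fun j => if j ∈ X then 1 else 0

theorem dig_codeOf {m j : ℕ} (X : Finset ℕ) (hj : j < m) :
    dig (codeOf m X) j = if j ∈ X then 1 else 0 :=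
  dig_encode (fun j _ => by split <;> norm_num) hj

theorem codeOf_lt (m : ℕ) (X : Finset ℕ) : codeOf m X < 3 ^ m :=
  encode_lt fun j _ => by split <;> norm_num

theorem codeOf_congr {m : ℕ} {X Y : Finset ℕ} (h : ∀ j < m, j ∈ X ↔ j ∈ Y) :
    codeOf m X = codeOf m Y :=
  encode_congr fun j hj => by simp only [h j hj]

theorem maskOf_codeOf (m : ℕ) (X : Finset ℕ) : maskOf m (codeOf m X) = codeOf m X :=
  encode_congr fun j hj => by rw [dig_codeOf X hj]; split_ifs <;> simp_all

theorem restOf_codeOf (m : ℕ) (X : Finset ℕ) : restOf m (codeOf m X) = 0 := by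
  rw [← maskOf_codeOf, restOf_maskOf]

theorem codeOf_empty (m : ℕ) : codeOf m ∅ = 0 := by simp [codeOf, encode]

/-- `H i t` depends only on the set of positions where `t` has the digit `1`. -/
def ClassFun (m : ℕ) (H : ℕ → ℕ → ℚ) : Prop :=
  ∀ i t t', (∀ j < m, dig t j = 1 ↔ dig t' j = 1) → H i t = H i t'

/-- The table entries are lower bounds for the total gain of every assignment of colors. -/
theorem table_le {H : ℕ → ℕ → ℚ} {m c : ℕ} {T : ℕ → ℚ} {ch : ℕ → ℕ} (hH : ClassFun m H)
    (hR : ∀ i < c, Relaxed H m i T ch (3 ^ m)) (hT : T 0 = 0) (g : ℕ → ℕ) {i : ℕ} (hi : i ≤ c)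
    {X : Finset ℕ} (hX : ∀ j ∈ X, g j < i) :
    T (i * 3 ^ m + codeOf m X) ≤
      ∑ l ∈ Finset.range i, H l (codeOf m (X.filter fun j => g j = l)) := by
  induction i generalizing X with
  | zero =>
    have : X = ∅ := Finset.eq_empty_of_forall_notMem fun j hj => by simpa using hX j hj
    simp [this, codeOf_empty, hT]
  | succ i ih =>
    -- the split that belongs to the assignment `g`
    set t := encode m fun j => if j ∈ X then (if g j = i then 1 else 2) else 0 with ht
    have hdig : ∀ j < m, dig t j = if j ∈ X then (if g j = i then 1 else 2) else 0 :=
      fun j hj => dig_encode (fun j _ => by split_ifs <;> norm_num) hj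
    have htlt : t < 3 ^ m := encode_lt fun j _ => by split_ifs <;> norm_num
    have h1 : maskOf m t = codeOf m X :=
      encode_congr fun j hj => by rw [hdig j hj]; split_ifs <;> simp_all
    have h2 : restOf m t = codeOf m (X.filter fun j => g j < i) := by
      refine encode_congr fun j hj => ?_
      rw [hdig j hj]
      by_cases hjX : j ∈ X
      · have := hX j hjX
        by_cases hg : g j = i
        · simp [hg, hjX]
        · have : g j < i := by omega
          simp [hg, hjX, this]
      · simp [hjX]
    have h3 : H i t = H i (codeOf m (X.filter fun j => g j = i)) := by
      refine hH i _ _ fun j hj => ?_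
      rw [hdig j hj, dig_codeOf _ hj]
      by_cases hjX : j ∈ X <;> by_cases hg : g j = i <;> simp [hjX, hg]
    have h4 := (hR i (by omega) t htlt fun hi0 => by
      rw [h2, hi0]
      simp [codeOf_empty]).1
    rw [h1, h2, h3] at h4
    refine h4.trans ?_
    rw [Finset.sum_range_succ]
    refine add_le_add_left ((ih (by omega) (X := X.filter fun j => g j < i) ?_).trans
      (le_of_eq ?_)) _
    · exact fun j hj => (Finset.mem_filter.1 hj).2
    · refine Finset.sum_congr rfl fun l hl => ?_
      have hl := Finset.mem_range.1 hl
      congr 2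
      ext j
      simp only [Finset.mem_filter]
      constructor
      · exact fun h => ⟨h.1.1, h.2⟩
      · exact fun h => ⟨⟨h.1, by omega⟩, h.2⟩

theorem wp_paintClass {w : ℕ} {s : State} {S : ℕ → ℕ} {m : ℕ} (hb : Bounded w s)
    (hw : 4 < cap w) (hm : s.reg rSize = m) (hS : s.arr aSet = S) :
    WP w paintClass s fun t s' => t ≤ m * 30 + 20 ∧ ∀ u, s'.arr aCol u =
      if ∃ j < m, s.arr aDig j = 1 ∧ S j = u then s.reg rCol else s.arr aCol u := by
  have w0 : 0 < cap w := by omega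
  have w1 : 1 < cap w := by omega
  have hmw : m < cap w := hm ▸ hb.reg _
  simp only [paintClass, wp_seq, wp_set]
  simp only [Expr.eval_const]
  refine ⟨by simp [w0], ?_⟩
  have hb₀ : Bounded w (s.setReg rJ 0) := hb.setReg w0
  refine (wp_loop m 24 (fun i s' => s'.reg rJ + i = m ∧ ∀ u, s'.arr aCol u =
      if ∃ j < s'.reg rJ, s.arr aDig j = 1 ∧ S j = u then s.reg rCol else s.arr aCol u)
    hb₀ (by simp) ?_).conseq hb₀ ?_
  · rintro i s₁ ⟨h1, h2⟩ hb₁ hF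
    have e1 : s₁.reg rSize = m := (hF.reg rSize rfl).trans hm
    have e2 : s₁.arr aSet = S := (hF.arr aSet rfl).trans hS
    have e3 : s₁.arr aDig = s.arr aDig := hF.arr aDig rfl
    have e4 : s₁.reg rCol = s.reg rCol := hF.reg rCol rfl
    refine ⟨by simp [hb₁.reg], fun hlt => ?_⟩
    simp only [Test.holds_lt, Expr.eval_reg, e1] at hlt
    obtain ⟨j, hj⟩ : ∃ j, s₁.reg rJ = j := ⟨_, rfl⟩
    rw [hj] at h1 h2 hlt
    have w2 : j < cap w := by omega
    have w3 : j + 1 < cap w := by omega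
    have w4 : S j < cap w := e2 ▸ hb₁.arr aSet j
    have w5 : s.arr aDig j < cap w := hb.arr _ _
    have w6 := hb.reg rCol
    simp only [wp_seq, wp_ite, wp_store, wp_skip, wp_set]
    simp only [Test.holds_eq, Expr.eval_get, Expr.eval_reg, Expr.eval_const, hj, e3]
    refine ⟨by simp [hj, e3, w1, w2, w5], fun hd => ?_, fun hd => ?_⟩
    · refine ⟨by simp [hj, e2, w2, w4], by simp [e4, w6], by simp [hj, w1, w2, w3], by simp,
        i - 1, by omega, by simp [hj]; omega, fun u => ?_⟩
      simp only [State.setReg_arr, State.setArr_arr, if_true, Expr.eval_add, Expr.eval_reg,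
        State.setReg_reg, State.setArr_reg, Expr.eval_const, hj, e2, e4]
      rw [Function.update_apply]
      by_cases hu : u = S j
      · rw [if_pos hu, if_pos ⟨j, by omega, hd, hu.symm⟩]
      · rw [if_neg hu, h2]
        refine if_congr ⟨fun ⟨l, hl, h⟩ => ⟨l, by omega, h⟩, fun ⟨l, hl, h, h'⟩ => ?_⟩ rfl rfl
        rcases Nat.lt_succ_iff_lt_or_eq.1 hl with hl | rfl
        · exact ⟨l, hl, h, h'⟩
        · exact absurd h'.symm hu
    · refine ⟨by simp [hj, w1, w2, w3], by simp, i - 1, by omega, by simp [hj]; omega, fun u => ?_⟩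
      simp only [State.setReg_arr, if_true, Expr.eval_add, Expr.eval_reg,
        State.setReg_reg, Expr.eval_const, hj]
      rw [h2]
      refine if_congr ⟨fun ⟨l, hl, h⟩ => ⟨l, by omega, h⟩, fun ⟨l, hl, h, h'⟩ => ?_⟩ rfl rfl
      rcases Nat.lt_succ_iff_lt_or_eq.1 hl with hl | rfl
      · exact ⟨l, hl, h, h'⟩
      · exact absurd h hd
  · rintro t s₁ hb₁ hF ⟨ht, hn, i, h1, h2⟩
    have e1 : s₁.reg rSize = m := (hF.reg rSize rfl).trans hm
    simp only [Test.holds_lt, Expr.eval_reg, e1] at hn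
    have : s₁.reg rJ = m := by omega
    rw [this] at h2
    exact ⟨by simp at ht ⊢; omega, h2⟩

theorem wp_recolor {w : ℕ} {s : State} {S : ℕ → ℕ} {m c : ℕ} {H : ℕ → ℕ → ℚ} {T : ℕ → ℚ}
    {ch col : ℕ → ℕ} (hb : Bounded w s) (hw : (c + 1) * 3 ^ m + 4 < cap w) (hc : 0 < c)
    (hm : s.reg rSize = m) (hS : s.arr aSet = S) (hinj : Set.InjOn S (Set.Iio m))
    (hB : s.reg rB = 3 ^ m) (hfull : s.reg rFull = encode m fun _ => 1) (hC : s.reg rC = c)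
    (hcol : s.arr aCol = col) (hch : s.arr aChoice = ch) (hH : ClassFun m H)
    (hR : ∀ i < c, Relaxed H m i T ch (3 ^ m)) (hT : T 0 = 0) :
    WP w recolor s fun t s' => t ≤ c * (m * 100 + 100) + 20 ∧
      (∀ u, (∀ j < m, S j ≠ u) → s'.arr aCol u = col u) ∧
      (∀ j < m, s'.arr aCol (S j) < c) ∧
      ∑ l ∈ Finset.range c,
        H l (codeOf m ((Finset.range m).filter fun j => s'.arr aCol (S j) = l)) =
        T (c * 3 ^ m + encode m fun _ => 1) := by
  have hmw : m < cap w := hm ▸ hb.reg _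
  have hcw : c < cap w := hC ▸ hb.reg _
  have w0 : 0 < cap w := by omega
  have w1 : 1 < cap w := by omega
  have p1 : (c + 1) * 3 ^ m = c * 3 ^ m + 3 ^ m := by ring
  have hfullX : (encode m fun _ => 1) = codeOf m (Finset.range m) :=
    encode_congr fun j hj => by simp [hj]
  rw [hfullX] at hfull ⊢
  simp only [recolor, wp_seq, wp_set]
  simp only [Expr.eval_reg, State.setReg_reg]
  refine ⟨by simp [hb.reg], by simp [hb.reg], ?_⟩
  rw [if_neg (by norm_num), hfull, hC]
  have hfb := codeOf_lt m (Finset.range m)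
  have hb₀ : Bounded w ((s.setReg rMask (codeOf m (Finset.range m))).setReg rCol c) :=
    (hb.setReg (by omega)).setReg hcw
  refine (wp_loop c (m * 90 + 80) (fun i s' => s'.reg rCol = i ∧ i ≤ c ∧ ∃ X ⊆ Finset.range m,
      s'.reg rMask = codeOf m X ∧ (i = 0 → X = ∅) ∧
      (∀ u, (∀ j < m, j ∉ X → S j ≠ u) → s'.arr aCol u = col u) ∧
      (∀ j < m, j ∉ X → i ≤ s'.arr aCol (S j) ∧ s'.arr aCol (S j) < c) ∧
      T (i * 3 ^ m + codeOf m X) + ∑ l ∈ Finset.Ico i c, H l (codeOf m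
        ((Finset.range m).filter fun j => j ∉ X ∧ s'.arr aCol (S j) = l)) =
        T (c * 3 ^ m + codeOf m (Finset.range m)))
    hb₀ ?_ ?_).conseq hb₀ ?_
  · refine ⟨by simp, le_rfl, Finset.range m, subset_rfl, by simp, by omega,
      fun u _ => by simp [hcol],
      fun j hj hj' => absurd (Finset.mem_range.2 hj) hj', by simp⟩
  · rintro i s₁ ⟨h1, hic, X, hX, h2, h3, h4, h5, h6⟩ hb₁ hF
    have e1 : s₁.reg rSize = m := (hF.reg rSize rfl).trans hm
    have e2 : s₁.arr aSet = S := (hF.arr aSet rfl).trans hS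
    have e3 : s₁.arr aChoice = ch := (hF.arr aChoice rfl).trans hch
    have e4 : s₁.reg rB = 3 ^ m := (hF.reg rB rfl).trans hB
    refine ⟨by simp [hb₁.reg, w0], fun hlt => ?_⟩
    simp only [Test.holds_lt, Expr.eval_reg, Expr.eval_const, h1] at hlt
    obtain ⟨i, rfl⟩ : ∃ i', i = i' + 1 := ⟨i - 1, by omega⟩
    have hXb := codeOf_lt m X
    have p2 : (i + 1) * 3 ^ m ≤ c * 3 ^ m := Nat.mul_le_mul_right _ hic
    have hrel := hR i (by omega) _ hXb fun _ => restOf_codeOf m X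
    rw [maskOf_codeOf, restOf_codeOf] at hrel
    obtain ⟨-, r1, r2, r3, r4⟩ := hrel
    obtain ⟨t, ht⟩ : ∃ t, ch ((i + 1) * 3 ^ m + codeOf m X) = t := ⟨_, rfl⟩
    rw [ht] at r1 r2 r3 r4
    have q1 : (i + 1) * 3 ^ m < cap w := by omega
    have q2 : (i + 1) * 3 ^ m + codeOf m X < cap w := by omega
    have q3 : t < cap w := by omega
    have q4 : 3 ^ m < cap w := by omega
    have q5 : codeOf m X < cap w := by omega
    have q6 : i + 1 < cap w := by omega
    have q7 : i < cap w := by omega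
    simp only [wp_seq, wp_set]
    refine ⟨by simp [h1, h2, e3, e4, q1, q2, q3, q4, q5, q6, ht], by simp [h1, q6, q7, w1], ?_⟩
    simp only [Expr.eval_get, Expr.eval_add, Expr.eval_mul, Expr.eval_sub, Expr.eval_reg,
      Expr.eval_const, h1, h2, e3, e4, ht]
    have e5 : ((s₁.setReg rT t).reg rCol) - 1 = i := by simp [h1]
    rw [e5]
    have hb₂ : Bounded w ((s₁.setReg rT t).setReg rCol i) := (hb₁.setReg q3).setReg q7
    refine (wp_splitCode hb₂ (m := m) (by simp [e1]) (by omega) (by simpa using r1)).conseq hb₂ ?_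
    rintro t₁ s₂ hb₃ hF₂ ⟨ht₁, d1, -, d2⟩
    simp only [State.setReg_reg] at d1 d2
    norm_num at d1 d2
    refine (wp_paintClass hb₃ (by omega) ((hF₂.reg rSize rfl).trans e1)
      ((hF₂.arr aSet rfl).trans e2)).conseq hb₃ ?_
    rintro t₂ s₃ hb₄ hF₃ ⟨ht₂, hp⟩
    have e6 : s₂.reg rCol = i := hF₂.reg rCol rfl
    have e7 : s₂.arr aCol = s₁.arr aCol := hF₂.arr aCol rfl
    have e8 : s₃.reg rRest = restOf m t := (hF₃.reg rRest rfl).trans d2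
    have e9 : s₃.reg rCol = i := (hF₃.reg rCol rfl).trans e6
    rw [e6, e7] at hp
    set X' := (Finset.range m).filter fun j => dig t j = 2 with hX'
    have hrest : restOf m t = codeOf m X' :=
      encode_congr fun j hj => by simp [hX', hj]
    have hdX : ∀ j < m, j ∈ X ↔ dig t j ≠ 0 := fun j hj => by
      have := dig_maskOf (t := t) hj
      rw [r2, dig_codeOf X hj] at this
      split_ifs at this with c1 c2 <;> simp_all
    have hdX' : ∀ j < m, j ∈ X' ↔ dig t j = 2 := fun j hj => by simp [hX', hj]
    -- how the step changes the color of a list vertex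
    have hnew : ∀ j < m, s₃.arr aCol (S j) = if dig t j = 1 then i else s₁.arr aCol (S j) := by
      intro j hj
      rw [hp]
      refine if_congr ⟨?_, fun h => ⟨j, hj, by rw [d1 j hj, h], rfl⟩⟩ rfl rfl
      rintro ⟨l, hl, h, h'⟩
      rw [← hinj hl hj h', ← d1 l hl, h]
    have e10 : restOf m t < cap w := e8 ▸ hb₄.reg rRest
    refine ⟨by simp [e8, e10], ?_, i, by omega, by simp [e9],
      by omega, X', Finset.filter_subset _ _, by simp [e8, hrest], fun hi0 => ?_, fun u hu => ?_,
      fun j hj hjX => ?_, ?_⟩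
    · simp
      omega
    · refine Finset.eq_empty_of_forall_notMem fun j hj => ?_
      have hjm := Finset.mem_range.1 (Finset.mem_filter.1 hj).1
      have := dig_restOf (t := t) hjm
      rw [r3 hi0, if_pos ((hdX' j hjm).1 hj)] at this
      simp [dig] at this
    · simp only [State.setReg_arr]
      rw [hp, if_neg, h4 u fun j hj hjX => hu j hj fun h => hjX ?_]
      · rw [hdX j hj, (hdX' j hj).1 h]
        norm_num
      · rintro ⟨j, hj, h, h'⟩
        refine hu j hj (fun hjX => ?_) h'
        rw [d1 j hj, (hdX' j hj).1 hjX] at h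
        norm_num at h
    · simp only [State.setReg_arr]
      rw [hnew j hj]
      split_ifs with h
      · omega
      · have h0 := dig_lt t j
        have := h5 j hj fun hjX' => by
          have h1 := (hdX j hj).1 hjX'
          exact hjX ((hdX' j hj).2 (by omega))
        omega
    · change T (i * 3 ^ m + codeOf m X') + ∑ l ∈ Finset.Ico i c, H l (codeOf m
        ((Finset.range m).filter fun j => j ∉ X' ∧ s₃.arr aCol (S j) = l)) = _
      rw [← h6, r4, hrest, Finset.sum_eq_sum_Ico_succ_bot (by omega : i < c), ← add_assoc]
      congr 1
      · congr 1
        refine hH i _ _ fun j hj => ?_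
        rw [dig_codeOf _ hj]
        simp only [Finset.mem_filter, Finset.mem_range, hdX' j hj, hnew j hj]
        have h0 := dig_lt t j
        by_cases hd : dig t j = 1
        · simp [hd, hj]
        · have : dig t j ≠ 2 → s₁.arr aCol (S j) ≠ i := fun h2 => by
            have := (h5 j hj fun hjX' => by have := (hdX j hj).1 hjX'; omega).1
            omega
          simp only [hd, if_false, iff_false]
          split_ifs <;> simp_all
      · refine Finset.sum_congr rfl fun l hl => ?_
        have hl := Finset.mem_Ico.1 hl
        congr 1
        refine codeOf_congr fun j hj => ?_
        simp only [Finset.mem_filter, Finset.mem_range, hdX' j hj, hnew j hj, hdX j hj]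
        have h0 := dig_lt t j
        by_cases hd : dig t j = 1
        · simp only [hd, if_true]
          omega
        · simp only [hd, if_false]
          constructor <;> rintro ⟨g1, g2, g3⟩ <;> refine ⟨g1, by omega, g3⟩
  · rintro t s₁ hb₁ hF ⟨ht, hn, i, h1, hic, X, hX, h2, h3, h4, h5, h6⟩
    simp only [Test.holds_lt, Expr.eval_reg, Expr.eval_const, h1] at hn
    obtain rfl : i = 0 := by omega
    obtain rfl := h3 rfl
    refine ⟨by simp at ht ⊢; nlinarith, fun u hu => h4 u fun j hj _ => hu j hj,
      fun j hj => (h5 j hj (by simp)).2, ?_⟩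
    simp [codeOf_empty, hT] at h6
    rw [← h6, Finset.range_eq_Ico]

/-! ### Combinations in colexicographic order -/

/-- The numbers `p 0, …, p K` increase strictly. -/
def IsComb (K : ℕ) (p : ℕ → ℕ) : Prop := ∀ i < K, p i < p (i + 1)

/-- The position of `{p 0 < … < p K}` among the sets of `K + 1` numbers in colexicographic order. -/
def rank (K : ℕ) (p : ℕ → ℕ) : ℕ := ∑ i ∈ Finset.range (K + 1), (p i).choose (i + 1)

theorem rank_zero (p : ℕ → ℕ) : rank 0 p = p 0 := by simp [rank]

theorem rank_succ (K : ℕ) (p : ℕ → ℕ) :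
    rank (K + 1) p = rank K p + (p (K + 1)).choose (K + 1 + 1) :=
  Finset.sum_range_succ _ _

theorem choose_le_rank (K : ℕ) (p : ℕ → ℕ) : (p K).choose (K + 1) ≤ rank K p := by
  rw [rank, Finset.sum_range_succ]
  exact Nat.le_add_left _ _

theorem rank_lt {K : ℕ} {p : ℕ → ℕ} (h : IsComb K p) : rank K p < (p K + 1).choose (K + 1) := by
  induction K with
  | zero => simp [rank_zero]
  | succ K ih =>
    have h1 := ih fun i hi => h i (by omega)
    have h2 : (p K + 1).choose (K + 1) ≤ (p (K + 1)).choose (K + 1) :=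
      Nat.choose_le_choose _ (h K (by omega))
    rw [rank_succ, Nat.choose_succ_succ']
    omega

/-- The maximum of a combination can be read off from its rank. -/
theorem rank_injective {K : ℕ} {p q : ℕ → ℕ} (hp : IsComb K p) (hq : IsComb K q)
    (h : rank K p = rank K q) : ∀ i ≤ K, p i = q i := by
  have key : ∀ {K : ℕ} {p q : ℕ → ℕ}, IsComb K p → rank K p = rank K q → q K ≤ p K := by
    intro K p q hp h
    by_contra! hlt
    have h1 := rank_lt hp
    have h2 : (p K + 1).choose (K + 1) ≤ (q K).choose (K + 1) := Nat.choose_le_choose _ hlt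
    have h3 := choose_le_rank K q
    omega
  induction K with
  | zero =>
    intro i hi
    obtain rfl : i = 0 := by omega
    exact le_antisymm (key hq h.symm) (key hp h)
  | succ K ih =>
    have he : p (K + 1) = q (K + 1) := le_antisymm (key hq h.symm) (key hp h)
    rw [rank_succ, rank_succ, he, Nat.add_right_cancel_iff] at h
    intro i hi
    rcases Nat.lt_succ_iff_lt_or_eq.1 (Nat.lt_succ_of_le hi) with hi | rfl
    · exact ih (fun i hi => hp i (by omega)) (fun i hi => hq i (by omega)) h i (by omega)
    · exact he

/-- A run of consecutive numbers is the last set before its maximum must increase. -/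
theorem rank_consecutive {i : ℕ} {p : ℕ → ℕ} (h : ∀ j < i, p j + 1 = p (j + 1)) :
    rank i p + 1 = (p i + 1).choose (i + 1) := by
  induction i with
  | zero => simp [rank_zero]
  | succ i ih =>
    have h1 := ih fun j hj => h j (by omega)
    rw [h i (by omega)] at h1
    rw [rank_succ, Nat.choose_succ_succ', ← h1]
    omega

/-- The step to the next combination, at the first place `i` where there is a gap, raises the rank
by `1`. -/
theorem rank_next {K i : ℕ} {p : ℕ → ℕ} (hi : i ≤ K) (h : ∀ j < i, p j + 1 = p (j + 1)) :
    rank K (fun j => if j < i then j else if j = i then p i + 1 else p j) = rank K p + 1 := by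
  induction K, hi using Nat.le_induction with
  | base =>
    rw [rank_consecutive h, rank, Finset.sum_range_succ, Finset.sum_eq_zero]
    · simp
    · intro j hj
      rw [if_pos (Finset.mem_range.1 hj)]
      exact Nat.choose_eq_zero_of_lt (Nat.lt_succ_self j)
  | succ K hK ih =>
    rw [rank_succ, rank_succ, ih, if_neg (by omega), if_neg (by omega)]
    omega

theorem IsComb.le {K : ℕ} {p : ℕ → ℕ} (h : IsComb K p) {i j : ℕ} (hij : i ≤ j) (hj : j ≤ K) :
    p i ≤ p j := by
  induction j, hij using Nat.le_induction with
  | base => exact le_rfl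
  | succ j hij ih => exact (ih (by omega)).trans (h j (by omega)).le

theorem IsComb.self_le {K : ℕ} {p : ℕ → ℕ} (h : IsComb K p) {i : ℕ} (hi : i ≤ K) : i ≤ p i := by
  induction i with
  | zero => omega
  | succ i ih => exact (ih (by omega)).trans_lt (h i (by omega))

theorem IsComb.next {K i : ℕ} {p : ℕ → ℕ} (h : IsComb K p) (hi : i ≤ K)
    (hn : i < K → p i + 1 ≠ p (i + 1)) :
    IsComb K (fun j => if j < i then j else if j = i then p i + 1 else p j) := by
  intro j hj
  have h1 := h j hj
  have h2 := h.self_le hi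
  dsimp only
  split_ifs with c1 c2 c3 c4 c5 c6 c7 c8 <;> try omega
  subst c4
  have := hn hj
  omega

theorem wp_nextComb {w : ℕ} {s : State} {K : ℕ} {p : ℕ → ℕ} (hb : Bounded w s)
    (hp : s.arr aComb = p) (hc : IsComb K p) (h0 : p (K + 1) = 0) (hw : p K + 1 < cap w)
    (hK : K + 4 < cap w) :
    WP w nextComb s fun t s' => t ≤ K * 30 + 40 ∧ IsComb K (s'.arr aComb) ∧
      s'.arr aComb (K + 1) = 0 ∧ p K ≤ s'.arr aComb K ∧ rank K (s'.arr aComb) = rank K p + 1 := by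
  have w0 : 0 < cap w := by omega
  have w1 : 1 < cap w := by omega
  simp only [nextComb, wp_seq, wp_set]
  simp only [Expr.eval_const]
  refine ⟨by simp [w0], ?_⟩
  have hb₀ : Bounded w (s.setReg rI 0) := hb.setReg w0
  refine (wp_loop K 20 (fun i' s' => s'.reg rI + i' = K ∧
      (∀ j < s'.reg rI, p j + 1 = p (j + 1)) ∧
      s'.arr aComb = fun j => if j < s'.reg rI then j else p j)
    hb₀ (by simp [hp]) ?_).conseq hb₀ ?_
  · rintro i' s₁ ⟨h1, h2, h3⟩ hb₁ hF
    obtain ⟨i, hi⟩ : ∃ i, s₁.reg rI = i := ⟨_, rfl⟩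
    rw [hi] at h1 h2 h3
    have w2 : i < cap w := by omega
    have w3 : i + 1 < cap w := by omega
    have w4 : p i + 1 < cap w := by have := hc.le (show i ≤ K by omega) le_rfl; omega
    have w5 : p i < cap w := by omega
    have w6 : p (i + 1) < cap w := hp ▸ hb.arr _ _
    refine ⟨by simp [hi, h3, w1, w2, w3, w4, w5, w6], fun ht => ?_⟩
    simp [hi, h3] at ht
    have : i ≠ K := by rintro rfl; omega
    simp only [wp_seq, wp_store, wp_set]
    refine ⟨by simp [hi, w2], by simp [hi, w2], by simp [hi, w1, w2, w3], by simp, i' - 1, by omega,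
      by simp [hi]; omega, ?_, ?_⟩
    · simp only [Expr.eval_add, Expr.eval_reg, State.setArr_reg, hi, Expr.eval_const,
        State.setReg_reg, if_true]
      intro j hj
      rcases Nat.lt_succ_iff_lt_or_eq.1 hj with hj | rfl
      · exact h2 j hj
      · exact ht
    · funext j
      simp [hi, h3, Function.update_apply]
      split_ifs <;> omega
  · rintro t s₁ hb₁ hF ⟨ht, hn, i', h1, h2, h3⟩
    obtain ⟨i, hi⟩ : ∃ i, s₁.reg rI = i := ⟨_, rfl⟩
    rw [hi] at h1 h2 h3
    simp [hi, h3] at hn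
    have w2 : i < cap w := by omega
    have w4 : p i + 1 < cap w := by have := hc.le (show i ≤ K by omega) le_rfl; omega
    have w5 : p i < cap w := by omega
    have e : Function.update (s₁.arr aComb) i (p i + 1) =
        fun j => if j < i then j else if j = i then p i + 1 else p j := by
      funext j
      rw [Function.update_apply, h3]
      dsimp only
      split_ifs <;> omega
    have h4 := hc.next (by omega : i ≤ K) fun _ => hn
    have h5 := rank_next (by omega : i ≤ K) h2
    rw [← e] at h4 h5
    rw [wp_store]
    refine ⟨by simp [hi, w2], by simp [hi, h3, w1, w2, w4, w5], by simp at ht ⊢; omega, ?_⟩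
    simp only [State.setArr_arr, if_true, Expr.eval_add, Expr.eval_reg, Expr.eval_get,
      Expr.eval_const, hi]
    have e' : s₁.arr aComb i = p i := by simp [h3]
    rw [e']
    refine ⟨h4, ?_, ?_, h5⟩
    · rw [e]
      dsimp only
      rw [if_neg (by omega), if_neg (by omega), h0]
    · rw [e]
      dsimp only
      split_ifs with c1 c2
      · omega
      · rw [c2]; omega
      · exact le_rfl

theorem wp_initComb {w : ℕ} {s : State} {K M : ℕ} (hb : Bounded w s) (hk : s.reg rK = K + 1)
    (hM : s.reg rM = M) (hKM : K ≤ M) (hw : 4 < cap w) :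
    WP w initComb s fun t s' => t ≤ K * 30 + 40 ∧ IsComb K (s'.arr aComb) ∧
      s'.arr aComb K = M ∧ s'.arr aComb (K + 1) = 0 ∧
      rank K (s'.arr aComb) = M.choose (K + 1) := by
  have w0 : 0 < cap w := by omega
  have w1 : 1 < cap w := by omega
  have hKw : K + 1 < cap w := hk ▸ hb.reg _
  have hMw : M < cap w := hM ▸ hb.reg _
  have w2 : K < cap w := by omega
  simp only [initComb, wp_seq, wp_set]
  simp only [Expr.eval_const]
  refine ⟨by simp [w0], ?_⟩
  have hb₀ : Bounded w (s.setReg rI 0) := hb.setReg w0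
  refine (wp_loop K 20 (fun i' s' => s'.reg rI + i' = K ∧
      (∀ j < s'.reg rI, s'.arr aComb j = j)) hb₀ (by simp) ?_).conseq hb₀ ?_
  · rintro i' s₁ ⟨h1, h2⟩ hb₁ hF
    have e1 : s₁.reg rK = K + 1 := (hF.reg rK rfl).trans hk
    obtain ⟨i, hi⟩ : ∃ i, s₁.reg rI = i := ⟨_, rfl⟩
    rw [hi] at h1 h2
    have w3 : i < cap w := by omega
    have w4 : i + 1 < cap w := by omega
    refine ⟨by simp [hi, e1, w1, w2, w3, hKw], fun ht => ?_⟩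
    simp [hi, e1] at ht
    simp only [wp_seq, wp_store, wp_set]
    refine ⟨by simp [hi, w3], by simp [hi, w3], by simp [hi, w1, w3, w4], by simp, i' - 1, by omega,
      by simp [hi]; omega, ?_⟩
    simp only [Expr.eval_add, Expr.eval_reg, State.setArr_reg, hi, Expr.eval_const,
      State.setReg_reg, if_true, State.setReg_arr, State.setArr_arr, Function.update_apply]
    intro j hj
    split_ifs with c
    · exact c.symm
    · exact h2 j (by omega)
  · rintro t s₁ hb₁ hF ⟨ht, hn, i', h1, h2⟩
    have e1 : s₁.reg rK = K + 1 := (hF.reg rK rfl).trans hk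
    have e2 : s₁.reg rM = M := (hF.reg rM rfl).trans hM
    simp [e1] at hn
    have e3 : s₁.reg rI = K := by omega
    rw [e3] at h2
    simp only [wp_store]
    refine ⟨by simp [e1, w1, w2, hKw], by simp [e2, hMw], by simp [e1, hKw], by simp [w0],
      by simp at ht ⊢; omega, ?_⟩
    simp only [State.setArr_arr, if_true, Expr.eval_sub, Expr.eval_reg, Expr.eval_const,
      State.setArr_reg, e1, e2, Nat.add_sub_cancel]
    have f1 : ∀ j < K, Function.update (Function.update (s₁.arr aComb) K M) (K + 1) 0 j = j := by
      intro j hj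
      rw [Function.update_of_ne (by omega), Function.update_of_ne (by omega), h2 j hj]
    have f2 : Function.update (Function.update (s₁.arr aComb) K M) (K + 1) 0 K = M := by
      rw [Function.update_of_ne (by omega), Function.update_self]
    refine ⟨fun j hj => ?_, f2, Function.update_self _ _ _, ?_⟩
    · rw [f1 j hj]
      rcases (show j + 1 < K ∨ j + 1 = K by omega) with h | h
      · rw [f1 _ h]; omega
      · rw [h, f2]; omega
    · rw [rank, Finset.sum_range_succ, Finset.sum_eq_zero, f2, zero_add]
      intro j hj
      rw [f1 j (Finset.mem_range.1 hj)]
      exact Nat.choose_eq_zero_of_lt (Nat.lt_succ_self j)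

/-! ### The guided breadth-first search -/

/-- A stage of the search: the list of the vertices found, the number of slots passed, and the slots
at which the vertices after the root were taken. -/
structure Stage where
  list : List ℕ
  slot : ℕ
  taken : List ℕ

/-- Looks at the vertex `u`. A vertex outside the list passes a slot; the guide `dec` decides
whether it is taken. -/
def Stage.step (dec : Stage → ℕ → Bool) (x : Stage) (u : ℕ) : Stage :=
  if u ∈ x.list then x
  else if dec x u then ⟨x.list ++ [u], x.slot + 1, x.taken ++ [x.slot]⟩
  else ⟨x.list, x.slot + 1, x.taken⟩

/-- The guide that takes the slots `p 0, p 1, …`, up to a list of length `k`. -/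
def combGuide (k : ℕ) (p : ℕ → ℕ) (x : Stage) (_u : ℕ) : Bool :=
  decide (x.list.length < k ∧ p (x.list.length - 1) = x.slot)

/-- The guide that takes the vertices of `D`. -/
def setGuide (D : Finset ℕ) (_x : Stage) (u : ℕ) : Bool := decide (u ∈ D)

namespace Data

variable (G : Data)

/-- The neighbors of `v`, in the order of the input. -/
def nbrs (v : ℕ) : List ℕ := (List.range' (G.st v) (G.st (v + 1) - G.st v)).map G.nb

/-- Looks at all neighbors of the list vertex number `j`. -/
def round (dec : Stage → ℕ → Bool) (x : Stage) (j : ℕ) : Stage :=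
  if j < x.list.length then (G.nbrs (x.list.getD j 0)).foldl (Stage.step dec) x else x

/-- The stage before the list vertex number `j` is processed. -/
def run (dec : Stage → ℕ → Bool) (v j : ℕ) : Stage :=
  (List.range j).foldl (G.round dec) ⟨[v], 0, []⟩

end Data

theorem Data.run_zero (G : Data) (dec : Stage → ℕ → Bool) (v : ℕ) :
    G.run dec v 0 = ⟨[v], 0, []⟩ := rfl

theorem Data.run_succ (G : Data) (dec : Stage → ℕ → Bool) (v j : ℕ) :
    G.run dec v (j + 1) = G.round dec (G.run dec v j) j := by
  rw [Data.run, List.range_succ, List.foldl_append]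
  rfl

theorem Data.mem_nbrs {G : Data} {v u : ℕ} : u ∈ G.nbrs v ↔ ∃ e ∈ G.adj v, G.nb e = u := by
  simp only [Data.nbrs, List.mem_map, List.mem_range'_1, Data.adj, Finset.mem_Ico]
  refine exists_congr fun e => and_congr_left fun _ => and_congr_right fun h => ?_
  omega

/-- To prove a property of all stages it suffices to follow it through the visits of neighbors. -/
theorem Data.run_induction {G : Data} {dec : Stage → ℕ → Bool} {v : ℕ} (I : Stage → Prop)
    (h0 : I ⟨[v], 0, []⟩)
    (hs : ∀ x y u, I x → y ∈ x.list → u ∈ G.nbrs y → I (x.step dec u)) (j : ℕ) :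
    I (G.run dec v j) := by
  have mem_step : ∀ (x : Stage) (y u : ℕ), y ∈ x.list → y ∈ (x.step dec u).list := by
    intro x y u hy
    rw [Stage.step]
    split_ifs <;> simp [hy]
  have fold : ∀ (l : List ℕ) (x : Stage) (y : ℕ), I x → y ∈ x.list → (∀ u ∈ l, u ∈ G.nbrs y) →
      I (l.foldl (Stage.step dec) x) := by
    intro l
    induction l with
    | nil => exact fun x y hx _ _ => hx
    | cons u l ih =>
      exact fun x y hx hy hl => ih _ y (hs x y u hx hy (hl u (by simp))) (mem_step x y u hy)
        fun u' hu' => hl u' (by simp [hu'])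
  induction j with
  | zero => exact h0
  | succ j ih =>
    rw [Data.run_succ, Data.round]
    split_ifs with h
    · refine fold _ _ _ ih ?_ fun u hu => hu
      rw [List.getD_eq_getElem _ _ h]
      exact List.getElem_mem h
    · exact ih

/-- What holds for all stages, whatever the guide. -/
structure Stage.Good (G : Data) (v : ℕ) (x : Stage) : Prop where
  nodup : x.list.Nodup
  lt : ∀ u ∈ x.list, u < G.n
  length_taken : x.list.length = x.taken.length + 1
  root : ∃ l, x.list = v :: l
  sorted : x.taken.Pairwise (· < ·)
  taken_lt : ∀ q ∈ x.taken, q < x.slot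
  parent : ∀ u ∈ x.list, u = v ∨ ∃ y ∈ x.list, y ∈ G.nbrs u

theorem Stage.Good.step {G : Data} (hG : G.Valid) {v : ℕ} {dec : Stage → ℕ → Bool} {x : Stage}
    (h : x.Good G v) {y u : ℕ} (hy : y ∈ x.list) (hu : u ∈ G.nbrs y) :
    (x.step dec u).Good G v := by
  obtain ⟨e, he, hn⟩ := Data.mem_nbrs.1 hu
  have hyn := h.lt y hy
  rw [Stage.step]
  split_ifs with h1 h2
  · exact h
  · obtain ⟨l, hl⟩ := h.root
    refine ⟨?_, ?_, by simp [h.length_taken], ⟨l ++ [u], by simp [hl]⟩, ?_, ?_, ?_⟩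
    · simpa [List.nodup_append, h.nodup] using fun a ha hau => h1 (by rwa [← hau])
    · intro z hz
      rcases List.mem_append.1 hz with hz | hz
      · exact h.lt z hz
      · rw [List.mem_singleton.1 hz, ← hn]
        exact hG.nb_lt y hyn e he
    · rw [List.pairwise_append]
      exact ⟨h.sorted, by simp, fun a ha b hb => by
        rw [List.mem_singleton.1 hb]
        exact h.taken_lt a ha⟩
    · intro q hq
      rcases List.mem_append.1 hq with hq | hq
      · exact Nat.lt_succ_of_lt (h.taken_lt q hq)
      · rw [List.mem_singleton.1 hq]
        exact Nat.lt_succ_self _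
    · intro z hz
      rcases List.mem_append.1 hz with hz | hz
      · refine (h.parent z hz).imp_right fun ⟨y, hy, hyz⟩ => ⟨y, by simp [hy], hyz⟩
      · rw [List.mem_singleton.1 hz]
        obtain ⟨e', he', hn'⟩ := hG.symm y hyn e he
        exact Or.inr ⟨y, by simp [hy], Data.mem_nbrs.2 ⟨e', hn ▸ he', hn'⟩⟩
  · exact ⟨h.nodup, h.lt, h.length_taken, h.root, h.sorted,
      fun q hq => Nat.lt_succ_of_lt (h.taken_lt q hq), h.parent⟩

theorem Data.run_good {G : Data} (hG : G.Valid) {v : ℕ} (hv : v < G.n) (dec : Stage → ℕ → Bool)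
    (j : ℕ) : (G.run dec v j).Good G v := by
  refine Data.run_induction (fun x => x.Good G v) ?_ (fun x y u h hy hu => h.step hG hy hu) j
  exact ⟨by simp, by simpa using hv, by simp, ⟨[], rfl⟩, by simp, by simp, by simp⟩

theorem Data.length_run_comb {G : Data} (hk : 1 ≤ G.k) (p : ℕ → ℕ) (v j : ℕ) :
    (G.run (combGuide G.k p) v j).list.length ≤ G.k := by
  refine Data.run_induction (fun x => x.list.length ≤ G.k) (by simpa using hk) ?_ j
  intro x y u h _ _
  rw [Stage.step]
  split_ifs with h1 h2
  · exact h
  · simp only [combGuide, decide_eq_true_eq] at h2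
    simp
    omega
  · exact h

/-- The rounds after the end of the list change nothing. -/
theorem Data.run_stable {G : Data} {dec : Stage → ℕ → Bool} {v j : ℕ}
    (h : (G.run dec v j).list.length ≤ j) {j' : ℕ} (hj : j ≤ j') :
    G.run dec v j' = G.run dec v j := by
  induction j', hj using Nat.le_induction with
  | base => rfl
  | succ j' hj ih => rw [Data.run_succ, ih, Data.round, if_neg (by omega)]

theorem combGuide_congr {k : ℕ} {p q : ℕ → ℕ} (h : ∀ i ≤ k - 1, p i = q i) :
    combGuide k p = combGuide k q := by
  funext x u
  simp only [combGuide]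
  refine decide_eq_decide.2 (and_congr_right fun hx => ?_)
  rw [h _ (by omega)]

/-- The combination `p` agrees with the slots taken so far, and selects none of the other slots
passed so far. -/
def Stage.Follows (k : ℕ) (p : ℕ → ℕ) (x : Stage) : Prop :=
  (∀ i < x.taken.length, x.taken.getD i 0 = p i) ∧
    (x.list.length < k → x.slot ≤ p (x.list.length - 1))

/-- What holds for all stages of the search guided by a set `D`. -/
structure Stage.In (D : Finset ℕ) (x : Stage) : Prop where
  subset : ∀ u ∈ x.list, u ∈ D
  nodup : x.list.Nodup
  length_taken : x.list.length = x.taken.length + 1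

theorem Stage.In.step {D : Finset ℕ} {x : Stage} (h : x.In D) (u : ℕ) :
    (x.step (setGuide D) u).In D := by
  rw [Stage.step]
  split_ifs with h1 h2
  · exact h
  · simp only [setGuide, decide_eq_true_eq] at h2
    refine ⟨?_, ?_, by simp [h.length_taken]⟩
    · intro z hz
      rcases List.mem_append.1 hz with hz | hz
      · exact h.subset z hz
      · rwa [List.mem_singleton.1 hz]
    · simpa [List.nodup_append, h.nodup] using fun a ha hau => h1 (by rwa [← hau])
  · exact ⟨h.subset, h.nodup, h.length_taken⟩

theorem Stage.In.length_le {D : Finset ℕ} {x : Stage} (h : x.In D) : x.list.length ≤ D.card := by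
  rw [← List.toFinset_card_of_nodup h.nodup]
  exact Finset.card_le_card fun u hu => h.subset u (List.mem_toFinset.1 hu)

/-- A combination that follows the stage after a visit makes the same decision at this visit as
the set `D`. -/
theorem Stage.Follows.step {k : ℕ} {D : Finset ℕ} (hD : D.card ≤ k) {p : ℕ → ℕ} {x : Stage}
    (h : x.In D) {u : ℕ} (hf : (x.step (setGuide D) u).Follows k p) :
    x.Follows k p ∧ x.step (combGuide k p) u = x.step (setGuide D) u := by
  have hlen := (h.step u).length_le
  have htk := h.length_taken
  rw [Stage.step] at hf hlen ⊢
  rw [Stage.step]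
  by_cases h1 : u ∈ x.list
  · simp only [if_pos h1] at hf ⊢
    exact ⟨hf, trivial⟩
  · simp only [if_neg h1] at hf hlen ⊢
    by_cases h2 : u ∈ D
    · simp only [setGuide, h2, decide_true, if_true, Stage.Follows, List.length_append,
        List.length_singleton] at hf hlen ⊢
      have e1 := hf.1 x.taken.length (by omega)
      rw [List.getD_append_right _ _ _ _ le_rfl] at e1
      simp at e1
      have e2 : x.list.length - 1 = x.taken.length := by omega
      refine ⟨⟨fun i hi => ?_, fun _ => ?_⟩, ?_⟩
      · rw [← hf.1 i (by omega), List.getD_append _ _ _ _ hi]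
      · rw [e2, ← e1]
      · rw [if_pos]
        simp only [combGuide, decide_eq_true_eq, e2, ← e1, and_true]
        omega
    · simp only [setGuide, h2, decide_false, Bool.false_eq_true, if_false, Stage.Follows] at hf ⊢
      refine ⟨⟨hf.1, fun hk => by have := hf.2 hk; omega⟩, ?_⟩
      rw [if_neg]
      simp only [combGuide, decide_eq_true_eq, not_and]
      intro hk
      have := hf.2 hk
      omega

theorem Stage.Follows.fold {k : ℕ} {D : Finset ℕ} (hD : D.card ≤ k) {p : ℕ → ℕ} (l : List ℕ)
    {x : Stage} (h : x.In D) (hf : (l.foldl (Stage.step (setGuide D)) x).Follows k p) :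
    x.Follows k p ∧
      l.foldl (Stage.step (combGuide k p)) x = l.foldl (Stage.step (setGuide D)) x := by
  induction l generalizing x with
  | nil => exact ⟨hf, rfl⟩
  | cons u l ih =>
    obtain ⟨h1, h2⟩ := ih (h.step u) hf
    obtain ⟨h3, h4⟩ := Stage.Follows.step hD h h1
    exact ⟨h3, by rw [List.foldl_cons, h4, h2, List.foldl_cons]⟩

theorem Data.run_in {G : Data} {D : Finset ℕ} {v : ℕ} (hv : v ∈ D) (j : ℕ) :
    (G.run (setGuide D) v j).In D :=
  Data.run_induction (fun x => x.In D) ⟨by simpa using hv, by simp, by simp⟩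
    (fun x _ u h _ _ => h.step u) j

/-- A combination that follows the last stage of the search guided by `D` guides the same search. -/
theorem Data.run_comb_eq {G : Data} {D : Finset ℕ} (hD : D.card ≤ G.k) {p : ℕ → ℕ} {v : ℕ}
    (hv : v ∈ D) {j : ℕ} (hf : (G.run (setGuide D) v j).Follows G.k p) :
    G.run (combGuide G.k p) v j = G.run (setGuide D) v j := by
  induction j with
  | zero => rfl
  | succ j ih =>
    have hin := Data.run_in (G := G) hv j
    rw [Data.run_succ, Data.round] at hf ⊢
    rw [Data.run_succ, Data.round]
    split_ifs at hf with h
    · obtain ⟨h1, h2⟩ := Stage.Follows.fold hD _ hin hf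
      rw [ih h1, if_pos h, if_pos h, h2]
    · rw [ih hf, if_neg h, if_neg h]

/-- The set found is closed: it contains the neighbors in `D` of its members. -/
theorem Data.run_closed {G : Data} {D : Finset ℕ} {v : ℕ} (j : ℕ) :
    ∀ i < j, i < (G.run (setGuide D) v j).list.length →
      ∀ u ∈ G.nbrs ((G.run (setGuide D) v j).list.getD i 0), u ∈ D →
        u ∈ (G.run (setGuide D) v j).list := by
  have step_prefix : ∀ (x : Stage) (u : ℕ), x.list <+: (x.step (setGuide D) u).list := by
    intro x u
    rw [Stage.step]
    split_ifs <;> simp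
  have fold_prefix : ∀ (l : List ℕ) (x : Stage),
      x.list <+: (l.foldl (Stage.step (setGuide D)) x).list := by
    intro l
    induction l with
    | nil => exact fun x => List.prefix_rfl
    | cons u l ih => exact fun x => (step_prefix x u).trans (ih _)
  have fold_mem : ∀ (l : List ℕ) (x : Stage), ∀ u ∈ l, u ∈ D →
      u ∈ (l.foldl (Stage.step (setGuide D)) x).list := by
    intro l
    induction l with
    | nil => simp
    | cons u' l ih =>
      intro x u hu hD
      rcases List.mem_cons.1 hu with rfl | hu
      · refine (fold_prefix l _).subset ?_
        rw [Stage.step]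
        split_ifs with h1 h2
        · exact h1
        · simp
        · simp [setGuide, hD] at h2
      · exact ih _ u hu hD
  induction j with
  | zero => intro i hi; omega
  | succ j ih =>
    rw [Data.run_succ, Data.round]
    split_ifs with hj
    · intro i hi hlen u hu hD
      have hpre := fold_prefix (G.nbrs ((G.run (setGuide D) v j).list.getD j 0))
        (G.run (setGuide D) v j)
      have hget : ∀ i < (G.run (setGuide D) v j).list.length,
          ((G.nbrs ((G.run (setGuide D) v j).list.getD j 0)).foldl (Stage.step (setGuide D))
            (G.run (setGuide D) v j)).list.getD i 0 = (G.run (setGuide D) v j).list.getD i 0 := by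
        intro i hi
        obtain ⟨t, ht⟩ := hpre
        rw [← ht, List.getD_append _ _ _ _ hi]
      rcases Nat.lt_succ_iff_lt_or_eq.1 hi with hi | rfl
      · rw [hget i (by omega)] at hu
        exact hpre.subset (ih i hi (by omega) u hu hD)
      · rw [hget i hj] at hu
        exact fold_mem _ _ u hu hD
    · intro i hi hlen u hu hD
      exact ih i (by omega) hlen u hu hD

/-- The root passes at most `d + 1` slots, and every other list vertex at most `d`, as its parent is
in the list already. -/
theorem Data.slot_run_le {G : Data} (hG : G.Valid) {v : ℕ} (hv : v < G.n) (dec : Stage → ℕ → Bool)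
    (j : ℕ) (hj : j ≤ (G.run dec v j).list.length) : (G.run dec v j).slot ≤ j * G.d + 1 := by
  have step_mem : ∀ (x : Stage) (y u : ℕ), y ∈ x.list → y ∈ (x.step dec u).list := by
    intro x y u hy
    rw [Stage.step]
    split_ifs <;> simp [hy]
  have fold_le : ∀ (l : List ℕ) (x : Stage), (l.foldl (Stage.step dec) x).slot ≤
      x.slot + l.length := by
    intro l
    induction l with
    | nil => simp
    | cons u l ih =>
      intro x
      refine (ih _).trans ?_
      rw [Stage.step]
      split_ifs <;> simp <;> omega
  have fold_lt : ∀ (l : List ℕ) (x : Stage) (y : ℕ), y ∈ l → y ∈ x.list →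
      (l.foldl (Stage.step dec) x).slot + 1 ≤ x.slot + l.length := by
    intro l
    induction l with
    | nil => simp
    | cons u l ih =>
      intro x y hy hyx
      rcases List.mem_cons.1 hy with rfl | hy
      · have := fold_le l x
        rw [List.foldl_cons, Stage.step, if_pos hyx, List.length_cons]
        omega
      · have h1 := ih (x.step dec u) y hy (step_mem x y u hyx)
        have h2 : (x.step dec u).slot ≤ x.slot + 1 := by
          rw [Stage.step]
          split_ifs <;> simp
        rw [List.foldl_cons, List.length_cons]
        omega
  induction j with
  | zero => simp [Data.run_zero]
  | succ j ih =>
    have hgood := Data.run_good hG hv dec j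
    rw [Data.run_succ, Data.round] at hj ⊢
    split_ifs at hj ⊢ with h
    · have ih := ih h.le
      set x := G.run dec v j
      have hy : x.list.getD j 0 ∈ x.list := by
        rw [List.getD_eq_getElem _ _ h]
        exact List.getElem_mem h
      have hdeg := hG.deg_le _ (hgood.lt _ hy)
      have hlen : (G.nbrs (x.list.getD j 0)).length ≤ G.d + 1 := by
        simp only [Data.nbrs, List.length_map, List.length_range']
        omega
      rcases Nat.eq_zero_or_pos j with rfl | hpos
      · have := fold_le (G.nbrs (x.list.getD 0 0)) x
        have h0 : x.slot = 0 := rfl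
        omega
      · rcases hgood.parent _ hy with hroot | ⟨y, hyx, hyn⟩
        · exfalso
          obtain ⟨l, hl⟩ := hgood.root
          have hnd := hgood.nodup
          rw [List.getD_eq_getElem _ _ h] at hroot
          have h0 : x.list[0]'(by omega) = v := by simp [hl]
          have := (hnd.getElem_inj_iff (hi := h) (hj := by omega)).1 (hroot.trans h0.symm)
          omega
        · have := fold_lt _ x y hyn hyx
          rw [Nat.add_mul]
          omega
    · omega

/-- Every set `D` of at most `k` vertices, searched from one of its members, is searched in the
same way by a strictly increasing combination of `k - 1` slots below `k * d + 1`. -/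
theorem Data.exists_comb {G : Data} (hG : G.Valid) {D : Finset ℕ} (hD : D.card ≤ G.k) {v : ℕ}
    (hv : v < G.n) (hvD : v ∈ D) :
    ∃ p, IsComb (G.k - 1) p ∧ p (G.k - 1) = G.k * G.d + 1 ∧
      G.run (combGuide G.k p) v G.k = G.run (setGuide D) v G.k := by
  set x := G.run (setGuide D) v G.k with hx
  have hk := hG.k_pos
  have hd := hG.d_pos
  have hgood := Data.run_good hG hv (setGuide D) G.k
  rw [← hx] at hgood
  have hlen : x.list.length ≤ G.k := (Data.run_in hvD G.k).length_le.trans hD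
  have htk := hgood.length_taken
  have hslot : x.slot ≤ x.list.length * G.d + 1 := by
    -- the search is over after as many rounds as there are list vertices
    obtain ⟨J, hJ⟩ : ∃ J, x.list.length = J := ⟨_, rfl⟩
    have hsettle : ∃ j ≤ G.k, (G.run (setGuide D) v j).list.length ≤ j := ⟨G.k, le_rfl, hlen⟩
    classical
    obtain ⟨hjk, hjl⟩ := Nat.find_spec hsettle
    set j := Nat.find hsettle with hj
    have hst := Data.run_stable hjl hjk
    have hge : j ≤ (G.run (setGuide D) v j).list.length := by
      by_contra! hlt
      have hj0 : j ≠ 0 := by omega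
      have h1 := Nat.find_min hsettle (m := j - 1) (by omega)
      push Not at h1
      have h2 := h1 (by omega)
      obtain ⟨i, hi⟩ : ∃ i, j = i + 1 := ⟨j - 1, by omega⟩
      rw [hi] at hlt
      rw [hi, Nat.add_sub_cancel] at h2
      have hmono : (G.run (setGuide D) v i).list.length ≤
          (G.run (setGuide D) v (i + 1)).list.length := by
        have fold : ∀ (l : List ℕ) (y : Stage), y.list.length ≤
            (l.foldl (Stage.step (setGuide D)) y).list.length := by
          intro l
          induction l with
          | nil => exact fun y => Nat.le_refl _
          | cons u l ih =>
            intro y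
            refine le_trans ?_ (ih _)
            rw [Stage.step]
            split_ifs <;> simp
        rw [Data.run_succ, Data.round]
        rw [if_pos h2]
        exact fold _ _
      omega
    have := Data.slot_run_le hG hv (setGuide D) j hge
    rw [hx, hst]
    have : j * G.d ≤ (G.run (setGuide D) v j).list.length * G.d := Nat.mul_le_mul_right _ hge
    omega
  -- `a` slots are used, so `b` places of the combination have to be filled up
  obtain ⟨a, ha⟩ : ∃ a, x.taken.length = a := ⟨_, rfl⟩
  have hla : x.list.length = a + 1 := by omega
  rw [hla] at hslot hlen
  obtain ⟨b, hb⟩ : ∃ b, G.k = a + 1 + b := ⟨G.k - (a + 1), by omega⟩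
  have hbd : b ≤ b * G.d := Nat.le_mul_of_pos_right _ hd
  have hM : G.k * G.d + 1 = (a + 1) * G.d + b * G.d + 1 := by rw [hb]; ring
  have hget : ∀ i < a, x.taken.getD i 0 < x.slot := by
    intro i hi
    rw [List.getD_eq_getElem _ _ (by omega)]
    exact hgood.taken_lt _ (List.getElem_mem _)
  -- the slots that are not used lie behind all slots that the search can pass
  refine ⟨fun i => if i < a then x.taken.getD i 0
    else if i < G.k - 1 then (a + 1) * G.d + 1 + (i - a) else G.k * G.d + 1, ?_, ?_, ?_⟩
  · intro i hi
    dsimp only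
    by_cases h1 : i + 1 < a
    · rw [if_pos (by omega), if_pos h1, List.getD_eq_getElem _ _ (by omega),
        List.getD_eq_getElem _ _ (by omega)]
      exact List.pairwise_iff_getElem.1 hgood.sorted _ _ _ _ (Nat.lt_succ_self i)
    · rw [if_neg h1]
      by_cases h2 : i < a
      · have := hget i h2
        rw [if_pos h2]
        split_ifs <;> omega
      · rw [if_neg h2, if_pos hi]
        split_ifs <;> omega
  · dsimp only
    rw [if_neg (by omega), if_neg (by omega)]
  · refine Data.run_comb_eq hD hvD ⟨fun i hi => ?_, fun hk' => ?_⟩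
    · rw [← hx] at hi ⊢
      dsimp only
      rw [if_pos (by omega)]
    · rw [← hx] at hk' ⊢
      rw [hla, Nat.add_sub_cancel]
      dsimp only
      rw [if_neg (by omega)]
      split_ifs <;> omega

/-- The memory holds the stage `x`. -/
structure Stage.Rep (x : Stage) (s : State) : Prop where
  size : s.reg rSize = x.list.length
  set : ∀ j < x.list.length, s.arr aSet j = x.list.getD j 0
  slot : s.reg rSlot = x.slot

theorem Stage.Rep.firstPos_lt {x : Stage} {s : State} (h : x.Rep s) (u : ℕ) :
    firstPos (s.arr aSet) (s.reg rSize) u < s.reg rSize ↔ u ∈ x.list := by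
  rw [firstPos_lt_iff, h.size, List.mem_iff_getElem]
  constructor
  · rintro ⟨j, hj, hu⟩
    exact ⟨j, hj, by rw [← hu, h.set j hj, List.getD_eq_getElem _ _ hj]⟩
  · rintro ⟨j, hj, hu⟩
    exact ⟨j, hj, by rw [← hu, h.set j hj, List.getD_eq_getElem _ _ hj]⟩

theorem wp_visitEdge {w : ℕ} {G : Data} {s : State} {x : Stage} {p : ℕ → ℕ} (hb : Bounded w s)
    (hw : G.Small w) (hM : Mem G s) (hx : x.Rep s) (hp : s.arr aComb = p)
    (he : s.reg rE + 1 < cap w) (hl : x.list.length ≤ G.k) (hl0 : 0 < x.list.length)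
    (hq : x.slot + 1 < cap w) :
    WP w visitEdge s fun t s' => t ≤ 14 * G.k + 80 ∧ s'.reg rE = s.reg rE + 1 ∧
      (x.step (combGuide G.k p) (G.nb (s.reg rE))).Rep s' := by
  have hn := hw.n_lt
  have hu : G.nb (s.reg rE) < cap w := by rw [← hM.nb]; exact hb.arr _ _
  rw [visitEdge, wp_seq, wp_set]
  refine ⟨by simp [hb.reg, hb.arr], ?_⟩
  have hb₁ := hb.setReg (x := rU) hu
  simp only [Expr.eval_get, Expr.eval_reg, hM.nb]
  rw [wp_seq]
  refine (wp_findPos hb₁ (by omega)).conseq hb₁ ?_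
  rintro t₁ s₁ hb₁ hF ⟨ht, hpos⟩
  have hM₁ : Mem G s₁ := (hM.setReg (by omega)).frame hF rfl
  have e1 : s₁.reg rSize = x.list.length := (hF.reg rSize rfl).trans hx.size
  have e2 : s₁.reg rU = G.nb (s.reg rE) := hF.reg rU rfl
  have e3 : s₁.reg rE = s.reg rE := hF.reg rE rfl
  have e4 : s₁.reg rSlot = x.slot := (hF.reg rSlot rfl).trans hx.slot
  have e5 : s₁.arr aSet = s.arr aSet := hF.arr aSet rfl
  have e6 : s₁.arr aComb = p := (hF.arr aComb rfl).trans hp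
  have hiff := hx.firstPos_lt (G.nb (s.reg rE))
  simp only [State.setReg_reg, State.setReg_arr, if_true] at hpos ht
  norm_num at hpos ht
  rw [← hpos, hx.size] at hiff
  rw [hx.size] at ht
  have w1 : 1 < cap w := by omega
  have w2 := hb₁.reg rPos
  have w3 : x.list.length < cap w := e1 ▸ hb₁.reg rSize
  have w4 : x.slot < cap w := by omega
  have w5 : ∀ i, p i < cap w := fun i => e6 ▸ hb₁.arr aComb i
  have w6 : x.list.length - 1 < cap w := by omega
  have w7 : G.k < cap w := hM.k ▸ hb.reg rK
  have w8 : s.reg rE < cap w := hb.reg _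
  simp only [wp_seq, wp_ite, wp_store, wp_set, wp_skip]
  refine ⟨by simp [e1, w2, w3], fun h1 => ?_, fun h1 => ?_⟩
  · simp only [Test.holds_lt, Expr.eval_reg, e1] at h1
    refine ⟨by simp [e3, w1, w8, he], by simp; omega, by simp [e3], ?_⟩
    rw [Stage.step, if_pos (hiff.1 h1)]
    exact ⟨by simp [e1], fun j hj => by simp [e5, hx.set j hj], by simp [e4]⟩
  · simp only [Test.holds_lt, Expr.eval_reg, e1] at h1
    refine ⟨by simp [e1, e4, e6, hM₁.k, w1, w3, w4, w5, w6, w7], fun h2 => ?_, fun h2 => ?_⟩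
    · simp [e1, e4, e6, hM₁.k] at h2
      have w9 : x.list.length + 1 < cap w := by omega
      refine ⟨by simp [e1, w3], by simp [e2, hu], by simp [e1, w1, w3, w9],
        by simp [e4, w1, w4, hq], by simp [e3, w1, w8, he], by simp; omega, by simp [e3], ?_⟩
      rw [Stage.step, if_neg fun h => h1 (hiff.2 h), if_pos (by simpa [combGuide] using h2)]
      refine ⟨by simp [e1], fun j hj => ?_, by simp [e4]⟩
      simp only [State.setReg_arr, State.setArr_arr, if_true, Expr.eval_reg, e1, e2, e5,
        Function.update_apply]
      simp only [List.length_append, List.length_singleton] at hj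
      split_ifs with hjl
      · rw [hjl, List.getD_append_right _ _ _ _ le_rfl]
        simp
      · rw [List.getD_append _ _ _ _ (by omega), hx.set j (by omega)]
    · simp [e1, e4, e6, hM₁.k] at h2
      refine ⟨by simp [e4, w1, w4, hq], by simp [e3, w1, w8, he], by simp; omega, by simp [e3], ?_⟩
      rw [Stage.step, if_neg fun h => h1 (hiff.2 h), if_neg (by simpa [combGuide] using h2)]
      exact ⟨by simp [e1], fun j hj => by simp [e5, hx.set j hj], by simp [e4]⟩

theorem Stage.length_le_step (dec : Stage → ℕ → Bool) (x : Stage) (u : ℕ) :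
    x.list.length ≤ (x.step dec u).list.length := by
  rw [Stage.step]
  split_ifs <;> simp

theorem Stage.slot_step_le (dec : Stage → ℕ → Bool) (x : Stage) (u : ℕ) :
    (x.step dec u).slot ≤ x.slot + 1 := by
  rw [Stage.step]
  split_ifs <;> simp

theorem Stage.getD_step {dec : Stage → ℕ → Bool} {x : Stage} {u j : ℕ} (hj : j < x.list.length) :
    (x.step dec u).list.getD j 0 = x.list.getD j 0 := by
  rw [Stage.step]
  split_ifs
  · rfl
  · rw [List.getD_append _ _ _ _ hj]
  · rfl

theorem Stage.length_step_comb_le {k : ℕ} {p : ℕ → ℕ} {x : Stage} (h : x.list.length ≤ k) (u : ℕ) :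
    (x.step (combGuide k p) u).list.length ≤ k := by
  rw [Stage.step]
  split_ifs with h1 h2
  · exact h
  · simp only [combGuide, decide_eq_true_eq] at h2
    simp
    omega
  · exact h

theorem wp_explore {w : ℕ} {G : Data} {s : State} {p : ℕ → ℕ} {v : ℕ} (hG : G.Valid)
    (hb : Bounded w s) (hw : G.Small w) (hM : Mem G s) (hp : s.arr aComb = p) (hv : s.reg rV = v)
    (hvn : v < G.n) :
    WP w explore s fun t s' => t ≤ G.k * ((G.d + 1) * (14 * G.k + 100) + 60) + 40 ∧
      (G.run (combGuide G.k p) v G.k).Rep s' := by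
  have hn := hw.n_lt
  have hk := hG.k_pos
  have hslot := hw.slot_lt
  have w0 : 0 < cap w := by omega
  have w1 : 1 < cap w := by omega
  have hvw : v < cap w := by omega
  simp only [explore, wp_seq, wp_store, wp_set]
  simp only [Expr.eval_const, Expr.eval_reg, hv]
  refine ⟨by simp [w0], by simp [hv, hvw], by simp [w1], by simp [w0], by simp [w0], ?_⟩
  have hb₀ : Bounded w ((((s.setArr aSet 0 v).setReg rSize 1).setReg rSlot 0).setReg rJ 0) :=
    (((hb.setArr hvw).setReg w1).setReg w0).setReg w0
  have hM₀ : Mem G ((((s.setArr aSet 0 v).setReg rSize 1).setReg rSlot 0).setReg rJ 0) :=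
    (((hM.setArr (by omega)).setReg (by omega)).setReg (by omega)).setReg (by omega)
  refine (wp_loop G.k ((G.d + 1) * (14 * G.k + 100) + 40) (fun i s' => s'.reg rJ + i = G.k ∧
      (G.run (combGuide G.k p) v (s'.reg rJ)).slot ≤ s'.reg rJ * (G.d + 1) ∧
      (G.run (combGuide G.k p) v (s'.reg rJ)).Rep s')
    hb₀ ?_ ?_).conseq hb₀ ?_
  · refine ⟨by simp, by simp [Data.run_zero], ?_⟩
    simp only [State.setReg_reg, if_true, Data.run_zero]
    exact ⟨by simp, fun j hj => by simp at hj; simp [hj], by simp⟩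
  · rintro i s₁ ⟨h1, h2, h3⟩ hb₁ hF
    have hM₁ := hM₀.frame hF rfl
    have hp₁ : s₁.arr aComb = p := (hF.arr aComb rfl).trans hp
    refine ⟨by simp [hb₁.reg], fun hlt => ?_⟩
    obtain ⟨j, hj⟩ : ∃ j, s₁.reg rJ = j := ⟨_, rfl⟩
    rw [hj] at h1 h2 h3
    simp only [Test.holds_lt, Expr.eval_reg, hj, h3.size] at hlt
    obtain ⟨x, hx⟩ : ∃ x, G.run (combGuide G.k p) v j = x := ⟨_, rfl⟩
    rw [hx] at h2 h3 hlt
    have hlen : x.list.length ≤ G.k := hx ▸ Data.length_run_comb hk p v j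
    have hgood : x.Good G v := hx ▸ Data.run_good hG hvn _ j
    obtain ⟨y, hy⟩ : ∃ y, x.list.getD j 0 = y := ⟨_, rfl⟩
    have hym : y ∈ x.list := by
      rw [← hy, List.getD_eq_getElem _ _ hlt]
      exact List.getElem_mem hlt
    have hyn := hgood.lt y hym
    have hySet : s₁.arr aSet j = y := by rw [h3.set j hlt, hy]
    have w2 : j < cap w := hj ▸ hb₁.reg rJ
    have w3 : j + 1 < cap w := by have := h3.size ▸ hb₁.reg rSize; omega
    have w4 : y < cap w := by omega
    have w5 : y + 1 < cap w := by omega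
    have w6 : ∀ v, G.st v < cap w := fun v => hM₁.st ▸ hb₁.arr aStart v
    have hdeg := hG.deg_le y hyn
    have hmono := hG.st_mono y hyn
    have hjk : (j + 1) * (G.d + 1) ≤ G.k * (G.d + 1) := Nat.mul_le_mul_right _ (by omega)
    have hjk' : (j + 1) * (G.d + 1) = j * (G.d + 1) + (G.d + 1) := by ring
    rw [wp_seq, wp_set]
    refine ⟨by simp [hj, hySet, hM₁.st, w2, w4, w6], ?_⟩
    simp only [Expr.eval_get, Expr.eval_reg, hj, hySet, hM₁.st]
    have hb₂ : Bounded w (s₁.setReg rE (G.st y)) := hb₁.setReg (w6 y)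
    rw [wp_seq]
    refine (wp_loop (G.st (y + 1) - G.st y) (14 * G.k + 80)
      (fun i' s' => ∃ r, s'.reg rE = G.st y + r ∧ r + i' = G.st (y + 1) - G.st y ∧
        ∃ z : Stage, z = ((List.range' (G.st y) r).map G.nb).foldl
          (Stage.step (combGuide G.k p)) x ∧ z.slot ≤ j * (G.d + 1) + r ∧
          z.list.length ≤ G.k ∧ x.list.length ≤ z.list.length ∧ z.list.getD j 0 = y ∧ z.Rep s')
      hb₂ ?_ ?_).conseq hb₂ ?_
    · exact ⟨0, by simp, by simp, x, by simp, by omega, hlen, le_rfl, hy,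
        ⟨by simp [h3.size], fun j hj => by simp [h3.set j hj], by simp [h3.slot]⟩⟩
    · rintro i' s₂ ⟨r, g1, g2, z, g3, g4, g5, g6, g7, g8⟩ hb₃ hF₂
      have hM₂ : Mem G s₂ := (hM₁.setReg (by omega)).frame hF₂ rfl
      have c1 : s₂.reg rJ = j := (hF₂.reg rJ rfl).trans hj
      have c2 : s₂.arr aComb = p := (hF₂.arr aComb rfl).trans hp₁
      have c3 : s₂.arr aSet j = y := by rw [g8.set j (by omega), g7]
      refine ⟨by simp [c1, c3, hM₂.st, hb₃.reg, w1, w2, w4, w5, w6], fun hlt' => ?_⟩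
      simp only [Test.holds_lt, Expr.eval_reg, Expr.eval_get, Expr.eval_add, Expr.eval_const, c1,
        c3, hM₂.st, g1] at hlt'
      have := w6 (y + 1)
      refine (wp_visitEdge hb₃ hw hM₂ g8 c2 (by omega) g5 (by omega) (by omega)).mono ?_
      rintro t s₃ ⟨ht, k1, k2⟩
      refine ⟨ht, i' - 1, by omega, r + 1, by omega, by omega, _, ?_, ?_,
        Stage.length_step_comb_le g5 _, g6.trans (Stage.length_le_step _ _ _), ?_, k2⟩
      · rw [List.range'_1_concat, List.map_append, List.foldl_append, ← g3, g1]
        rfl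
      · have := Stage.slot_step_le (combGuide G.k p) z (G.nb (s₂.reg rE))
        omega
      · rw [Stage.getD_step (by omega), g7]
    · rintro t s₂ hb₃ hF₂ ⟨ht, hn₂, i', r, g1, g2, z, g3, g4, g5, g6, g7, g8⟩
      have hM₂ : Mem G s₂ := (hM₁.setReg (by omega)).frame hF₂ rfl
      have c1 : s₂.reg rJ = j := (hF₂.reg rJ rfl).trans hj
      have c3 : s₂.arr aSet j = y := by rw [g8.set j (by omega), g7]
      simp only [Test.holds_lt, Expr.eval_reg, Expr.eval_get, Expr.eval_add, Expr.eval_const, c1,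
        c3, hM₂.st, g1] at hn₂
      obtain rfl : r = G.st (y + 1) - G.st y := by omega
      have hz : G.run (combGuide G.k p) v (j + 1) = z := by
        rw [Data.run_succ, hx, Data.round, if_pos hlt, hy, g3, Data.nbrs]
      rw [wp_set]
      refine ⟨by simp [c1, w1, w2, w3], ?_, i - 1, by omega, by simp [c1]; omega, ?_, ?_⟩
      · have hd : G.st (y + 1) - G.st y ≤ G.d + 1 := by omega
        have := ht.trans (Nat.add_le_add_right (Nat.mul_le_mul_right _ hd) _)
        simp at this ⊢
        nlinarith
      · simp only [Expr.eval_add, Expr.eval_reg, Expr.eval_const, c1, State.setReg_reg, if_true, hz]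
        omega
      · simp only [Expr.eval_add, Expr.eval_reg, Expr.eval_const, c1, State.setReg_reg, if_true, hz]
        exact ⟨by simp [g8.size], fun j hj => by simp [g8.set j hj], by simp [g8.slot]⟩
  · rintro t s₁ hb₁ hF ⟨ht, hn₁, i, h1, h2, h3⟩
    simp only [Test.holds_lt, Expr.eval_reg, h3.size] at hn₁
    refine ⟨?_, ?_⟩
    · simp at ht ⊢
      nlinarith
    · rw [Data.run_stable (by omega) (by omega : s₁.reg rJ ≤ G.k)]
      exact h3

/-! ### Monochromatic weight under local changes -/

namespace Data

variable {G : Data}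

/-- `1` if `u` and `v` have the same color, else `0`. -/
def same (f : ℕ → ℕ) (v u : ℕ) : ℚ := if f u = f v then 1 else 0

theorem same_comm (f : ℕ → ℕ) (v u : ℕ) : same f v u = same f u v := by
  simp only [same, eq_comm]

theorem mono_eq (f : ℕ → ℕ) :
    G.mono f = ∑ v ∈ Finset.range G.n, ∑ u ∈ Finset.range G.n, G.W v u * same f v u := by
  simp only [mono, same, mul_ite, mul_one, mul_zero]

theorem mono_congr {f g : ℕ → ℕ} (h : ∀ u < G.n, f u = g u) : G.mono f = G.mono g := by
  refine Finset.sum_congr rfl fun v hv => Finset.sum_congr rfl fun u hu => ?_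
  rw [h v (Finset.mem_range.1 hv), h u (Finset.mem_range.1 hu)]

theorem sum_adj (hG : G.Valid) {v : ℕ} (hv : v < G.n) (g : ℕ → ℚ) :
    ∑ e ∈ G.adj v, G.wt e * g (G.nb e) = ∑ u ∈ Finset.range G.n, G.W v u * g u := by
  simp only [W, Finset.sum_mul]
  rw [Finset.sum_comm]
  refine Finset.sum_congr rfl fun e he => ?_
  have := hG.nb_lt v hv e he
  simp only [ite_mul, zero_mul, Finset.sum_ite_eq, Finset.mem_range, this, if_true]

theorem mem_nbrs_of_W_ne_zero {v u : ℕ} (h : G.W v u ≠ 0) : u ∈ G.nbrs v := by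
  obtain ⟨e, he, h⟩ := Finset.exists_ne_zero_of_sum_ne_zero h
  refine mem_nbrs.2 ⟨e, he, ?_⟩
  by_contra hne
  exact h (if_neg hne)

/-- In a sum over ordered pairs of a symmetric function that vanishes on the pairs outside `A`,
the pairs with exactly one member in `A` may be collected at that member. -/
theorem sum_pairs {R A : Finset ℕ} (hA : A ⊆ R) (F : ℕ → ℕ → ℚ)
    (hF : ∀ v ∈ R, ∀ u ∈ R, F v u = F u v) (h0 : ∀ v ∈ R, v ∉ A → ∀ u ∈ R, u ∉ A → F v u = 0) :
    ∑ v ∈ R, ∑ u ∈ R, F v u = ∑ v ∈ A, ∑ u ∈ R, if u ∈ A then F v u else 2 * F v u := by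
  have h1 : ∑ v ∈ R \ A, ∑ u ∈ R, F v u = ∑ v ∈ A, ∑ u ∈ R \ A, F v u := by
    rw [Finset.sum_comm, ← Finset.sum_sdiff hA, Finset.sum_eq_zero, zero_add]
    · refine Finset.sum_congr rfl fun v hv => Finset.sum_congr rfl fun u hu => ?_
      exact hF u (Finset.mem_sdiff.1 hu).1 v (hA hv)
    · intro v hv
      refine Finset.sum_eq_zero fun u hu => ?_
      have hv := Finset.mem_sdiff.1 hv
      have hu := Finset.mem_sdiff.1 hu
      exact h0 u hu.1 hu.2 v hv.1 hv.2
  rw [← Finset.sum_sdiff hA, h1, ← Finset.sum_add_distrib]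
  refine Finset.sum_congr rfl fun v hv => ?_
  rw [← Finset.sum_sdiff hA, ← Finset.sum_sdiff hA (f := fun u => if u ∈ A then _ else _)]
  rw [Finset.sum_congr rfl fun u hu => if_neg (Finset.mem_sdiff.1 hu).2,
    Finset.sum_congr rfl fun u hu => if_pos hu, ← Finset.mul_sum]
  ring

theorem mono_sub_mono (hG : G.Valid) {A : Finset ℕ} (hA : A ⊆ Finset.range G.n) {f : ℕ → ℕ}
    (hf : ∀ u, u ∉ A → f u = G.col u) :
    G.mono f - G.mono G.col = ∑ v ∈ A, ∑ e ∈ G.adj v, G.wt e *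
      if G.nb e ∈ A then same f v (G.nb e) - same G.col v (G.nb e)
      else 2 * (same f v (G.nb e) - same G.col v (G.nb e)) := by
  rw [mono_eq, mono_eq, ← Finset.sum_sub_distrib]
  simp only [← Finset.sum_sub_distrib, ← mul_sub]
  rw [sum_pairs hA]
  · refine Finset.sum_congr rfl fun v hv => ?_
    rw [sum_adj hG (Finset.mem_range.1 (hA hv)) fun u =>
      if u ∈ A then same f v u - same G.col v u else 2 * (same f v u - same G.col v u)]
    refine Finset.sum_congr rfl fun u _ => ?_
    split_ifs <;> ring
  · intro v hv u hu
    rw [hG.W_symm v (Finset.mem_range.1 hv) u (Finset.mem_range.1 hu), same_comm f, same_comm G.col]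
  · intro v _ hv u _ hu
    rw [same, same, hf v hv, hf u hu, sub_self, mul_zero]

/-- The gains of the color classes of `f` on the list add up to the change of the doubled
monochromatic weight. -/
theorem sum_gain (hG : G.Valid) {S : ℕ → ℕ} {m : ℕ} (hinj : Set.InjOn S (Set.Iio m))
    (hSn : ∀ j < m, S j < G.n) {f : ℕ → ℕ} (hf : ∀ u, (∀ j < m, S j ≠ u) → f u = G.col u)
    (hfc : ∀ j < m, f (S j) < G.c) :
    ∑ l ∈ Finset.range G.c,
      G.gain S m l (dig (codeOf m ((Finset.range m).filter fun j => f (S j) = l))) =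
      G.mono f - G.mono G.col := by
  set A := (Finset.range m).image S with hA
  have memA : ∀ u, u ∈ A ↔ firstPos S m u < m := by
    intro u
    rw [firstPos_lt_iff, hA]
    simp
  have hAn : A ⊆ Finset.range G.n := by
    intro u hu
    obtain ⟨j, hj, rfl⟩ := Finset.mem_image.1 hu
    exact Finset.mem_range.2 (hSn j (Finset.mem_range.1 hj))
  have hf' : ∀ u, u ∉ A → f u = G.col u := fun u hu => hf u fun j hj h =>
    hu (Finset.mem_image.2 ⟨j, Finset.mem_range.2 hj, h⟩)
  rw [mono_sub_mono hG hAn hf', hA, Finset.sum_image (by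
    intro a ha b hb
    exact hinj (by simpa using ha) (by simpa using hb))]
  simp only [gain]
  rw [Finset.sum_comm]
  refine Finset.sum_congr rfl fun j hj => ?_
  have hj := Finset.mem_range.1 hj
  rw [Finset.sum_eq_single (f (S j))]
  · rw [if_pos (by rw [dig_codeOf _ hj]; simp [hj])]
    refine Finset.sum_congr rfl fun e _ => ?_
    congr 1
    rw [← hA, coeff]
    by_cases h : firstPos S m (G.nb e) < m
    · rw [if_pos h, if_pos ((memA _).2 h), dig_codeOf _ h]
      simp only [Finset.mem_filter, Finset.mem_range, h, true_and, apply_firstPos h, same]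
      congr 1
      split_ifs <;> simp_all
    · have hu : G.nb e ∉ A := mt (memA _).1 h
      rw [if_neg h, if_neg hu, same, same, hf' _ hu]
  · intro l _ hl
    rw [if_neg]
    rw [dig_codeOf _ hj]
    simp [hj, hl.symm]
  · intro h
    exact absurd (Finset.mem_range.2 (hfc j hj)) h

theorem classFun_gain {S : ℕ → ℕ} {m : ℕ} : ClassFun m fun i t => G.gain S m i (dig t) := by
  intro i t t' h
  refine Finset.sum_congr rfl fun j hj => ?_
  refine if_congr (h j (Finset.mem_range.1 hj)) (Finset.sum_congr rfl fun e _ => ?_) rfl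
  congr 1
  simp only [coeff]
  refine ite_congr rfl (fun hp => ?_) fun _ => rfl
  congr 1
  exact if_congr (h _ hp) rfl rfl

/-- If no edge joins `A` to a recolored vertex outside `A`, then the changes on `A` and outside
`A` are independent. -/
theorem mono_split (hG : G.Valid) {A : Finset ℕ} {f : ℕ → ℕ}
    (hA : ∀ v ∈ A, ∀ u < G.n, G.W v u ≠ 0 → u ∉ A → f u = G.col u) :
    G.mono f - G.mono G.col =
      (G.mono (fun u => if u ∈ A then f u else G.col u) - G.mono G.col) +
      (G.mono (fun u => if u ∈ A then G.col u else f u) - G.mono G.col) := by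
  simp only [mono_eq, ← Finset.sum_sub_distrib, ← Finset.sum_add_distrib, ← mul_sub, ← mul_add]
  refine Finset.sum_congr rfl fun v hv => Finset.sum_congr rfl fun u hu => ?_
  have hv := Finset.mem_range.1 hv
  have hu := Finset.mem_range.1 hu
  by_cases hW : G.W v u = 0
  · simp [hW]
  · congr 1
    simp only [same]
    by_cases h1 : v ∈ A <;> by_cases h2 : u ∈ A
    · simp [h1, h2]
    · have := hA v h1 u hu hW h2
      simp [h1, h2, this]
    · have := hA u h2 v hv (by rwa [hG.W_symm u hu v hv]) h1
      simp [h1, h2, this]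
    · simp [h1, h2]

/-- The coloring `f` is an improvement with at most `k` recolored vertices. -/
structure Improves (G : Data) (f : ℕ → ℕ) : Prop where
  lt : ∀ u < G.n, f u < G.c
  card_le : ((Finset.range G.n).filter fun u => f u ≠ G.col u).card ≤ G.k
  mono_lt : G.mono f < G.mono G.col

/-- If there is an improvement, then there is one whose recolored vertices are found by a search
guided by a set of at most `k` vertices: a search inside the recolored vertices finds a part that
can be recolored independently of the rest, and one of the two recolorings improves. -/
theorem Improves.exists_local (hG : G.Valid) {f : ℕ → ℕ} (hf : G.Improves f) :
    ∃ (D : Finset ℕ) (v : ℕ), D.card ≤ G.k ∧ v < G.n ∧ v ∈ D ∧ ∃ g : ℕ → ℕ,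
      (∀ u, u ∉ (G.run (setGuide D) v G.k).list → g u = G.col u) ∧ (∀ u < G.n, g u < G.c) ∧
      G.mono g < G.mono G.col := by
  obtain ⟨N, hN⟩ : ∃ N, ((Finset.range G.n).filter fun u => f u ≠ G.col u).card = N := ⟨_, rfl⟩
  induction N using Nat.strong_induction_on generalizing f with
  | _ N ih =>
    set D := (Finset.range G.n).filter fun u => f u ≠ G.col u with hD
    obtain ⟨v, hv⟩ : D.Nonempty := by
      rw [Finset.nonempty_iff_ne_empty]
      intro he
      refine hf.mono_lt.ne (mono_congr fun u hu => ?_)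
      by_contra hne
      have : u ∈ D := Finset.mem_filter.2 ⟨Finset.mem_range.2 hu, hne⟩
      simp [he] at this
    have hvn : v < G.n := Finset.mem_range.1 (Finset.mem_filter.1 hv).1
    set x := G.run (setGuide D) v G.k with hx
    have hin : x.In D := run_in hv G.k
    have hlen : x.list.length ≤ G.k := hin.length_le.trans hf.card_le
    set A := x.list.toFinset with hA
    have hsplit := mono_split hG (A := A) (f := f) (by
      intro y hy u hu hW huA
      by_contra hne
      refine huA (List.mem_toFinset.2 ?_)
      obtain ⟨i, hi, hiy⟩ := List.mem_iff_getElem.1 (List.mem_toFinset.1 hy)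
      refine run_closed G.k i (hi.trans_le hlen) hi u ?_
        (Finset.mem_filter.2 ⟨Finset.mem_range.2 hu, hne⟩)
      rw [← hx, List.getD_eq_getElem _ _ hi, hiy]
      exact mem_nbrs_of_W_ne_zero hW)
    have hlt := hf.mono_lt
    by_cases h1 : G.mono (fun u => if u ∈ A then f u else G.col u) < G.mono G.col
    · refine ⟨D, v, hf.card_le, hvn, hv, _, fun u hu => if_neg fun h => hu (List.mem_toFinset.1 h),
        fun u hu => ?_, h1⟩
      split_ifs
      · exact hf.lt u hu
      · exact hG.col_lt u hu
    · have hvA : v ∈ A := by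
        obtain ⟨l, hl⟩ := (run_good hG hvn (setGuide D) G.k).root
        rw [hA, List.mem_toFinset, hx, hl]
        simp
      have hsub : ((Finset.range G.n).filter fun u =>
          (if u ∈ A then G.col u else f u) ≠ G.col u) ⊂ D := by
        rw [Finset.ssubset_iff_of_subset]
        · exact ⟨v, hv, by simp [hvA]⟩
        · intro u hu
          rw [Finset.mem_filter] at hu
          refine Finset.mem_filter.2 ⟨hu.1, ?_⟩
          have := hu.2
          split_ifs at this
          · exact absurd rfl this
          · exact this
      have hcard := Finset.card_lt_card hsub
      refine ih _ (hN ▸ hcard) (f := fun u => if u ∈ A then G.col u else f u)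
        ⟨fun u hu => ?_, (hcard.le).trans hf.card_le, by linarith⟩ rfl
      split_ifs
      · exact hG.col_lt u hu
      · exact hf.lt u hu

end Data

/-! ### Correctness and time of the whole search -/

/-- No recoloring of the vertices that the combination `p` selects from the root `v` improves. -/
def Stuck (G : Data) (v : ℕ) (p : ℕ → ℕ) : Prop :=
  ¬ ∃ g : ℕ → ℕ, (∀ u, u ∉ (G.run (combGuide G.k p) v G.k).list → g u = G.col u) ∧
    (∀ u < G.n, g u < G.c) ∧ G.mono g < G.mono G.col

/-- Whether the program leaves the input alone, except possibly the coloring. -/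
def Program.keepsGraph (p : Program) : Bool :=
  !(p.writesReg rN || p.writesReg rC || p.writesReg rK || p.writesArr aStart ||
    p.writesArr aNbr || p.writesWArr wWt)

theorem Mem.frame_of_col {G : Data} {p : Program} {s s' : State} (h : Mem G s)
    (hF : Frame p s s') (hp : p.keepsGraph = true) (hc : s'.arr aCol = G.col) : Mem G s' := by
  simp only [Program.keepsGraph, Bool.not_eq_true', Bool.or_eq_false_iff] at hp
  obtain ⟨⟨⟨⟨⟨p1, p2⟩, p3⟩, p4⟩, p5⟩, p7⟩ := hp
  exact ⟨(hF.reg _ p1).trans h.n, (hF.reg _ p2).trans h.c, (hF.reg _ p3).trans h.k,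
    (hF.arr _ p4).trans h.st, (hF.arr _ p5).trans h.nb, hc, (hF.warr _ p7).trans h.wt⟩

/-- The bound for the time of one combination, up to a constant factor. -/
def Data.unit (G : Data) : ℕ := G.k * (G.k * (G.d * (G.c * 3 ^ G.k)))

theorem Data.time_le {G : Data} (hk : 1 ≤ G.k) (hd : 1 ≤ G.d) (hc : 1 ≤ G.c) {m : ℕ}
    (hm : m ≤ G.k) :
    G.k * ((G.d + 1) * (14 * G.k + 100) + 60) + 40 +
      (m * 30 + 50 + G.c * (3 ^ m * (m * ((G.d + 1) * (14 * m + 100) + 120) + 120) + 40)) +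
      (G.c * (m * 100 + 100) + 20) + (G.k * 30 + 40) + 50 ≤ 2000 * G.unit := by
  have key : ∀ k d c P Q : ℕ, 1 ≤ k → 1 ≤ d → 1 ≤ c → 1 ≤ P → m ≤ k → Q ≤ P →
      k * ((d + 1) * (14 * k + 100) + 60) + 40 +
        (m * 30 + 50 + c * (Q * (m * ((d + 1) * (14 * m + 100) + 120) + 120) + 40)) +
        (c * (m * 100 + 100) + 20) + (k * 30 + 40) + 50 ≤ 2000 * (k * (k * (d * (c * P)))) := by
    intro k d c P Q hk hd hc hP hm hQ
    have b1 : ∀ m ≤ k, (d + 1) * (14 * m + 100) ≤ 228 * (d * k) := by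
      intro m hm
      calc (d + 1) * (14 * m + 100) ≤ (2 * d) * (114 * k) := Nat.mul_le_mul (by omega) (by omega)
        _ = 228 * (d * k) := by ring
    have b2 : 1 ≤ d * k := Nat.mul_pos hd hk
    have b3 : d * k ≤ k * (d * k) := Nat.le_mul_of_pos_left _ hk
    have b4 : 1 ≤ c * P := Nat.mul_pos hc hP
    have c1 : k * ((d + 1) * (14 * k + 100) + 60) ≤ 288 * (k * (d * k)) := by
      calc _ ≤ k * (288 * (d * k)) := Nat.mul_le_mul_left _ (by have := b1 k le_rfl; omega)
        _ = _ := by ring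
    have c2 : m * ((d + 1) * (14 * m + 100) + 120) + 120 ≤ 468 * (k * (d * k)) := by
      have : m * ((d + 1) * (14 * m + 100) + 120) ≤ k * (348 * (d * k)) :=
        Nat.mul_le_mul hm (by have := b1 m hm; omega)
      have e : k * (348 * (d * k)) = 348 * (k * (d * k)) := by ring
      omega
    have c3 : Q * (m * ((d + 1) * (14 * m + 100) + 120) + 120) ≤ P * (468 * (k * (d * k))) :=
      Nat.mul_le_mul hQ c2
    have c4 : k ≤ k * (d * k) := Nat.le_mul_of_pos_right _ b2
    have c5 : c ≤ c * P * (k * (d * k)) := by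
      calc c ≤ c * (P * (k * (d * k))) := Nat.le_mul_of_pos_right _ (Nat.mul_pos hP (by omega))
        _ = _ := by ring
    have c6 : k * (d * k) ≤ c * P * (k * (d * k)) := Nat.le_mul_of_pos_left _ b4
    have c7 : c * k ≤ c * P * (k * (d * k)) :=
      Nat.mul_le_mul (Nat.le_mul_of_pos_right _ hP) c4
    have c8 : c * m ≤ c * k := Nat.mul_le_mul_left _ hm
    have c9 := Nat.mul_le_mul_left c c3
    have e1 : c * (P * (468 * (k * (d * k)))) = 468 * (c * P * (k * (d * k))) := by ring
    have e2 : k * (k * (d * (c * P))) = c * P * (k * (d * k)) := by ring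
    have e3 : c * (m * 100 + 100) = 100 * (c * m) + 100 * c := by ring
    rw [e1] at c9
    rw [e2, e3, Nat.mul_add]
    have fin : ∀ U V X Y y z : ℕ, X ≤ 288 * Y → k ≤ Y → c ≤ U → Y ≤ U → z ≤ U → y ≤ z →
        V ≤ 468 * U → 1 ≤ k → 1 ≤ c → m ≤ k →
        X + 40 + (m * 30 + 50 + (V + c * 40)) + (100 * y + 100 * c + 20) + (k * 30 + 40) + 50
          ≤ 2000 * U := by
      intros
      omega
    refine (Nat.le_of_eq ?_).trans
      (fin _ _ _ _ _ _ c1 c4 c5 c6 c7 c8 c9 hk hc hm)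
    ring
  exact key G.k G.d G.c (3 ^ G.k) (3 ^ m) hk hd hc (Nat.one_le_pow _ _ (by norm_num)) hm
    (Nat.pow_le_pow_right (by norm_num) hm)

theorem wp_tryComb {w : ℕ} {G : Data} {s : State} {p : ℕ → ℕ} {v : ℕ} (hG : G.Valid)
    (hb : Bounded w s) (hw : G.Small w) (hM : Mem G s) (hv : s.reg rV = v) (hvn : v < G.n)
    (hfound : s.reg rFound = 0) (hp : s.arr aComb = p) (hcomb : IsComb (G.k - 1) p)
    (hpK : p (G.k - 1) = G.k * G.d + 1) (hp0 : p (G.k - 1 + 1) = 0) :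
    WP w tryComb s fun t s' => t ≤ 2000 * G.unit ∧
      ((s'.reg rFound = 1 ∧ G.Improves (s'.arr aCol)) ∨
        (s'.reg rFound = 0 ∧ s'.arr aCol = G.col ∧ Stuck G v p ∧
          IsComb (G.k - 1) (s'.arr aComb) ∧ s'.arr aComb (G.k - 1 + 1) = 0 ∧
          G.k * G.d + 1 ≤ s'.arr aComb (G.k - 1) ∧
          rank (G.k - 1) (s'.arr aComb) = rank (G.k - 1) p + 1)) := by
  have hn := hw.n_lt
  have hcode := hw.code_lt
  have hslot := hw.slot_lt
  have hk := hG.k_pos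
  have hd := hG.d_pos
  have hc : 0 < G.c := (Nat.zero_le _).trans_lt (hG.col_lt v hvn)
  have hcw : G.c < cap w := hM.c ▸ hb.reg rC
  have hkw : G.k < cap w := hM.k ▸ hb.reg rK
  have w1 : 1 < cap w := by omega
  rw [tryComb, wp_seq]
  refine (wp_explore hG hb hw hM hp hv hvn).conseq hb ?_
  rintro t₁ s₁ hb₁ hF₁ ⟨ht₁, hx⟩
  have hM₁ := hM.frame hF₁ rfl
  obtain ⟨x, hxe⟩ : ∃ x, G.run (combGuide G.k p) v G.k = x := ⟨_, rfl⟩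
  rw [hxe] at hx
  have hgood : x.Good G v := hxe ▸ Data.run_good hG hvn _ _
  have hmk : x.list.length ≤ G.k := hxe ▸ Data.length_run_comb hk p v _
  obtain ⟨m, hm⟩ : ∃ m, x.list.length = m := ⟨_, rfl⟩
  obtain ⟨S, hS⟩ : ∃ S, s₁.arr aSet = S := ⟨_, rfl⟩
  have hmem : ∀ j, (hj : j < m) → S j = x.list[j]'(by omega) := by
    intro j hj
    rw [← hS, hx.set j (by omega), List.getD_eq_getElem]
  have hSn : ∀ j < m, S j < G.n := by
    intro j hj
    rw [hmem j hj]
    exact hgood.lt _ (List.getElem_mem _)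
  have hinj : Set.InjOn S (Set.Iio m) := by
    intro a ha b hb' hab
    rw [hmem a ha, hmem b hb'] at hab
    exact hgood.nodup.getElem_inj_iff.1 hab
  have hmemS : ∀ u, u ∉ x.list ↔ ∀ j < m, S j ≠ u := by
    intro u
    constructor
    · rintro hu j hj rfl
      rw [hmem j hj] at hu
      exact hu (List.getElem_mem _)
    · intro h hu
      obtain ⟨j, hj, rfl⟩ := List.mem_iff_getElem.1 hu
      exact h j (by omega) (hmem j (by omega))
  rw [hm] at hmk
  have p3 : 3 ^ m ≤ 3 ^ G.k := Nat.pow_le_pow_right (by norm_num) hmk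
  have p4 : (G.c + 1) * 3 ^ m ≤ (G.c + 1) * 3 ^ G.k := Nat.mul_le_mul_left _ p3
  have p5 : (G.c + 1) * 3 ^ m = G.c * 3 ^ m + 3 ^ m := by ring
  have hfullX : (encode m fun _ => 1) = codeOf m (Finset.range m) :=
    encode_congr fun j hj => by simp [hj]
  have hfb := codeOf_lt m (Finset.range m)
  rw [wp_seq]
  refine (wp_fillTable hG hb₁ hw hM₁ (hx.size.trans hm) hmk hS hSn).conseq hb₁ ?_
  rintro t₂ s₂ hb₂ hF₂ ⟨ht₂, hB, hfull, hT0, hR⟩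
  have hM₂ := hM₁.frame hF₂ rfl
  have e1 : s₂.reg rSize = m := (hF₂.reg rSize rfl).trans (hx.size.trans hm)
  have e2 : s₂.arr aSet = S := (hF₂.arr aSet rfl).trans hS
  have e3 : s₂.arr aComb = p := ((hF₂.arr aComb rfl).trans (hF₁.arr aComb rfl)).trans hp
  have e4 : s₂.reg rFound = 0 := ((hF₂.reg rFound rfl).trans (hF₁.reg rFound rfl)).trans hfound
  have htime := Data.time_le hk hd hc hmk
  have q1 : G.c * 3 ^ m < cap w := by omega
  have q2 : G.c * 3 ^ m + codeOf m (Finset.range m) < cap w := by omega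
  have q3 : 3 ^ m < cap w := by omega
  have q4 : codeOf m (Finset.range m) < cap w := by omega
  rw [wp_ite]
  refine ⟨by simp [hM₂.c, hB, hfull, hfullX, q1, q2, q3, q4, hcw], fun hneg => ?_, fun hneg => ?_⟩
  · simp only [Test.holds_wlt, WExpr.eval_get, WExpr.eval_zero, Expr.eval_add, Expr.eval_mul,
      Expr.eval_reg, hM₂.c, hB, hfull] at hneg
    rw [wp_seq, wp_set]
    refine ⟨by simp [w1], ?_⟩
    simp only [Expr.eval_const]
    have hb₃ : Bounded w (s₂.setReg rFound 1) := hb₂.setReg w1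
    refine (wp_recolor (S := S) (m := m) (c := G.c) (T := s₂.warr wTab) (ch := s₂.arr aChoice)
      (col := G.col) hb₃ (by omega) hc (by simp [e1]) (by simp [e2]) hinj (by simp [hB])
      (by simp [hfull]) (by simp [hM₂.c]) (by simp [hM₂.col]) (by simp)
      Data.classFun_gain hR hT0).conseq hb₃ ?_
    rintro t₃ s₃ hb₄ hF₃ ⟨ht₃, h1, h2, h3⟩
    refine ⟨by simp; omega, Or.inl ⟨hF₃.reg rFound rfl, ?_⟩⟩
    rw [Data.sum_gain hG hinj hSn h1 h2] at h3
    refine ⟨fun u hu => ?_, ?_, by linarith⟩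
    · by_cases hul : ∃ j < m, S j = u
      · obtain ⟨j, hj, rfl⟩ := hul
        exact h2 j hj
      · rw [h1 u fun j hj h => hul ⟨j, hj, h⟩]
        exact hG.col_lt u hu
    · refine le_trans ?_ hmk
      calc _ ≤ ((Finset.range m).image S).card := Finset.card_le_card fun u hu => by
              by_contra hul
              refine (Finset.mem_filter.1 hu).2 (h1 u fun j hj h => hul ?_)
              exact Finset.mem_image.2 ⟨j, Finset.mem_range.2 hj, h⟩
        _ ≤ (Finset.range m).card := Finset.card_image_le
        _ = m := Finset.card_range m
  · simp only [Test.holds_wlt, WExpr.eval_get, WExpr.eval_zero, Expr.eval_add, Expr.eval_mul,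
      Expr.eval_reg, hM₂.c, hB, hfull] at hneg
    have hkd : G.k * (G.d + 1) = G.k * G.d + G.k := by ring
    refine (wp_nextComb hb₂ e3 hcomb hp0 (by omega) (by omega)).conseq hb₂ ?_
    rintro t₃ s₃ hb₃ hF₃ ⟨ht₃, h1, h2, h3, h4⟩
    refine ⟨by simp; omega, Or.inr ⟨(hF₃.reg rFound rfl).trans e4,
      (hF₃.arr aCol rfl).trans hM₂.col, ?_, h1, h2, hpK ▸ h3, h4⟩⟩
    rintro ⟨g, hg1, hg2, hg3⟩
    rw [hxe] at hg1
    have hle := table_le Data.classFun_gain hR hT0 (fun j => g (S j)) le_rfl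
      (X := Finset.range m) fun j hj => hg2 _ (hSn j (Finset.mem_range.1 hj))
    rw [Data.sum_gain hG hinj hSn (fun u hu => hg1 u ((hmemS u).2 hu))
      fun j hj => hg2 _ (hSn j hj), ← hfullX] at hle
    linarith

theorem wp_search {w : ℕ} {G : Data} {s : State} (hG : G.Valid) (hb : Bounded w s)
    (hw : G.Small w) (hM : Mem G s) (hfound : s.reg rFound = 0) (hrM : s.reg rM = G.k * G.d + 1) :
    WP w search s fun t s' =>
      t ≤ G.n * ((G.k * G.d + 1).choose (G.k - 1) * (2000 * G.unit + 20) + G.k * 30 + 100) + 20 ∧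
      ((s'.reg rFound = 1 ∧ G.Improves (s'.arr aCol)) ∨
        (s'.reg rFound = 0 ∧ s'.arr aCol = G.col ∧ ∀ v < G.n, ∀ q, IsComb (G.k - 1) q →
          q (G.k - 1) = G.k * G.d + 1 → Stuck G v q)) := by
  have hn := hw.n_lt
  have hk := hG.k_pos
  have hd := hG.d_pos
  have w0 : 0 < cap w := by omega
  have w1 : 1 < cap w := by omega
  have hkw : G.k < cap w := hM.k ▸ hb.reg rK
  have hKk : G.k - 1 + 1 = G.k := by omega
  have hKM : G.k - 1 ≤ G.k * G.d + 1 := by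
    have := Nat.le_mul_of_pos_right G.k hd
    omega
  simp only [search, wp_seq, wp_set]
  simp only [Expr.eval_const]
  refine ⟨by simp [w0], ?_⟩
  have hb₀ : Bounded w (s.setReg rV 0) := hb.setReg w0
  have hM₀ : Mem G (s.setReg rV 0) := hM.setReg (by omega)
  -- as long as nothing is found, the roots before the current one are settled
  refine (wp_loop G.n ((G.k * G.d + 1).choose (G.k - 1) * (2000 * G.unit + 20) + G.k * 30 + 80)
    (fun i s' => s'.reg rV + i = G.n ∧ ((s'.reg rFound = 1 ∧ G.Improves (s'.arr aCol)) ∨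
        (s'.reg rFound = 0 ∧ s'.arr aCol = G.col ∧ ∀ v < s'.reg rV, ∀ q, IsComb (G.k - 1) q →
          q (G.k - 1) = G.k * G.d + 1 → Stuck G v q)))
    hb₀ ?_ ?_).conseq hb₀ ?_
  · exact ⟨by simp, Or.inr ⟨by simp [hfound], hM₀.col, by simp⟩⟩
  · rintro i s₁ ⟨h1, h2⟩ hb₁ hF
    have eN : s₁.reg rN = G.n := (hF.reg rN rfl).trans hM₀.n
    refine ⟨by simp [hb₁.reg, w0], fun hlt => ?_⟩
    obtain ⟨v, hv⟩ : ∃ v, s₁.reg rV = v := ⟨_, rfl⟩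
    simp only [Test.holds_and, Test.holds_lt, Test.holds_eq, Expr.eval_reg, Expr.eval_const, hv,
      eN] at hlt
    rcases h2 with h2 | ⟨-, h2, h3⟩
    · omega
    rw [hv] at h1 h3
    have hM₁ := hM₀.frame_of_col hF rfl h2
    have hrM₁ : s₁.reg rM = G.k * G.d + 1 := (hF.reg rM rfl).trans hrM
    rw [wp_seq]
    refine (wp_initComb (K := G.k - 1) hb₁ (hM₁.k.trans hKk.symm) hrM₁ hKM (by omega)).conseq hb₁ ?_
    rintro t₁ s₂ hb₂ hF₂ ⟨ht₁, g1, g2, g3, g4⟩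
    have hM₂ := hM₁.frame hF₂ rfl
    have hv₂ : s₂.reg rV = v := (hF₂.reg rV rfl).trans hv
    have hf₂ : s₂.reg rFound = 0 := (hF₂.reg rFound rfl).trans hlt.2
    have hrM₂ : s₂.reg rM = G.k * G.d + 1 := (hF₂.reg rM rfl).trans hrM₁
    rw [wp_seq]
    -- Combinations of lower rank are settled; the sentinel takes part in the rank, as the last
    -- member. The ranks with sentinel `M = k * d + 1` go from `M.choose k` to
    -- `(M + 1).choose k - 1`, which are `M.choose (k - 1)` numbers.
    refine (wp_loop ((G.k * G.d + 1).choose (G.k - 1)) (2000 * G.unit)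
      (fun i' s' => (s'.reg rFound = 1 ∧ G.Improves (s'.arr aCol)) ∨
        (s'.reg rFound = 0 ∧ s'.arr aCol = G.col ∧ IsComb (G.k - 1) (s'.arr aComb) ∧
          s'.arr aComb (G.k - 1 + 1) = 0 ∧ G.k * G.d + 1 ≤ s'.arr aComb (G.k - 1) ∧
          rank (G.k - 1) (s'.arr aComb) + i' = (G.k * G.d + 1 + 1).choose (G.k - 1 + 1) ∧
          ∀ q, IsComb (G.k - 1) q → q (G.k - 1) = G.k * G.d + 1 →
            rank (G.k - 1) q < rank (G.k - 1) (s'.arr aComb) → Stuck G v q))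
      hb₂ ?_ ?_).conseq hb₂ ?_
    · refine Or.inr ⟨hf₂, hM₂.col, g1, g3, g2.ge, ?_, fun q _ hq hlt' => ?_⟩
      · rw [g4, Nat.choose_succ_succ' (G.k * G.d + 1) (G.k - 1), add_comm]
      · have := choose_le_rank (G.k - 1) q
        rw [hq] at this
        omega
    · rintro i' s₃ hI hb₃ hF₃
      have eK : s₃.reg rK = G.k := (hF₃.reg rK rfl).trans hM₂.k
      have w2 : G.k - 1 < cap w := by omega
      refine ⟨by simp [hb₃.reg, hb₃.arr, eK, w0, w1, w2, hkw], fun hlt' => ?_⟩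
      simp only [Test.holds_and, Test.holds_eq, Expr.eval_get, Expr.eval_sub, Expr.eval_reg,
        Expr.eval_const, eK, (hF₃.reg rM rfl).trans hrM₂] at hlt'
      rcases hI with hI | ⟨-, c1, c2, c3, c4, c5, c6⟩
      · omega
      have hM₃ := hM₂.frame_of_col hF₃ rfl c1
      obtain ⟨p, hp⟩ : ∃ p, s₃.arr aComb = p := ⟨_, rfl⟩
      rw [hp] at c2 c3 c4 c5 c6 hlt'
      have hrank := rank_lt c2
      rw [hlt'.1] at hrank
      refine (wp_tryComb hG hb₃ hw hM₃ ((hF₃.reg rV rfl).trans hv₂) hlt.1 hlt'.2 hp c2 hlt'.1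
        c3).mono ?_
      rintro t s₄ ⟨ht, h⟩
      refine ⟨ht, i' - 1, by omega, h.imp_right ?_⟩
      rintro ⟨f1, f2, f3, f4, f5, f6, f7⟩
      refine ⟨f1, f2, f4, f5, f6, by omega, fun q hq hqM hqr => ?_⟩
      rcases (show rank (G.k - 1) q < rank (G.k - 1) p ∨ rank (G.k - 1) q = rank (G.k - 1) p by
        omega) with hr | hr
      · exact c6 q hq hqM hr
      · have := rank_injective hq c2 hr
        rw [Stuck, combGuide_congr this]
        exact f3
    · rintro t₂ s₃ hb₃ hF₃ ⟨ht₂, hn₃, i', hI⟩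
      have eV : s₃.reg rV = v := (hF₃.reg rV rfl).trans hv₂
      have eK : s₃.reg rK = G.k := (hF₃.reg rK rfl).trans hM₂.k
      simp only [Test.holds_and, Test.holds_eq, Expr.eval_get, Expr.eval_sub, Expr.eval_reg,
        Expr.eval_const, eK, (hF₃.reg rM rfl).trans hrM₂] at hn₃
      have w2 : v < cap w := by omega
      have w3 : v + 1 < cap w := by omega
      rw [wp_set]
      refine ⟨by simp [eV, w1, w2, w3], ?_, i - 1, by omega, by simp [eV]; omega, ?_⟩
      · simp at ht₂ ⊢
        have : (G.k * G.d + 1).choose (G.k - 1) * (11 + 2000 * G.unit) ≤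
            (G.k * G.d + 1).choose (G.k - 1) * (2000 * G.unit + 20) :=
          Nat.mul_le_mul_left _ (by omega)
        omega
      · refine hI.imp_right ?_
        rintro ⟨c0, c1, c2, c3, c4, c5, c6⟩
        refine ⟨c0, c1, ?_⟩
        simp only [Expr.eval_add, Expr.eval_reg, Expr.eval_const, eV, State.setReg_reg, if_true]
        intro v' hv' q hq hqM
        rcases Nat.lt_succ_iff_lt_or_eq.1 hv' with hv' | rfl
        · exact h3 v' hv' q hq hqM
        · refine c6 q hq hqM ?_
          have r1 := rank_lt hq
          have r2 := choose_le_rank (G.k - 1) (s₃.arr aComb)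
          have r3 : (G.k * G.d + 1 + 1).choose (G.k - 1 + 1) ≤
              (s₃.arr aComb (G.k - 1)).choose (G.k - 1 + 1) :=
            Nat.choose_le_choose _ (by omega)
          rw [hqM] at r1
          omega
  · rintro t s₁ hb₁ hF ⟨ht, hn₁, i, h1, h2⟩
    have eN : s₁.reg rN = G.n := (hF.reg rN rfl).trans hM₀.n
    simp only [Test.holds_and, Test.holds_lt, Test.holds_eq, Expr.eval_reg, Expr.eval_const,
      eN] at hn₁
    refine ⟨?_, h2.imp_right fun ⟨c0, c1, c2⟩ => ⟨c0, c1, fun v hv => c2 v (by omega)⟩⟩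
    simp at ht ⊢
    generalize (G.k * G.d + 1).choose (G.k - 1) * (2000 * G.unit + 20) = A at *
    nlinarith

theorem wp_degBound {w : ℕ} {G : Data} {s : State} (hb : Bounded w s) (hM : Mem G s)
    (hw : G.n + 4 < cap w) :
    WP w degBound s fun t s' => t ≤ G.n * 60 + 20 ∧ 1 ≤ s'.reg rD ∧
      (∀ v < G.n, G.st (v + 1) ≤ G.st v + (s'.reg rD + 1)) ∧
      (s'.reg rD = 1 ∨ ∃ v < G.n, G.st (v + 1) = G.st v + (s'.reg rD + 1)) := by
  have w0 : 0 < cap w := by omega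
  have w1 : 1 < cap w := by omega
  simp only [degBound, wp_seq, wp_set]
  simp only [Expr.eval_const]
  refine ⟨by simp [w1], by simp [w0], ?_⟩
  have hb₀ : Bounded w ((s.setReg rD 1).setReg rV 0) := (hb.setReg w1).setReg w0
  have hM₀ : Mem G ((s.setReg rD 1).setReg rV 0) := (hM.setReg (by omega)).setReg (by omega)
  refine (wp_loop G.n 50 (fun i s' => s'.reg rV + i = G.n ∧ 1 ≤ s'.reg rD ∧
      s'.reg rD + 1 < cap w ∧
      (∀ v < s'.reg rV, G.st (v + 1) ≤ G.st v + (s'.reg rD + 1)) ∧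
      (s'.reg rD = 1 ∨ ∃ v < G.n, G.st (v + 1) = G.st v + (s'.reg rD + 1)))
    hb₀ ?_ ?_).conseq hb₀ ?_
  · simp
    omega
  · rintro i s₁ ⟨h1, h2, h3, h4, h5⟩ hb₁ hF
    have hM₁ := hM₀.frame hF rfl
    refine ⟨by simp [hb₁.reg], fun hlt => ?_⟩
    obtain ⟨v, hv⟩ : ∃ v, s₁.reg rV = v := ⟨_, rfl⟩
    obtain ⟨d, hd⟩ : ∃ d, s₁.reg rD = d := ⟨_, rfl⟩
    simp only [Test.holds_lt, Expr.eval_reg, hv, hM₁.n] at hlt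
    rw [hv] at h1 h4
    rw [hd] at h2 h3 h4 h5
    have w2 : v < cap w := by omega
    have w3 : v + 1 < cap w := by omega
    have w4 : d < cap w := by omega
    have w5 : ∀ v, G.st v < cap w := fun v => hM₁.st ▸ hb₁.arr aStart v
    have w6 : G.st (v + 1) - G.st v < cap w := by have := w5 (v + 1); omega
    have w7 : G.st (v + 1) - G.st v - 1 < cap w := by omega
    simp only [wp_seq, wp_ite, wp_set, wp_skip]
    refine ⟨by simp [hd, hv, hM₁.st, w1, w2, w3, w4, w5, w6, h3], fun hc => ?_, fun hc => ?_⟩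
    · simp [hd, hv, hM₁.st] at hc
      refine ⟨by simp [hv, hM₁.st, w1, w2, w3, w5, w6, w7], by simp [hv, w1, w2, w3], by simp,
        i - 1, by omega, by simp [hv]; omega, by simp [hv, hM₁.st]; omega,
        by simp [hv, hM₁.st]; omega, ?_, Or.inr ⟨v, hlt, by simp [hv, hM₁.st]; omega⟩⟩
      simp only [Expr.eval_add, Expr.eval_sub, Expr.eval_reg, Expr.eval_get, Expr.eval_const,
        State.setReg_reg, hv, hM₁.st]
      norm_num [hv]
      intro v' hv'
      rcases (show v' < v ∨ v' = v by omega) with hv' | rfl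
      · have := h4 v' hv'
        omega
      · omega
    · simp [hd, hv, hM₁.st] at hc
      refine ⟨by simp [hv, w1, w2, w3], by simp, i - 1, by omega, by simp [hv]; omega,
        by simp [hd, h2], by simp [hd, h3], ?_, by simpa [hd] using h5⟩
      simp only [Expr.eval_add, Expr.eval_reg, Expr.eval_const, State.setReg_reg, hv]
      norm_num [hd]
      intro v' hv'
      rcases (show v' < v ∨ v' = v by omega) with hv' | rfl
      · exact h4 v' hv'
      · omega
  · rintro t s₁ hb₁ hF ⟨ht, hn, i, h1, h2, -, h4, h5⟩
    have hM₁ := hM₀.frame hF rfl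
    simp only [Test.holds_lt, Expr.eval_reg, hM₁.n] at hn
    exact ⟨by simp at ht ⊢; omega, h2, fun v hv => h4 v (by omega), h5⟩

theorem wp_output {w : ℕ} {s : State} {n : ℕ} (hb : Bounded w s) (hn : s.reg rN = n)
    (hw : 4 < cap w) :
    WP w output s fun t s' => t ≤ n * 30 + 20 ∧ s'.reg rN = s.reg rFound ∧
      ∀ v < n, s'.arr aStart v = s.arr aCol v := by
  have w0 : 0 < cap w := by omega
  have w1 : 1 < cap w := by omega
  have hnw : n < cap w := hn ▸ hb.reg rN
  simp only [output, wp_seq, wp_set]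
  simp only [Expr.eval_const]
  refine ⟨by simp [w0], ?_⟩
  have hb₀ : Bounded w (s.setReg rV 0) := hb.setReg w0
  refine (wp_loop n 20 (fun i s' => s'.reg rV + i = n ∧
      ∀ v < s'.reg rV, s'.arr aStart v = s.arr aCol v) hb₀ (by simp) ?_).conseq hb₀ ?_
  · rintro i s₁ ⟨h1, h2⟩ hb₁ hF
    have e1 : s₁.reg rN = n := (hF.reg rN rfl).trans hn
    have e2 : s₁.arr aCol = s.arr aCol := hF.arr aCol rfl
    refine ⟨by simp [hb₁.reg], fun hlt => ?_⟩
    obtain ⟨v, hv⟩ : ∃ v, s₁.reg rV = v := ⟨_, rfl⟩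
    simp only [Test.holds_lt, Expr.eval_reg, hv, e1] at hlt
    rw [hv] at h1 h2
    have w2 : v < cap w := by omega
    have w3 : v + 1 < cap w := by omega
    simp only [wp_seq, wp_store, wp_set]
    refine ⟨by simp [hv, w2], by simp [hv, w2, hb₁.arr], by simp [hv, w1, w2, w3], by simp,
      i - 1, by omega, by simp [hv]; omega, ?_⟩
    simp only [Expr.eval_add, Expr.eval_reg, Expr.eval_get, Expr.eval_const, State.setArr_reg,
      State.setReg_reg, if_true, State.setReg_arr, State.setArr_arr, hv, e2,
      Function.update_apply]
    intro v' hv'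
    split_ifs with hc
    · rw [hc]
    · exact h2 v' (by omega)
  · rintro t s₁ hb₁ hF ⟨ht, hn₁, i, h1, h2⟩
    have e1 : s₁.reg rN = n := (hF.reg rN rfl).trans hn
    simp only [Test.holds_lt, Expr.eval_reg, e1] at hn₁
    have e2 : s₁.reg rFound = s.reg rFound := hF.reg rFound rfl
    refine ⟨by simp [hb₁.reg], by simp at ht ⊢; omega, by simp [e2], fun v hv => ?_⟩
    exact h2 v (by omega)

/-! ### Instances and their encodings -/

section Encoding

variable {I : Instance} {s : State}

/-- The arrays that encode the instance in the memory `s`, with `d` as degree bound. -/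
def Instance.data (I : Instance) (s : State) (d : ℕ) : Data :=
  ⟨I.n, I.c, I.k, d, s.arr aStart, s.arr aNbr, s.arr aCol, s.warr wWt⟩

namespace Encodes

theorem mem (h : Encodes I s) (d : ℕ) : Mem (I.data s d) s :=
  ⟨h.reg_n, h.reg_c, h.reg_k, rfl, rfl, rfl, rfl⟩

/-- The list of `v` has no entries but the neighbors of `v`, and no repetitions: the neighbors
inject into the positions, and there are as many of the former as of the latter. -/
theorem exists_nbr (h : Encodes I s) (v : Fin I.n) {j : ℕ}
    (hj : j ∈ Finset.Ico (s.arr 0 v) (s.arr 0 (v + 1))) :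
    ∃ (u : Fin I.n) (ha : I.G.Adj v u), s.arr 1 j = u ∧
      s.warr 0 j = I.ω ⟨s(v, u), I.G.mem_edgeSet.2 ha⟩ ∧
      ∀ j' ∈ Finset.Ico (s.arr 0 v) (s.arr 0 (v + 1)), s.arr 1 j' = u → j' = j := by
  classical
  choose pos hpos using h.neighbor v
  have hbij : ∀ j ∈ Finset.Ico (s.arr 0 v) (s.arr 0 (v + 1)), ∃ u, ∃ ha : I.G.Adj v u,
      pos u ha = j := by
    have hsurj := Finset.surj_on_of_inj_on_of_card_le
      (s := I.G.neighborFinset v) (t := Finset.Ico (s.arr 0 v) (s.arr 0 (v + 1)))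
      (fun u hu => pos u ((I.G.mem_neighborFinset v u).1 hu))
      (fun u hu => Finset.mem_Ico.2
        ⟨(hpos u ((I.G.mem_neighborFinset v u).1 hu)).1,
          (hpos u ((I.G.mem_neighborFinset v u).1 hu)).2.1⟩)
      (fun u u' hu hu' he => Fin.ext (by
        have h1 := (hpos u ((I.G.mem_neighborFinset v u).1 hu)).2.2.1
        have h2 := (hpos u' ((I.G.mem_neighborFinset v u').1 hu')).2.2.1
        rw [he, h2] at h1
        exact h1.symm))
      (by
        rw [Nat.card_Ico, h.start_succ, Instance.degree, SimpleGraph.degree]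
        simp)
    intro j hj
    obtain ⟨u, hu, e⟩ := hsurj j hj
    exact ⟨u, (I.G.mem_neighborFinset v u).1 hu, e.symm⟩
  obtain ⟨u, ha, rfl⟩ := hbij j hj
  refine ⟨u, ha, (hpos u ha).2.2.1, (hpos u ha).2.2.2, fun j' hj' he => ?_⟩
  obtain ⟨u', ha', rfl⟩ := hbij j' hj'
  obtain rfl : u' = u := Fin.ext (by rw [← he, (hpos u' ha').2.2.1])
  rfl

open Classical in
theorem W_eq (h : Encodes I s) (d : ℕ) (v u : Fin I.n) :
    (I.data s d).W v u =
      if ha : I.G.Adj v u then I.ω ⟨s(v, u), I.G.mem_edgeSet.2 ha⟩ else 0 := by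
  rw [Data.W]
  split_ifs with ha
  · obtain ⟨j, h1, h2, h3, h4⟩ := h.neighbor v u ha
    have hj : j ∈ (I.data s d).adj v := Finset.mem_Ico.2 ⟨h1, h2⟩
    rw [Finset.sum_eq_single_of_mem j hj]
    · exact (if_pos h3).trans h4
    · intro j' hj' hne
      refine if_neg fun he => hne ?_
      obtain ⟨u', -, e1, -, e2⟩ := h.exists_nbr v hj
      exact e2 j' hj' (he.trans (h3.symm.trans e1))
  · refine Finset.sum_eq_zero fun j hj => if_neg fun he => ha ?_
    obtain ⟨u', ha', e1, -⟩ := h.exists_nbr v hj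
    obtain rfl : u' = u := Fin.ext (e1.symm.trans he)
    exact ha'

theorem valid (h : Encodes I s) {d : ℕ} (hk : 1 ≤ I.k) (hd : 1 ≤ d)
    (hdeg : ∀ v < I.n, s.arr 0 (v + 1) ≤ s.arr 0 v + (d + 1)) : (I.data s d).Valid where
  st_mono v hv := by
    have := h.start_succ ⟨v, hv⟩
    exact Nat.le.intro this.symm
  deg_le := hdeg
  nb_lt v hv e he := by
    obtain ⟨u, -, e1, -⟩ := h.exists_nbr ⟨v, hv⟩ he
    exact (congrArg (· < I.n) e1).mpr u.2
  symm v hv e he := by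
    obtain ⟨u, ha, e1, -⟩ := h.exists_nbr ⟨v, hv⟩ he
    obtain ⟨j, h1, h2, h3, -⟩ := h.neighbor u ⟨v, hv⟩ ha.symm
    have e1' : (I.data s d).nb e = u := e1
    rw [e1']
    exact ⟨j, Finset.mem_Ico.2 ⟨h1, h2⟩, h3⟩
  W_symm u hu v hv := by
    classical
    refine (h.W_eq d ⟨u, hu⟩ ⟨v, hv⟩).trans (Eq.trans ?_ (h.W_eq d ⟨v, hv⟩ ⟨u, hu⟩).symm)
    by_cases ha : I.G.Adj ⟨u, hu⟩ ⟨v, hv⟩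
    · rw [dif_pos ha, dif_pos ha.symm]
      congr 2
      exact Sym2.eq_swap
    · rw [dif_neg ha, dif_neg fun h => ha h.symm]
  col_lt v hv := by
    have := h.color ⟨v, hv⟩
    exact (congrArg (· < I.c) this).mpr (I.χ ⟨v, hv⟩).2
  d_pos := hd
  k_pos := hk

/-- Each edge occurs twice in a sum over ordered pairs of vertices. -/
theorem two_mul_cutWeight (h : Encodes I s) (d : ℕ) (χ' : Fin I.n → Fin I.c) {f : ℕ → ℕ}
    (hf : ∀ v : Fin I.n, f v = χ' v) :
    2 * I.cutWeight χ' = (I.data s d).mono (fun _ => 0) - (I.data s d).mono f := by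
  classical
  have hpair : (I.data s d).mono (fun _ => 0) - (I.data s d).mono f =
      ∑ p : Fin I.n × Fin I.n, if χ' p.2 = χ' p.1 then 0 else (I.data s d).W p.1 p.2 := by
    rw [Data.mono, Data.mono, ← Finset.sum_sub_distrib, Fintype.sum_prod_type]
    refine (Finset.sum_range _).trans (Finset.sum_congr rfl fun v _ => ?_)
    rw [← Finset.sum_sub_distrib]
    refine (Finset.sum_range _).trans (Finset.sum_congr rfl fun u _ => ?_)
    have hfχ : f u = f v ↔ χ' u = χ' v := by
      rw [show f u = χ' u from hf u, show f v = χ' v from hf v, Fin.val_inj]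
    simp only [hfχ, if_true]
    split_ifs <;> simp
  set g : I.G.edgeSet → ℚ := fun e => if I.ProperlyColored χ' e then I.ω e else 0 with hg
  have hdart : ∑ p : Fin I.n × Fin I.n, (if χ' p.2 = χ' p.1 then 0 else (I.data s d).W p.1 p.2) =
      ∑ a : I.G.Dart, g ⟨a.edge, a.edge_mem⟩ := by
    refine (Fintype.sum_of_injective (fun a : I.G.Dart => a.toProd)
      SimpleGraph.Dart.toProd_injective _ _ ?_ ?_).symm
    · rintro ⟨v, u⟩ hp
      have : ¬ I.G.Adj v u := fun ha => hp ⟨⟨(v, u), ha⟩, rfl⟩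
      simp [h.W_eq, this]
    · rintro ⟨⟨v, u⟩, ha⟩
      have hpc : I.ProperlyColored χ' ⟨s(v, u), I.G.mem_edgeSet.2 ha⟩ ↔ ¬ χ' u = χ' v := by
        constructor
        · rintro ⟨x, y, hxy, hne⟩ he
          rcases Sym2.eq_iff.1 hxy with ⟨rfl, rfl⟩ | ⟨rfl, rfl⟩
          · exact hne he.symm
          · exact hne he
        · exact fun hne => ⟨v, u, rfl, fun he => hne he.symm⟩
      change (if I.ProperlyColored χ' ⟨s(v, u), I.G.mem_edgeSet.2 ha⟩ then
        I.ω ⟨s(v, u), I.G.mem_edgeSet.2 ha⟩ else 0) = _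
      have ha' : I.G.Adj v u := ha
      simp only [h.W_eq, dif_pos ha', hpc, ite_not]
  rw [hpair, hdart, Instance.cutWeight, Finset.sum_filter, Finset.mul_sum,
    ← Finset.sum_fiberwise Finset.univ (fun a : I.G.Dart => (⟨a.edge, a.edge_mem⟩ : I.G.edgeSet))]
  refine Finset.sum_congr rfl fun e _ => ?_
  rw [Finset.sum_congr rfl (g := fun _ => g e) fun a ha => by rw [(Finset.mem_filter.1 ha).2],
    Finset.sum_const]
  have hcard := I.G.dart_edge_fiber_card e.1 e.2
  simp only [Subtype.ext_iff]
  rw [hcard, nsmul_eq_mul]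
  rfl

theorem improves_iff (h : Encodes I s) (d : ℕ) {χ' : Fin I.n → Fin I.c} {f : ℕ → ℕ}
    (hf : ∀ v : Fin I.n, f v = χ' v) : (I.data s d).Improves f ↔ I.Improving χ' := by
  classical
  have h1 := h.two_mul_cutWeight d χ' hf
  have h2 := h.two_mul_cutWeight d I.χ (f := (I.data s d).col) h.color
  have hcard : ((Finset.range I.n).filter fun u => f u ≠ (I.data s d).col u).card =
      (I.flip I.χ χ').card := by
    rw [Instance.flip, Finset.card_filter, Finset.card_filter]
    refine (Finset.sum_range _).trans (Finset.sum_congr rfl fun v _ => ?_)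
    rw [hf, show (I.data s d).col v = I.χ v from h.color v]
    simp only [ne_eq, Fin.val_inj, eq_comm]
  constructor
  · rintro ⟨-, hk, hlt⟩
    exact ⟨hcard ▸ hk, by linarith⟩
  · rintro ⟨hk, hlt⟩
    refine ⟨fun u hu => ?_, hcard.le.trans hk, by linarith⟩
    rw [hf ⟨u, hu⟩]
    exact (χ' ⟨u, hu⟩).2

theorem not_improving_of_stuck (h : Encodes I s) {d : ℕ} (hG : (I.data s d).Valid)
    (hst : ∀ v < I.n, ∀ q, IsComb (I.k - 1) q → q (I.k - 1) = I.k * d + 1 →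
      Stuck (I.data s d) v q) (χ' : Fin I.n → Fin I.c) : ¬ I.Improving χ' := by
  intro hi
  have hf := (h.improves_iff d (f := fun u => if hu : u < I.n then χ' ⟨u, hu⟩ else 0)
    fun v => by simp).2 hi
  obtain ⟨D, v, hD, hv, hvD, g, h1, h2, h3⟩ := hf.exists_local hG
  obtain ⟨p, hp, hpM, hrun⟩ := Data.exists_comb hG hD hv hvD
  exact hst v hv p hp hpM ⟨g, fun u hu => h1 u (hrun ▸ hu), h2, h3⟩

theorem not_improving_of_k_eq_zero (hk : I.k = 0) (χ' : Fin I.n → Fin I.c) :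
    ¬ I.Improving χ' := by
  rintro ⟨h1, h2⟩
  rw [hk, Nat.le_zero, Finset.card_eq_zero] at h1
  have : I.χ = χ' := by
    funext v
    by_contra hne
    have : v ∈ I.flip I.χ χ' := Finset.mem_filter.2 ⟨Finset.mem_univ _, hne⟩
    simp [h1] at this
  exact h2.ne (by rw [this])

end Encodes

end Encoding

/-! ### Word length -/

section Encoding

variable {I : Instance} {s : State}

theorem Instance.degree_lt (I : Instance) (v : Fin I.n) : I.degree v < I.n := by
  classical
  have := I.G.degree_lt_card_verts v
  rw [Fintype.card_fin] at this
  rw [Instance.degree]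
  convert this

theorem Instance.degree_le (I : Instance) (v : Fin I.n) : I.degree v ≤ I.maxDegree := by
  classical
  exact I.G.degree_le_maxDegree v

namespace Encodes

theorem start_le (h : Encodes I s) {v : ℕ} (hv : v ≤ I.n) : s.arr 0 v ≤ v * I.n := by
  induction v with
  | zero => simp [h.start_zero]
  | succ v ih =>
    have h1 : s.arr 0 (v + 1) = s.arr 0 v + _ := h.start_succ ⟨v, hv⟩
    have h2 := I.degree_lt ⟨v, hv⟩
    have := ih (by omega)
    rw [h1, Nat.succ_mul]
    omega

theorem exists_mem_list (h : Encodes I s) {m : ℕ} (hm : m ≤ I.n) {i : ℕ} (hi : i < s.arr 0 m) :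
    ∃ v < m, i ∈ Finset.Ico (s.arr 0 v) (s.arr 0 (v + 1)) := by
  induction m with
  | zero => simp [h.start_zero] at hi
  | succ m ih =>
    by_cases hlt : i < s.arr 0 m
    · obtain ⟨v, hv, hi⟩ := ih (by omega) hlt
      exact ⟨v, by omega, hi⟩
    · exact ⟨m, by omega, Finset.mem_Ico.2 ⟨by omega, hi⟩⟩

theorem bounded (h : Encodes I s) {w : ℕ} (hn : I.n < cap w) (hnn : I.n * I.n < cap w)
    (hc : I.c < cap w) (hk : I.k < cap w) : Bounded w s where
  reg x := by
    match x with
    | 0 => exact h.reg_n ▸ hn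
    | 1 => exact h.reg_c ▸ hc
    | 2 => exact h.reg_k ▸ hk
    | x + 3 => rw [h.reg_rest _ (by omega)]; omega
  arr a i := by
    match a with
    | 0 =>
      by_cases hi : i ≤ I.n
      · exact (h.start_le hi).trans_lt ((Nat.mul_le_mul_right _ hi).trans_lt hnn)
      · rw [h.start_rest i (by omega)]; omega
    | 1 =>
      by_cases hi : i < s.arr 0 I.n
      · obtain ⟨v, hv, hi⟩ := h.exists_mem_list le_rfl hi
        obtain ⟨u, -, e1, -⟩ := h.exists_nbr ⟨v, hv⟩ hi
        have := u.2
        omega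
      · rw [h.neighbor_rest i (by omega)]; omega
    | 2 =>
      by_cases hi : i < I.n
      · have h1 : s.arr 2 i = _ := h.color ⟨i, hi⟩
        have := (I.χ ⟨i, hi⟩).2
        omega
      · rw [h.color_rest i (by omega)]; omega
    | a + 3 => rw [h.arr_rest _ _ (by omega)]; omega

end Encodes

end Encoding

/-! ### The solver -/

section Solver

variable {I : Instance} {s : State}

/-- All numbers that occur are bounded by powers of `2 ^ L`, up to the twelfth. -/
theorem cap_estimates {n c k L w : ℕ} (hn : Nat.log 2 n < L) (hc : Nat.log 2 c < L) (hk : k < L)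
    (hw : 12 * L ≤ w) :
    n * n < cap w ∧ (∀ a ≤ n, k * (a + 1 + 1) + 4 < cap w) ∧ n + 4 < cap w ∧ c < cap w ∧
      k < cap w ∧ (c + 1) * 3 ^ k + 4 < cap w := by
  obtain ⟨X, hX⟩ : ∃ X, 2 ^ L = X := ⟨_, rfl⟩
  have pw : ∀ m < L, 2 ^ (m + 1) ≤ X := fun m hm => hX ▸ Nat.pow_le_pow_right (by omega) hm
  have n1 : n < X := (Nat.lt_pow_succ_log_self (by omega) n).trans_le (pw _ hn)
  have c1 : c < X := (Nat.lt_pow_succ_log_self (by omega) c).trans_le (pw _ hc)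
  have k2 : 2 ^ k ≤ X := hX ▸ Nat.pow_le_pow_right (by omega) hk.le
  have k1 : k < X := Nat.lt_two_pow_self.trans_le k2
  have k3 : 3 ^ k ≤ X * X := calc
    3 ^ k ≤ 4 ^ k := Nat.pow_le_pow_left (by omega) k
    _ = 2 ^ k * 2 ^ k := by rw [← Nat.mul_pow]
    _ ≤ X * X := Nat.mul_le_mul k2 k2
  have X2 : 2 ≤ X := pw 0 (by omega)
  have hcap : X ^ 12 ≤ cap w := by
    rw [← hX, ← pow_mul, cap]
    exact Nat.pow_le_pow_right (by omega) (by omega)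
  have Xm : ∀ m, 2 * X ^ m ≤ X ^ (m + 1) := fun m => by
    rw [pow_succ, mul_comm]; exact Nat.mul_le_mul_left _ X2
  have x1 := Xm 1
  have x2 := Xm 2
  have x3 := Xm 3
  have x4 := Xm 4
  have x5 := Xm 5
  have x6 := Xm 6
  have x7 : X ^ 7 ≤ X ^ 12 := Nat.pow_le_pow_right (by omega) (by omega)
  norm_num only [pow_one] at x1 x2 x3 x4 x5 x6
  have e2 : X * X = X ^ 2 := by ring
  have m1 : n * n ≤ X ^ 2 := e2 ▸ Nat.mul_le_mul n1.le n1.le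
  have m2 : (c + 1) * 3 ^ k ≤ X ^ 3 := by
    calc (c + 1) * 3 ^ k ≤ X * (X * X) := Nat.mul_le_mul c1 k3
      _ = X ^ 3 := by ring
  refine ⟨by omega, fun a ha => ?_, by omega, by omega, by omega, by omega⟩
  have m3 : k * (a + 1 + 1) ≤ X * (2 * X) := Nat.mul_le_mul k1.le (by omega)
  have e3 : X * (2 * X) = 2 * X ^ 2 := by ring
  omega

/-- The number of combinations at one root, times the time for one combination; this is where the
factor `(3e)^k` comes from. -/
theorem choose_mul_unit_le (G : Data) (hk : 1 ≤ G.k) (hd : 1 ≤ G.d) :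
    (((G.k * G.d + 1).choose (G.k - 1) * G.unit : ℕ) : ℝ) ≤
      3 * ((3 * Real.exp 1) ^ G.k * (G.d : ℝ) ^ G.k * G.c * (G.k : ℝ) ^ 2) := by
  obtain ⟨m, hm⟩ : ∃ m, G.k = m + 1 := ⟨G.k - 1, by omega⟩
  have hchoose : (((G.k * G.d + 1).choose (G.k - 1) : ℕ) : ℝ) ≤
      (G.d : ℝ) ^ m * (3 * Real.exp 1 ^ G.k) := by
    rw [hm, Nat.add_sub_cancel]
    have h1 : ((((m + 1) * G.d + 1).choose m : ℕ) : ℝ) ≤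
        (((m + 1) * G.d + 1 : ℕ) : ℝ) ^ m / (m.factorial : ℝ) := Nat.choose_le_pow_div _ _
    have h2 : (((m + 1) * G.d + 1 : ℕ) : ℝ) ≤ (G.d : ℝ) * ((m + 2 : ℕ) : ℝ) := by
      have : (m + 1) * G.d + 1 ≤ G.d * (m + 2) := by nlinarith
      exact_mod_cast this
    have h3 : ((m + 2 : ℕ) : ℝ) ^ m / (m.factorial : ℝ) ≤ Real.exp ((m + 2 : ℕ) : ℝ) :=
      Real.pow_div_factorial_le_exp _ (Nat.cast_nonneg _) m
    have h4 : Real.exp ((m + 2 : ℕ) : ℝ) = Real.exp 1 * Real.exp 1 ^ (m + 1) := by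
      rw [← pow_succ', ← Real.exp_nat_mul, mul_one]
    have h5 : Real.exp 1 ≤ 3 := Real.exp_one_lt_three.le
    calc _ ≤ (((m + 1) * G.d + 1 : ℕ) : ℝ) ^ m / (m.factorial : ℝ) := h1
      _ ≤ ((G.d : ℝ) * ((m + 2 : ℕ) : ℝ)) ^ m / (m.factorial : ℝ) := by gcongr
      _ = (G.d : ℝ) ^ m * (((m + 2 : ℕ) : ℝ) ^ m / (m.factorial : ℝ)) := by
        rw [mul_pow, mul_div_assoc]
      _ ≤ (G.d : ℝ) ^ m * (3 * Real.exp 1 ^ (m + 1)) := by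
        rw [h4] at h3
        gcongr
        exact h3.trans (by gcongr)
  have hunit : ((G.unit : ℕ) : ℝ) = (G.k : ℝ) ^ 2 * (G.d : ℝ) * G.c * 3 ^ G.k := by
    rw [Data.unit]
    push_cast
    ring
  rw [Nat.cast_mul, hunit]
  calc _ ≤ ((G.d : ℝ) ^ m * (3 * Real.exp 1 ^ G.k)) *
        ((G.k : ℝ) ^ 2 * (G.d : ℝ) * G.c * 3 ^ G.k) := by
        gcongr
    _ = 3 * ((3 * Real.exp 1) ^ G.k * ((G.d : ℝ) ^ m * G.d) * G.c * (G.k : ℝ) ^ 2) := by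
        rw [mul_pow]
        ring
    _ = _ := by rw [← pow_succ, hm]

theorem Data.total_time_le (G : Data) (hk : 1 ≤ G.k) (hd : 1 ≤ G.d) (hc : 1 ≤ G.c) (hn : 1 ≤ G.n) :
    G.n * ((G.k * G.d + 1).choose (G.k - 1) * (2000 * G.unit + 20) + G.k * 30 + 100) + G.n * 90 + 80
      ≤ 3000 * (G.n * ((G.k * G.d + 1).choose (G.k - 1) * G.unit)) := by
  obtain ⟨B, hB⟩ : ∃ B, (G.k * G.d + 1).choose (G.k - 1) = B := ⟨_, rfl⟩
  have hB1 : 1 ≤ B := by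
    rw [← hB]
    refine Nat.choose_pos ?_
    have := Nat.le_mul_of_pos_right G.k hd
    omega
  have hU : G.k ≤ G.unit := by
    rw [Data.unit]
    refine Nat.le_mul_of_pos_right _ ?_
    have : 1 ≤ 3 ^ G.k := Nat.one_le_pow _ _ (by norm_num)
    positivity
  obtain ⟨U, hU'⟩ : ∃ U, G.unit = U := ⟨_, rfl⟩
  rw [hU'] at hU
  rw [hB, hU']
  have h1 : U ≤ B * U := Nat.le_mul_of_pos_left _ hB1
  have h2 : B ≤ B * U := Nat.le_mul_of_pos_right _ (by omega)
  have h3 : B * (2000 * U + 20) = 2000 * (B * U) + 20 * B := by ring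
  have h4 : B * (2000 * U + 20) + G.k * 30 + 100 ≤ 2200 * (B * U) := by omega
  have h5 := Nat.mul_le_mul_left G.n h4
  have h6 : G.n * (2200 * (B * U)) = 2200 * (G.n * (B * U)) := by ring
  have h7 : G.n ≤ G.n * (B * U) := Nat.le_mul_of_pos_right _ (by omega)
  omega

/-- Correctness and time of the solver. The degree bound `d` that it computes is `max 1 (Δ - 1)`;
only the upper bound for it matters. -/
theorem wp_solver {w : ℕ} (h : Encodes I s)
    (hw : 12 * (I.k + Nat.log 2 I.n + Nat.log 2 I.c + 1) ≤ w) :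
    WP w solver s fun t s' => Answers I s' ∧ (1 ≤ I.k → ∃ d, 1 ≤ d ∧ d ≤ max 1 (I.maxDegree - 1) ∧
      t ≤ I.n * ((I.k * d + 1).choose (I.k - 1) * (2000 * (I.data s d).unit + 20) + I.k * 30 +
        100) + I.n * 90 + 80) := by
  obtain ⟨b1, b2, b3, b4, b5, b6⟩ := cap_estimates (n := I.n) (c := I.c) (k := I.k) (by omega)
    (by omega) (by omega) hw
  have hb : Bounded w s := h.bounded (by omega) b1 b4 b5
  have w0 : 0 < cap w := by omega
  have w1 : 1 < cap w := by omega
  rw [solver, wp_seq, wp_ite]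
  refine ⟨by simp [hb.reg, w0], fun hk => ?_, fun hk => ?_⟩
  · simp only [Test.holds_lt, Expr.eval_const, Expr.eval_reg] at hk
    rw [h.reg_k] at hk
    rw [wp_seq]
    refine (wp_degBound hb (h.mem 1) b3).conseq hb ?_
    rintro t₁ s₁ hb₁ hF₁ ⟨ht₁, hd1, hdeg, hdmax⟩
    obtain ⟨d, hd⟩ : ∃ d, s₁.reg rD = d := ⟨_, rfl⟩
    rw [hd] at hd1 hdeg hdmax
    have hdle : d ≤ max 1 (I.maxDegree - 1) ∧ d ≤ I.n + 1 := by
      rcases hdmax with rfl | ⟨v, hv, e⟩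
      · exact ⟨le_max_left _ _, by omega⟩
      · have e1 : s.arr 0 (v + 1) = s.arr 0 v + (d + 1) := e
        have e2 : s.arr 0 (v + 1) = s.arr 0 v + _ := h.start_succ ⟨v, hv⟩
        have e3 := I.degree_le ⟨v, hv⟩
        have e4 := I.degree_lt ⟨v, hv⟩
        exact ⟨le_max_of_le_right (by omega), by omega⟩
    have hG : (I.data s d).Valid := h.valid hk hd1 hdeg
    have hM₁ : Mem (I.data s d) s₁ := (h.mem d).frame hF₁ rfl
    have hkd : I.k * d + 1 < cap w := by
      have h1 := b2 I.n le_rfl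
      have h2 := Nat.mul_le_mul_left I.k (show d + 1 ≤ I.n + 1 + 1 by omega)
      rw [Nat.mul_succ] at h2
      omega
    have hS : (I.data s d).Small w := ⟨b3, by
      have h1 := b2 I.n le_rfl
      have h2 := Nat.mul_le_mul_left I.k (show d + 1 ≤ I.n + 1 + 1 by omega)
      exact (Nat.add_le_add_right h2 4).trans_lt h1, b6⟩
    rw [wp_seq, wp_set]
    have ev : (reg rK * reg rD + const 1).eval s₁ = I.k * d + 1 := by
      simp only [Expr.eval_add, Expr.eval_mul, Expr.eval_reg, Expr.eval_const]
      rw [hd, hM₁.k]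
      rfl
    have hkd' : I.k * d < cap w := by omega
    refine ⟨?_, ?_⟩
    · have eK : s₁.reg rK = I.k := hM₁.k
      have hdw : d < cap w := hd ▸ hb₁.reg rD
      simp [eK, hd, w1, hkd, hkd', b5, hdw]
    rw [ev]
    have hb₂ : Bounded w (s₁.setReg rM (I.k * d + 1)) := hb₁.setReg hkd
    refine (wp_search hG hb₂ hS (hM₁.setReg (by omega)) ?_ ?_).conseq hb₂ ?_
    · rw [State.setReg_reg, if_neg (by omega), hF₁.reg rFound rfl]
      exact h.reg_rest _ (by omega)
    · rw [State.setReg_reg, if_pos rfl]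
      rfl
    rintro t₂ s₂ hb₂ hF₂ ⟨ht₂, hres⟩
    have en : s₂.reg rN = I.n := by
      rw [hF₂.reg rN rfl, State.setReg_reg, if_neg (by omega)]
      exact hM₁.n
    refine (wp_output hb₂ en (by omega)).mono ?_
    rintro t₃ s₃ ⟨ht₃, hN, hout⟩
    refine ⟨?_, fun _ => ⟨d, hd1, hdle.1, ?_⟩⟩
    · rcases hres with ⟨hf, himp⟩ | ⟨hf, -, hst⟩
      · refine Or.inl ⟨hN.trans hf, fun v => ⟨s₂.arr aCol v, himp.lt v v.2⟩, ?_,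
          fun v => hout v v.2⟩
        exact (h.improves_iff d fun v => rfl).1 himp
      · exact Or.inr ⟨hN.trans hf, fun ⟨χ', hχ⟩ => h.not_improving_of_stuck hG hst χ' hχ⟩
    · have ht₁ : t₁ ≤ I.n * 60 + 20 := ht₁
      have ht₂ : t₂ ≤ I.n * ((I.k * d + 1).choose (I.k - 1) * (2000 * (I.data s d).unit + 20) +
        I.k * 30 + 100) + 20 := ht₂
      simp only [Test.cost_lt, Expr.cost_add, Expr.cost_mul, Expr.cost_reg, Expr.cost_const]
      omega
  · simp only [Test.holds_lt, Expr.eval_const, Expr.eval_reg] at hk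
    rw [h.reg_k] at hk
    rw [wp_skip]
    refine (wp_output hb h.reg_n (by omega)).mono ?_
    rintro t s' ⟨-, hN, -⟩
    exact ⟨Or.inr ⟨hN.trans (h.reg_rest _ (by omega)),
      fun ⟨χ', hχ⟩ => Encodes.not_improving_of_k_eq_zero (by omega) χ' hχ⟩, by omega⟩

end Solver

end LSCut

open LSCut in
/-- LS Max `c`-Cut, in its search version, is solved by one program on a machine with words of
`O(k + log n + log c)` bits; its running time is `O((3e)^k (Δ - 1)^(k+1) c k³ n)` on the instances
with `Δ ≥ 2` and `k ≥ 1`. -/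
theorem mainTheorem1 :
    ∃ (P : Program) (C : ℕ), ∀ (I : Instance) (s : State), Encodes I s →
      ∃ (t : ℕ) (s' : State),
        Runs (C * (I.k + Nat.log 2 I.n + Nat.log 2 I.c + 1)) P s t s' ∧
        Answers I s' ∧
        (2 ≤ I.maxDegree → 1 ≤ I.k →
          (t : ℝ) ≤ C * ((3 * Real.exp 1) ^ I.k * ((I.maxDegree : ℝ) - 1) ^ (I.k + 1) *
            I.c * (I.k : ℝ) ^ 3 * I.n)) := by
  refine ⟨solver, 9000, fun I s h => ?_⟩
  obtain ⟨t, s', hr, hans, ht⟩ := wp_solver (w := 9000 * (I.k + Nat.log 2 I.n + Nat.log 2 I.c + 1))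
    h (Nat.mul_le_mul_right _ (by omega))
  refine ⟨t, s', hr, hans, fun hΔ hk => ?_⟩
  obtain ⟨d, hd1, hd2, ht⟩ := ht hk
  have hn : 1 ≤ I.n := by
    classical
    by_contra hn
    have : IsEmpty (Fin I.n) := ⟨fun v => hn (v.pos)⟩
    have h0 : I.maxDegree = 0 := by
      rw [Instance.maxDegree]
      exact SimpleGraph.maxDegree_of_subsingleton _
    omega
  have hc : 1 ≤ I.c := (Nat.zero_le _).trans_lt (I.χ ⟨0, hn⟩).2
  have ht2 := ht.trans ((I.data s d).total_time_le hk hd1 hc hn)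
  have ht3 : (t : ℝ) ≤ 3000 * ((I.n : ℝ) *
      (((I.k * d + 1).choose (I.k - 1) * (I.data s d).unit : ℕ) : ℝ)) := by
    exact_mod_cast ht2
  have hdR : (d : ℝ) ≤ (I.maxDegree : ℝ) - 1 := by
    have : d + 1 ≤ I.maxDegree := by omega
    have : ((d + 1 : ℕ) : ℝ) ≤ I.maxDegree := Nat.cast_le.2 this
    push_cast at this
    linarith
  have hd1R : (1 : ℝ) ≤ d := by exact_mod_cast hd1
  have hkR : (1 : ℝ) ≤ I.k := by exact_mod_cast hk
  have hpow : (d : ℝ) ^ I.k ≤ ((I.maxDegree : ℝ) - 1) ^ (I.k + 1) :=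
    (pow_le_pow_right₀ hd1R (by omega)).trans (pow_le_pow_left₀ (by linarith) hdR _)
  have hk3 : (I.k : ℝ) ^ 2 ≤ (I.k : ℝ) ^ 3 := pow_le_pow_right₀ hkR (by omega)
  have hΔR : (0 : ℝ) ≤ (I.maxDegree : ℝ) - 1 := by linarith
  have hcu := choose_mul_unit_le (I.data s d) hk hd1
  calc (t : ℝ) ≤ _ := ht3
    _ ≤ 3000 * ((I.n : ℝ) *
        (3 * ((3 * Real.exp 1) ^ I.k * (d : ℝ) ^ I.k * I.c * (I.k : ℝ) ^ 2))) := by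
      gcongr
      exact hcu
    _ ≤ 3000 * ((I.n : ℝ) * (3 * ((3 * Real.exp 1) ^ I.k *
        ((I.maxDegree : ℝ) - 1) ^ (I.k + 1) * I.c * (I.k : ℝ) ^ 3))) := by
      gcongr
    _ = _ := by
      push_cast
      ring
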